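/- Let $\mathbf k$ be a field. Let $\mathrm{Aut}(\mathbb A^2)$ be the group, under composition, of polynomial automorphisms $\phi=(f_1,f_2)$, $f_1,f_2\in\mathbf k[x,y]$, of the affine plane over $\mathbf k$, and let $$\mathrm{Aff}=\{(a_{11}x+a_{12}y+a_{13},\,a_{21}x+a_{22}y+a_{23}) : a_{ij}\in\mathbf k,\ a_{11}a_{22}-a_{12}a_{21}\neq 0\},$$ $$\mathbb J=\{(ax+P(y),\,by+c) : a,b\in\mathbf k\setminus\{0\},\ c\in\mathbf k,\ P\in\mathbf k[y]\}$$ be its affine and de Jonquières subgroups. An algorithm here is a finite program that works on finite binary trees whose leaves are either empty or labelled by elements of $\mathbf k$. It may build and take apart trees, use the constants $0,1$ and the operations $+,\cdot,-,{}^{-1}$ of $\mathbf k$ (with $0^{-1}=0$), test whether an element of $\mathbf k$ is zero, test the shape of a tree, branch, and loop. A polynomial is given to, or returned by, a program as a finite list of terms $(i,j,c)$ with sum $\sum c\,x^iy^j$, the exponents being written in unary, and an automorphism as the pair of its two components. **Theorem.** There is an algorithm, one and the same program for all fields $\mathbf k$, with the following property. Given any finite list of elements $g_1,\dots,g_n\in\mathrm{Aut}(\mathbb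 A^2)$ generating a subgroup $H=\langle g_1,\dots,g_n\rangle$, the algorithm halts and decides whether $H$ is conjugate in $\mathrm{Aut}(\mathbb A^2)$ to a subgroup of $\mathrm{Aff}$ or to a subgroup of $\mathbb J$. If it is, the algorithm outputs a conjugator, that is, an automorphism $\theta\in\mathrm{Aut}(\mathbb A^2)$ with $\theta H\theta^{-1}\subseteq\mathrm{Aff}$ or $\theta H\theta^{-1}\subseteq\mathbb J$. -/

import Mathlib

/-! ### The automorphism group of the affine plane -/

/-- The group `Aut(𝔸²)` of automorphisms of the affine plane over `k`. An automorphism is recorded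
by its comorphism, a `k`-algebra automorphism of `k[x, y]`, where `x = X 0` and `y = X 1`. Since
`φ ↦ φ^*` is contravariant, the group is the opposite of the group of algebra automorphisms; the
product is then the composition of maps, see `PlaneAut.component_mul`. -/
abbrev PlaneAut (k : Type*) [Field k] : Type _ :=
  (MvPolynomial (Fin 2) k ≃ₐ[k] MvPolynomial (Fin 2) k)ᵐᵒᵖ

namespace PlaneAut

open MvPolynomial

variable {k : Type*} [Field k]

/-- The components of `φ = (f₁, f₂)`. -/
noncomputable def component (φ : PlaneAut k) (i : Fin 2) : MvPolynomial (Fin 2) k :=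
  φ.unop (X i)

/-- `φ * ψ` is the composition `φ ∘ ψ` of polynomial maps: its `i`-th component is obtained by
substituting the components of `ψ` into the `i`-th component of `φ`. -/
theorem component_mul (φ ψ : PlaneAut k) (i : Fin 2) :
    (φ * ψ).component i = aeval ψ.component (φ.component i) := by
  have h : (ψ.unop : MvPolynomial (Fin 2) k →ₐ[k] MvPolynomial (Fin 2) k)
      = aeval ψ.component := by
    ext j
    simp [component]
  have h2 := DFunLike.congr_fun h (φ.component i)
  simpa [component] using h2

/-- `φ` has the form `(a₁₁x + a₁₂y + a₁₃, a₂₁x + a₂₂y + a₂₃)` with `a₁₁a₂₂ - a₁₂a₂₁ ≠ 0`. -/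
def IsAffine (φ : PlaneAut k) : Prop :=
  ∃ a₁₁ a₁₂ a₁₃ a₂₁ a₂₂ a₂₃ : k, a₁₁ * a₂₂ - a₁₂ * a₂₁ ≠ 0 ∧
    φ.component 0 = C a₁₁ * X 0 + C a₁₂ * X 1 + C a₁₃ ∧
    φ.component 1 = C a₂₁ * X 0 + C a₂₂ * X 1 + C a₂₃

/-- `φ` has the form `(ax + P(y), by + c)` with `a ≠ 0` and `b ≠ 0`. -/
def IsDeJonquieres (φ : PlaneAut k) : Prop :=
  ∃ (a b c : k) (P : Polynomial k), a ≠ 0 ∧ b ≠ 0 ∧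
    φ.component 0 = C a * X 0 + Polynomial.aeval (X 1) P ∧
    φ.component 1 = C b * X 1 + C c

theorem component_inv_mul (φ : PlaneAut k) (i : Fin 2) :
    aeval φ⁻¹.component (φ.component i) = X i := by
  rw [← component_mul, mul_inv_cancel]
  simp [component]

variable (k) in
/-- The affine group `Aff`. -/
def affineGroup : Subgroup (PlaneAut k) where
  carrier := {φ | IsAffine φ}
  one_mem' := ⟨1, 0, 0, 0, 1, 0, by simp, by simp [component], by simp [component]⟩
  mul_mem' := by
    rintro φ ψ ⟨a, b, c, d, e, f, h, h0, h1⟩ ⟨a', b', c', d', e', f', h', h0', h1'⟩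
    refine ⟨a * a' + b * d', a * b' + b * e', a * c' + b * f' + c,
      d * a' + e * d', d * b' + e * e', d * c' + e * f' + f, ?_, ?_, ?_⟩
    · have : (a * a' + b * d') * (d * b' + e * e') - (a * b' + b * e') * (d * a' + e * d')
        = (a * e - b * d) * (a' * e' - b' * d') := by ring
      rw [this]
      exact mul_ne_zero h h'
    · rw [component_mul, h0]
      simp only [map_add, map_mul, aeval_X, aeval_C, algebraMap_eq, h0', h1']
      ring
    · rw [component_mul, h1]
      simp only [map_add, map_mul, aeval_X, aeval_C, algebraMap_eq, h0', h1']
      ring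
  inv_mem' := by
    rintro φ ⟨a, b, c, d, e, f, h, h0, h1⟩
    have e0 := component_inv_mul φ 0
    have e1 := component_inv_mul φ 1
    rw [h0] at e0
    rw [h1] at e1
    simp only [map_add, map_mul, aeval_X, aeval_C, algebraMap_eq] at e0 e1
    set D : k := a * e - b * d with hD
    have hC : (C D⁻¹ : MvPolynomial (Fin 2) k) * (C a * C e - C b * C d) = 1 := by
      rw [← C_mul, ← C_mul, ← C_sub, ← C_mul, inv_mul_cancel₀ h, C_1]
    refine ⟨D⁻¹ * e, -(D⁻¹ * b), D⁻¹ * (b * f - e * c), -(D⁻¹ * d), D⁻¹ * a,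
      D⁻¹ * (d * c - a * f), ?_, ?_, ?_⟩
    · have : D⁻¹ * e * (D⁻¹ * a) - -(D⁻¹ * b) * -(D⁻¹ * d) = D⁻¹ * (D⁻¹ * D) := by
        rw [hD]; ring
      rw [this, inv_mul_cancel₀ h, mul_one]
      exact inv_ne_zero h
    · simp only [C_mul, C_sub, C_neg]
      linear_combination (-component φ⁻¹ 0) * hC + (C D⁻¹ * C e) * e0 - (C D⁻¹ * C b) * e1
    · simp only [C_mul, C_sub, C_neg]
      linear_combination (-component φ⁻¹ 1) * hC - (C D⁻¹ * C d) * e0 + (C D⁻¹ * C a) * e1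

variable (k) in
/-- The de Jonquières group `𝕁`. -/
def deJonquieresGroup : Subgroup (PlaneAut k) where
  carrier := {φ | IsDeJonquieres φ}
  one_mem' := ⟨1, 1, 0, 0, by simp, by simp, by simp [component], by simp [component]⟩
  mul_mem' := by
    rintro φ ψ ⟨a, b, c, P, ha, hb, h0, h1⟩ ⟨a', b', c', P', ha', hb', h0', h1'⟩
    refine ⟨a * a', b * b', b * c' + c,
      Polynomial.C a * P' + P.comp (Polynomial.C b' * Polynomial.X + Polynomial.C c'),
      mul_ne_zero ha ha', mul_ne_zero hb hb', ?_, ?_⟩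
    · rw [component_mul, h0]
      simp only [map_add, map_mul, aeval_X, aeval_C, algebraMap_eq, h0',
        ← Polynomial.aeval_algHom_apply, Polynomial.aeval_comp, Polynomial.aeval_X,
        Polynomial.aeval_C, h1']
      ring
    · rw [component_mul, h1]
      simp only [map_add, map_mul, aeval_X, aeval_C, algebraMap_eq, h1']
      ring
  inv_mem' := by
    rintro φ ⟨a, b, c, P, ha, hb, h0, h1⟩
    have e0 := component_inv_mul φ 0
    have e1 := component_inv_mul φ 1
    rw [h0] at e0
    rw [h1] at e1
    simp only [map_add, map_mul, aeval_X, aeval_C, algebraMap_eq,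
      ← Polynomial.aeval_algHom_apply] at e0 e1
    have hA : (C a⁻¹ : MvPolynomial (Fin 2) k) * C a = 1 := by
      rw [← C_mul, inv_mul_cancel₀ ha, C_1]
    have hB : (C b⁻¹ : MvPolynomial (Fin 2) k) * C b = 1 := by
      rw [← C_mul, inv_mul_cancel₀ hb, C_1]
    have f1 : component φ⁻¹ 1 = C b⁻¹ * X 1 + C (-(b⁻¹ * c)) := by
      simp only [C_mul, C_neg]
      linear_combination (-component φ⁻¹ 1) * hB + C b⁻¹ * e1
    refine ⟨a⁻¹, b⁻¹, -(b⁻¹ * c), -(Polynomial.C a⁻¹ *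
      P.comp (Polynomial.C b⁻¹ * Polynomial.X + Polynomial.C (-(b⁻¹ * c)))),
      inv_ne_zero ha, inv_ne_zero hb, ?_, f1⟩
    rw [f1] at e0
    simp only [map_neg, map_mul, Polynomial.aeval_comp, map_add, Polynomial.aeval_X,
      Polynomial.aeval_C, algebraMap_eq] at e0 ⊢
    linear_combination (-component φ⁻¹ 0) * hA + C a⁻¹ * e0

/-- The automorphism `θ` conjugates `H` into one of the factors:
`θ H θ⁻¹ ⊆ Aff` or `θ H θ⁻¹ ⊆ 𝕁`. -/
def IsConjugator (θ : PlaneAut k) (H : Subgroup (PlaneAut k)) : Prop :=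
  H.map (MulAut.conj θ).toMonoidHom ≤ affineGroup k ∨
    H.map (MulAut.conj θ).toMonoidHom ≤ deJonquieresGroup k

end PlaneAut

/-! ### Algorithms over a field

A program works on finite binary trees whose leaves are empty or carry an element of the field. It
can build and take apart trees, perform field operations, test whether a field element is zero,
branch, and loop. Programs are finite and mention no field. -/

/-- The data: finite binary trees whose leaves are empty or labelled by elements of `k`. -/
inductive FieldData (k : Type*) : Type _
  | nil : FieldData k
  | atom (a : k) : FieldData k
  | pair (s t : FieldData k) : FieldData k

/-- The programs, each denoting a partial function from data to data. As a truth value, `nil` is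
false and every other datum is true. -/
inductive FieldProg : Type
  /-- the identity -/
  | id : FieldProg
  /-- the constant `nil` -/
  | nil : FieldProg
  /-- the constant `0` of the field -/
  | zero : FieldProg
  /-- the constant `1` of the field -/
  | one : FieldProg
  /-- the left subtree -/
  | fst : FieldProg
  /-- the right subtree -/
  | snd : FieldProg
  /-- addition of two field elements -/
  | add : FieldProg
  /-- multiplication of two field elements -/
  | mul : FieldProg
  /-- the additive inverse of a field element -/
  | neg : FieldProg
  /-- the multiplicative inverse of a field element (with `0⁻¹ = 0`) -/
  | inv : FieldProg
  /-- is the datum a field element? -/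
  | isAtom : FieldProg
  /-- is the datum the field element `0`? -/
  | isZero : FieldProg
  /-- run both programs on the input and pair the results -/
  | pair (p q : FieldProg) : FieldProg
  /-- run `q`, then `p` on the result -/
  | comp (p q : FieldProg) : FieldProg
  /-- run `c`; if the result is true run `p` on the input, otherwise run `q` on the input -/
  | cond (c p q : FieldProg) : FieldProg
  /-- while `c` is true of the current datum, replace that datum by the result of `p` -/
  | loop (c p : FieldProg) : FieldProg

namespace FieldData

variable {k : Type*}

/-- The truth values as data. -/
def ofBool : Bool → FieldData k
  | false => nil
  | true => pair nil nil

/-- Natural numbers as data, in unary. -/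
def ofNat : ℕ → FieldData k
  | 0 => nil
  | n + 1 => pair nil (ofNat n)

/-- Finite lists of data as data. -/
def ofList : List (FieldData k) → FieldData k
  | [] => nil
  | s :: l => pair s (ofList l)

/-- The left subtree (`nil` if there is none). -/
def fst : FieldData k → FieldData k
  | pair s _ => s
  | _ => nil

/-- The right subtree (`nil` if there is none). -/
def snd : FieldData k → FieldData k
  | pair _ t => t
  | _ => nil

/-- Apply a unary operation to a field element (`nil` on other data). -/
def map₁ (f : k → k) : FieldData k → FieldData k
  | atom a => atom (f a)
  | _ => nil

/-- Apply a binary operation to a pair of field elements (`nil` on other data). -/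
def map₂ (f : k → k → k) : FieldData k → FieldData k
  | pair (atom a) (atom b) => atom (f a b)
  | _ => nil

/-- Is the datum a field element? -/
def isAtom : FieldData k → Bool
  | atom _ => true
  | _ => false

open Classical in
/-- Is the datum the field element `0`? -/
noncomputable def isZero [Zero k] : FieldData k → Bool
  | atom a => decide (a = 0)
  | _ => false

/-- Is the datum true, that is, different from `nil`? -/
def truth : FieldData k → Bool
  | nil => false
  | _ => true

end FieldData

/-- The partial function computed by a program over the field `k`; it is undefined at the data on
which the program does not halt. -/
noncomputable def FieldProg.eval {k : Type*} [Field k] : FieldProg → FieldData k →. FieldData k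
  | .id, s => Part.some s
  | .nil, _ => Part.some .nil
  | .zero, _ => Part.some (.atom 0)
  | .one, _ => Part.some (.atom 1)
  | .fst, s => Part.some s.fst
  | .snd, s => Part.some s.snd
  | .add, s => Part.some (s.map₂ (· + ·))
  | .mul, s => Part.some (s.map₂ (· * ·))
  | .neg, s => Part.some (s.map₁ (- ·))
  | .inv, s => Part.some (s.map₁ (·⁻¹))
  | .isAtom, s => Part.some (.ofBool s.isAtom)
  | .isZero, s => Part.some (.ofBool s.isZero)
  | .pair p q, s => (p.eval s).bind fun t => (q.eval s).map fun t' => .pair t t'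
  | .comp p q, s => (q.eval s).bind p.eval
  | .cond c p q, s => (c.eval s).bind fun b => bif b.truth then p.eval s else q.eval s
  | .loop c p, s => PFun.fix (fun t => (c.eval t).bind fun b =>
      bif b.truth then (p.eval t).map Sum.inr else Part.some (Sum.inl t)) s

/-! ### Presenting automorphisms to a program -/

/-- A written-out polynomial in two variables: a finite list of terms `(i, j, c)`, each standing
for `c xⁱ yʲ`. Repeated exponents and zero coefficients are allowed. -/
abbrev TermList (k : Type*) : Type _ := List (ℕ × ℕ × k)

namespace TermList

variable {k : Type*}

/-- The polynomial denoted by a list of terms. -/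
noncomputable def toPoly [Field k] (l : TermList k) : MvPolynomial (Fin 2) k :=
  (l.map fun t => MvPolynomial.C t.2.2 * MvPolynomial.X 0 ^ t.1 * MvPolynomial.X 1 ^ t.2.1).sum

/-- A list of terms as a datum. -/
def toData (l : TermList k) : FieldData k :=
  .ofList (l.map fun t => .pair (.ofNat t.1) (.pair (.ofNat t.2.1) (.atom t.2.2)))

end TermList

/-- A pair of written-out polynomials as a datum. -/
def TermList.pairToData {k : Type*} (w : TermList k × TermList k) : FieldData k :=
  .pair w.1.toData w.2.toData

/-- The pair `w` of written-out polynomials presents the automorphism `φ = (f₁, f₂)`. -/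
def PlaneAut.PresentedBy {k : Type*} [Field k] (φ : PlaneAut k) (w : TermList k × TermList k) :
    Prop :=
  φ.component 0 = w.1.toPoly ∧ φ.component 1 = w.2.toPoly

/-! Suppose `H` is conjugate into a factor. A subgroup of `Aff` preserves the ordinary degree.
Finitely many elements of `𝕁` and their inverses preserve the degree with weight `w` on `x` and `1`
on `y`, as soon as `w` bounds the degrees of all the polynomials `P` involved. Transporting along
the conjugator gives a substitution `T` for which every generator preserves the degree of `T f`
(`PreservesDegree`, `IsConjugator.preservesDegree`). The algorithm does not know this degree, but
its existence forces the search to succeed.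

Let `α`, `β` be the degrees of `T x`, `T y`, and call an automorphism good if it is affine or de
Jonquières. If all generators are good, then comparing `α` with `β` puts them all into one factor
(`PreservesDegree.forall_or_forall`). If `g` is not good, then either `deg g₀ < deg g₁` and `α < β`,
or there are `m` and `c` with `deg g₀ = m deg g₁`, `α = m β`, a drop of degree in `g₀ - c g₁ ^ m`,
and top part a multiple of a power of `x - c y ^ m` in both components of `g`
(`exists_edge_component_of_not_good`). Conjugating by `(y, x)`, respectively by `(x - c y ^ m, y)`,
lowers the complexity of `g`. It also keeps good generators good, because the relation between `α`
and `β` puts them into one factor together with the conjugating map (`PreservesDegree.step`). Since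
`m` and `c` can be read off from `g` alone, the generators can be simplified one after another; a
direct test of the resulting conjugates decides the answer.

The top part comes from `exists_isEdged`: if substituting into a coordinate `f` gives a smaller
degree than the weights predict, the top part of `f` is `c (x ^ a - μ y ^ b) ^ e` with `a = 1` or `b
= 1`. It is applied to the components of `g⁻¹`, since substituting `g` there collapses them to `x`
and `y`; invariance of the degree under `g` then makes `T` cancel along the same binomial. The proof
works in every characteristic. Cancellation makes the leading coefficients satisfy `A ^ a = μ B ^
b`, so the binomial divides the top part of `f`. The Hasse derivatives along a complementary
coordinate kill `f`. The index at which they last attain their maximal expansion rate `K` (`IsDom`)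
is additive on products, so it vanishes on the binomial as well. All indices then have the form `r
(b i + a l)`, while a well-chosen derivative of `x` or `y` has an index dividing `r`; this forces `a
= 1` or `b = 1`. -/

/-! ### Monomial norms on the polynomial ring. -/

open MvPolynomial in
theorem MvPolynomial.eq_sum_support_fin_two {k : Type*} [Field k] (f : MvPolynomial (Fin 2) k) :
    f = ∑ d ∈ f.support, C (f.coeff d) * (X 0 ^ d 0 * X 1 ^ d 1) := by
  conv_lhs => rw [f.as_sum]
  refine Finset.sum_congr rfl fun d _ => ?_
  rw [monomial_eq, Finsupp.prod_fintype _ _ (by simp)]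
  simp

/-- A multiplicative nonarchimedean norm on `k[x, y]` for which every polynomial has the largest
norm of its monomials. -/
structure MonomialNorm (k : Type*) [Field k] where
  /-- the underlying function -/
  N : MvPolynomial (Fin 2) k → ℝ
  zero : N 0 = 0
  pos : ∀ f, f ≠ 0 → 0 < N f
  mul : ∀ f g, N (f * g) = N f * N g
  add : ∀ f g, N (f + g) ≤ max (N f) (N g)
  const : ∀ c : k, c ≠ 0 → N (MvPolynomial.C c) = 1
  coeff : ∀ f d, MvPolynomial.coeff d f ≠ 0 →
    N (MvPolynomial.X 0) ^ d 0 * N (MvPolynomial.X 1) ^ d 1 ≤ N f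

namespace MonomialNorm

open MvPolynomial

variable {k : Type*} [Field k] (ν : MonomialNorm k)

theorem nonneg (f : MvPolynomial (Fin 2) k) : 0 ≤ ν.N f := by
  by_cases h : f = 0
  · rw [h, ν.zero]
  · exact (ν.pos f h).le

theorem one : ν.N 1 = 1 := by
  rw [← C_1]; exact ν.const 1 one_ne_zero

theorem pow (f : MvPolynomial (Fin 2) k) (n : ℕ) : ν.N (f ^ n) = ν.N f ^ n := by
  induction n with
  | zero => simp [ν.one]
  | succ n ih => rw [pow_succ, ν.mul, ih, pow_succ]

theorem const_le (c : k) : ν.N (C c) ≤ 1 := by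
  by_cases h : c = 0
  · rw [h, C_0, ν.zero]; exact zero_le_one
  · exact (ν.const c h).le

theorem neg (f : MvPolynomial (Fin 2) k) : ν.N (-f) = ν.N f := by
  have : -f = C (-1) * f := by simp
  rw [this, ν.mul, ν.const _ (by simp), one_mul]

theorem sub (f g : MvPolynomial (Fin 2) k) : ν.N (f - g) ≤ max (ν.N f) (ν.N g) := by
  rw [sub_eq_add_neg, ← ν.neg g]; exact ν.add _ _

theorem sum_le {ι : Type*} (s : Finset ι) (f : ι → MvPolynomial (Fin 2) k) {B : ℝ} (hB : 0 ≤ B)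
    (h : ∀ i ∈ s, ν.N (f i) ≤ B) : ν.N (∑ i ∈ s, f i) ≤ B := by
  refine Finset.sum_induction f (fun g => ν.N g ≤ B) (fun a b ha hb => ?_) ?_ h
  · exact (ν.add a b).trans (max_le ha hb)
  · simpa [ν.zero] using hB

theorem sum_lt {ι : Type*} (s : Finset ι) (f : ι → MvPolynomial (Fin 2) k) {B : ℝ} (hB : 0 < B)
    (h : ∀ i ∈ s, ν.N (f i) < B) : ν.N (∑ i ∈ s, f i) < B := by
  refine Finset.sum_induction f (fun g => ν.N g < B) (fun a b ha hb => ?_) ?_ h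
  · exact (ν.add a b).trans_lt (max_lt ha hb)
  · simpa [ν.zero] using hB

theorem add_eq_left {f g : MvPolynomial (Fin 2) k} (h : ν.N g < ν.N f) : ν.N (f + g) = ν.N f := by
  refine le_antisymm ((ν.add f g).trans (max_le le_rfl h.le)) ?_
  have h1 := ν.sub (f + g) g
  rw [add_sub_cancel_right] at h1
  rcases le_max_iff.1 h1 with h2 | h2
  · exact h2
  · exact absurd h2 (not_le.2 h)

theorem eq_of_sub_lt {f g : MvPolynomial (Fin 2) k} (h : ν.N (f - g) < ν.N f) :
    ν.N g = ν.N f := by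
  have := ν.add_eq_left (f := f) (g := -(f - g)) (by rwa [ν.neg])
  rwa [show f + -(f - g) = g by ring] at this

end MonomialNorm

/-! ### Higher derivations and the index of their dominant term. -/

/-- A locally finite iterative higher derivation of `k[x, y]`. -/
structure HasseSystem (k : Type*) [Field k] where
  /-- the higher derivatives -/
  D : ℕ → MvPolynomial (Fin 2) k →ₗ[k] MvPolynomial (Fin 2) k
  zero : ∀ f, D 0 f = f
  const : ∀ i c, 0 < i → D i (MvPolynomial.C c) = 0
  mul : ∀ n f g, D n (f * g) = ∑ ij ∈ Finset.HasAntidiagonal.antidiagonal n, D ij.1 f * D ij.2 g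
  comp : ∀ i j f, D i (D j f) = ((i + j).choose i : k) • D (i + j) f
  finite : ∀ f, ∃ n, ∀ i, n < i → D i f = 0

namespace HasseSystem

open MvPolynomial

variable {k : Type*} [Field k] (E : HasseSystem k) (ν : MonomialNorm k) {K : ℝ}

/-- The higher derivatives expand the norm by powers of `K` at most. -/
def Bounded (K : ℝ) : Prop := ∀ i f, ν.N (E.D i f) ≤ K ^ i * ν.N f

/-- `m` is the last index at which the expansion by powers of `K` is attained. -/
def IsDom (K : ℝ) (f : MvPolynomial (Fin 2) k) (m : ℕ) : Prop :=
  ν.N (E.D m f) = K ^ m * ν.N f ∧ ∀ i, m < i → ν.N (E.D i f) < K ^ i * ν.N f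

variable {E ν}

/-- The Leibniz rule propagates the bound to monomials, and the norm of a polynomial is the largest
norm of its monomials. -/
theorem bounded_of_X (hK : 0 < K) (h0 : ∀ i, ν.N (E.D i (X 0)) ≤ K ^ i * ν.N (X 0))
    (h1 : ∀ i, ν.N (E.D i (X 1)) ≤ K ^ i * ν.N (X 1)) : E.Bounded ν K := by
  have hmul : ∀ f g : MvPolynomial (Fin 2) k, (∀ i, ν.N (E.D i f) ≤ K ^ i * ν.N f) →
      (∀ i, ν.N (E.D i g) ≤ K ^ i * ν.N g) → ∀ i, ν.N (E.D i (f * g)) ≤ K ^ i * ν.N (f * g) := by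
    intro f g hf hg i
    rw [E.mul]
    refine ν.sum_le _ _ (mul_nonneg (by positivity) (ν.nonneg _)) fun ij hij => ?_
    rw [ν.mul, ν.mul, ← Finset.HasAntidiagonal.mem_antidiagonal.1 hij, pow_add]
    calc _ ≤ (K ^ ij.1 * ν.N f) * (K ^ ij.2 * ν.N g) :=
          mul_le_mul (hf _) (hg _) (ν.nonneg _) (mul_nonneg (by positivity) (ν.nonneg _))
      _ = _ := by ring
  have hC : ∀ c : k, ∀ i, ν.N (E.D i (C c)) ≤ K ^ i * ν.N (C c) := by
    intro c i
    rcases Nat.eq_zero_or_pos i with rfl | hi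
    · rw [E.zero]; simp
    · rw [E.const _ _ hi, ν.zero]; exact mul_nonneg (by positivity) (ν.nonneg _)
  have hpow : ∀ f : MvPolynomial (Fin 2) k, (∀ i, ν.N (E.D i f) ≤ K ^ i * ν.N f) →
      ∀ n i, ν.N (E.D i (f ^ n)) ≤ K ^ i * ν.N (f ^ n) := by
    intro f hf n
    induction n with
    | zero => simpa using hC 1
    | succ n ih => rw [pow_succ]; exact hmul _ _ ih hf
  intro i f
  conv_lhs => rw [f.eq_sum_support_fin_two]
  rw [map_sum]
  refine ν.sum_le _ _ (mul_nonneg (by positivity) (ν.nonneg _)) fun d hd => ?_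
  refine (hmul _ _ (hC _) (hmul _ _ (hpow _ h0 _) (hpow _ h1 _)) i).trans ?_
  rw [ν.mul, ν.mul, ν.pow, ν.pow, ν.const _ (mem_support_iff.1 hd), one_mul]
  exact mul_le_mul_of_nonneg_left (ν.coeff f d (mem_support_iff.1 hd)) (by positivity)

/-- Equality holds at index `0`, and local finiteness excludes all large indices, so a last index of
equality exists. -/
theorem exists_isDom (hK : 0 < K) (hb : E.Bounded ν K) {f : MvPolynomial (Fin 2) k} (hf : f ≠ 0) :
    ∃ m, E.IsDom ν K f m := by
  classical
  obtain ⟨n, hn⟩ := E.finite f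
  have hex : ∃ m, m ≤ n ∧ ν.N (E.D m f) = K ^ m * ν.N f := ⟨0, n.zero_le, by simp [E.zero]⟩
  let P : ℕ → Prop := fun m => ν.N (E.D m f) = K ^ m * ν.N f
  have hspec : P (Nat.findGreatest P n) := by
    obtain ⟨m, hm, h⟩ := hex
    exact Nat.findGreatest_spec hm h
  refine ⟨Nat.findGreatest P n, hspec, fun i hi => ?_⟩
  by_cases hin : i ≤ n
  · exact lt_of_le_of_ne (hb i f) (Nat.findGreatest_is_greatest hi hin)
  · rw [hn i (not_le.1 hin), ν.zero]
    exact mul_pos (by positivity) (ν.pos f hf)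

theorem IsDom.unique {f : MvPolynomial (Fin 2) k} {m n : ℕ} (h : E.IsDom ν K f m)
    (h' : E.IsDom ν K f n) : m = n := by
  rcases lt_trichotomy m n with h1 | h1 | h1
  · exact absurd h'.1 (h.2 n h1).ne
  · exact h1
  · exact absurd h.1 (h'.2 m h1).ne

/-- As for degrees of products: in the Leibniz sum every term other than the one at `(m, n)` has an
index beyond `m` or beyond `n` and is strictly smaller, so the dominant term cannot cancel. -/
theorem IsDom.mul (hK : 0 < K) (hb : E.Bounded ν K) {f g : MvPolynomial (Fin 2) k} (hf : f ≠ 0)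
    (hg : g ≠ 0) {m n : ℕ} (h : E.IsDom ν K f m) (h' : E.IsDom ν K g n) :
    E.IsDom ν K (f * g) (m + n) := by
  have pf := ν.pos f hf
  have pg := ν.pos g hg
  have key : ∀ i j, m < i ∨ n < j →
      ν.N (E.D i f * E.D j g) < K ^ (i + j) * ν.N (f * g) := by
    intro i j hij
    rw [ν.mul, ν.mul, pow_add, show K ^ i * K ^ j * (ν.N f * ν.N g)
      = (K ^ i * ν.N f) * (K ^ j * ν.N g) by ring]
    rcases hij with hi | hj
    · exact mul_lt_mul_of_lt_of_le_of_nonneg_of_pos (h.2 i hi) (hb j g) (ν.nonneg _)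
        (by positivity)
    · exact (mul_le_mul_of_nonneg_right (hb i f) (ν.nonneg _)).trans_lt
        (mul_lt_mul_of_pos_left (h'.2 j hj) (by positivity))
  have pfg : 0 < ν.N (f * g) := by rw [ν.mul]; positivity
  constructor
  · rw [E.mul, ← Finset.add_sum_erase _ _ (a := (m, n)) (by simp)]
    have e1 : ν.N (E.D m f * E.D n g) = K ^ (m + n) * ν.N (f * g) := by
      rw [ν.mul, ν.mul, h.1, h'.1, pow_add]; ring
    rw [ν.add_eq_left, e1]
    rw [e1]
    refine ν.sum_lt _ _ (by positivity) fun ij hij => ?_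
    obtain ⟨hne, hij⟩ := Finset.mem_erase.1 hij
    have hij := Finset.HasAntidiagonal.mem_antidiagonal.1 hij
    rw [← hij]
    refine key _ _ ?_
    by_contra hcon
    push Not at hcon
    exact hne (Prod.ext (by omega) (by omega))
  · intro i hi
    rw [E.mul]
    refine ν.sum_lt _ _ (by positivity) fun ij hij => ?_
    have hij := Finset.HasAntidiagonal.mem_antidiagonal.1 hij
    rw [← hij]
    exact key _ _ (by omega)

/-- The index depends only on the top part: the bound applied to `f - g` makes its derivatives
negligible. -/
theorem IsDom.of_sub_lt (hK : 0 < K) (hb : E.Bounded ν K) {f g : MvPolynomial (Fin 2) k}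
    (hlt : ν.N (f - g) < ν.N f) {m : ℕ} (h : E.IsDom ν K g m) : E.IsDom ν K f m := by
  have e : ν.N g = ν.N f := ν.eq_of_sub_lt hlt
  have hs : ∀ i, ν.N (E.D i (f - g)) < K ^ i * ν.N f := fun i =>
    (hb i _).trans_lt (mul_lt_mul_of_pos_left hlt (by positivity))
  have hd : ∀ i, E.D i f = E.D i g + E.D i (f - g) := fun i => by rw [← map_add]; congr 1; ring
  constructor
  · rw [hd, ν.add_eq_left, h.1, e]
    rw [h.1, e]; exact hs m
  · intro i hi
    rw [hd]
    refine (ν.add _ _).trans_lt (max_lt ?_ (hs i))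
    rw [← e]; exact h.2 i hi

theorem IsDom.of_invariant (hK : 0 < K) {f : MvPolynomial (Fin 2) k} (hf : f ≠ 0)
    (h : ∀ i, 0 < i → E.D i f = 0) : E.IsDom ν K f 0 := by
  have pf := ν.pos f hf
  refine ⟨by simp [E.zero], fun i hi => ?_⟩
  rw [h i hi, ν.zero]; positivity

theorem IsDom.pow (hK : 0 < K) (hb : E.Bounded ν K) {f : MvPolynomial (Fin 2) k} (hf : f ≠ 0)
    {m : ℕ} (h : E.IsDom ν K f m) (n : ℕ) : E.IsDom ν K (f ^ n) (n * m) := by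
  induction n with
  | zero =>
    simpa using IsDom.of_invariant hK one_ne_zero fun i hi => by rw [← C_1, E.const _ _ hi]
  | succ n ih =>
    rw [pow_succ, add_mul, one_mul]
    exact ih.mul hK hb (pow_ne_zero _ hf) hf h

/-- Iterativity turns `D q ∘ D (m - q)` into a binomial multiple of `D m`. If the binomial
coefficient survives in `k`, any index `q ≤ m` is thus realized by a derivative of `f`. -/
theorem IsDom.derivative (hK : 0 < K) (hb : E.Bounded ν K) {f : MvPolynomial (Fin 2) k}
    {m q : ℕ} (h : E.IsDom ν K f m) (hq : q ≤ m) (hf : f ≠ 0) (hc : (m.choose q : k) ≠ 0) :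
    E.D (m - q) f ≠ 0 ∧ E.IsDom ν K (E.D (m - q) f) q := by
  have pf := ν.pos f hf
  have e : E.D q (E.D (m - q) f) = C (m.choose q : k) * E.D m f := by
    rw [E.comp, Nat.add_sub_cancel' hq, smul_eq_C_mul]
  have e1 : ν.N (E.D q (E.D (m - q) f)) = K ^ q * (K ^ (m - q) * ν.N f) := by
    rw [e, ν.mul, ν.const _ hc, one_mul, h.1, ← mul_assoc, ← pow_add, Nat.add_sub_cancel' hq]
  have e2 : ν.N (E.D (m - q) f) = K ^ (m - q) * ν.N f := by
    refine le_antisymm (hb _ _) ?_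
    have := hb q (E.D (m - q) f)
    rw [e1] at this
    exact le_of_mul_le_mul_left this (by positivity)
  refine ⟨fun h0 => ?_, by rw [e1, e2], fun i hi => ?_⟩
  · rw [h0, ν.zero] at e2
    have : 0 < K ^ (m - q) * ν.N f := by positivity
    linarith
  · rw [E.comp, smul_eq_C_mul, ν.mul, e2, ← mul_assoc, ← pow_add]
    refine lt_of_le_of_lt ?_ (h.2 (i + (m - q)) (by omega))
    exact mul_le_of_le_one_left (ν.nonneg _) (ν.const_le _)

end HasseSystem

/-- In characteristic `p` take for `q` the full power of `p` dividing `r`: Frobenius reduces the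
binomial coefficient to `(r / q) * b`, which is nonzero in `k`. In characteristic zero `q = 1`
works. -/
theorem exists_dvd_choose_ne_zero (k : Type*) [Field k] {r b : ℕ} (hr : 0 < r)
    (hb : (b : k) ≠ 0) : ∃ q, 0 < q ∧ q ∣ r ∧ (((r * b).choose q : ℕ) : k) ≠ 0 := by
  obtain ⟨p, hp⟩ := CharP.exists k
  rcases CharP.char_is_prime_or_zero k p with hprime | rfl
  · have := Fact.mk hprime
    obtain ⟨s, r', hr', rfl⟩ := Nat.exists_eq_pow_mul_and_not_dvd hr.ne' p hprime.ne_one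
    refine ⟨p ^ s, pow_pos hprime.pos _, Dvd.intro _ rfl, ?_⟩
    have h1 : (((p ^ s * r' * b).choose (p ^ s) : ℕ) : k)
        = ((Polynomial.X + 1 : Polynomial k) ^ (p ^ s * r' * b)).coeff (p ^ s) := by
      rw [Polynomial.coeff_X_add_one_pow]
    have h2 : (Polynomial.X + 1 : Polynomial k) ^ (p ^ s * r' * b)
        = Polynomial.expand k (p ^ s) ((Polynomial.X + 1) ^ (r' * b)) := by
      rw [mul_assoc, pow_mul, add_pow_char_pow]
      simp
    rw [h1, h2]
    have h3 := Polynomial.coeff_expand_mul (pow_pos hprime.pos s)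
      ((Polynomial.X + 1 : Polynomial k) ^ (r' * b)) 1
    rw [one_mul] at h3
    rw [h3, Polynomial.coeff_X_add_one_pow, Nat.choose_one_right, Nat.cast_mul]
    refine mul_ne_zero (fun h => hr' ?_) hb
    exact (CharP.cast_eq_zero_iff k p r').1 h
  · have := CharP.charP_to_charZero k
    refine ⟨1, one_pos, one_dvd _, ?_⟩
    rw [Nat.choose_one_right, Nat.cast_ne_zero]
    have : b ≠ 0 := by rintro rfl; simp at hb
    positivity

/-! ### Division by a binomial, modulo lower norm. -/

namespace MonomialNorm

open MvPolynomial

variable {k : Type*} [Field k] (ν : MonomialNorm k)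

theorem exists_mem_support {f : MvPolynomial (Fin 2) k} (hf : f ≠ 0) :
    ∃ d ∈ f.support, ν.N f = ν.N (X 0) ^ d 0 * ν.N (X 1) ^ d 1 := by
  obtain ⟨d, hd, hmax⟩ := Finset.exists_max_image f.support
    (fun d => ν.N (X 0) ^ d 0 * ν.N (X 1) ^ d 1) (support_nonempty.2 hf)
  refine ⟨d, hd, le_antisymm ?_ (ν.coeff f d (mem_support_iff.1 hd))⟩
  conv_lhs => rw [f.eq_sum_support_fin_two]
  refine ν.sum_le _ _ (mul_nonneg (pow_nonneg (ν.nonneg _) _) (pow_nonneg (ν.nonneg _) _))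
    fun e he => ?_
  rw [ν.mul, ν.mul, ν.pow, ν.pow, ν.const _ (mem_support_iff.1 he), one_mul]
  exact hmax e he

variable {ν} {θ : ℝ} {a b : ℕ} {μ : k}

theorem eq_pow (h0 : ν.N (X 0) = θ ^ b) (h1 : ν.N (X 1) = θ ^ a) {f : MvPolynomial (Fin 2) k}
    (hf : f ≠ 0) : ∃ d ∈ f.support, ν.N f = θ ^ (b * d 0 + a * d 1) := by
  obtain ⟨d, hd, h⟩ := ν.exists_mem_support hf
  exact ⟨d, hd, by rw [h, h0, h1, ← pow_mul, ← pow_mul, ← pow_add]⟩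

theorem coeff_binomial (hb : 0 < b) :
    MvPolynomial.coeff (Finsupp.single 0 a) (X 0 ^ a - C μ * X 1 ^ b : MvPolynomial (Fin 2) k) = 1 := by
  classical
  have hne : Finsupp.single (1 : Fin 2) b ≠ Finsupp.single 0 a := by
    intro h
    have := DFunLike.congr_fun h 1
    simp at this
    omega
  simp [coeff_X_pow, coeff_C_mul, hne]

theorem binomial_ne_zero (hb : 0 < b) :
    (X 0 ^ a - C μ * X 1 ^ b : MvPolynomial (Fin 2) k) ≠ 0 := by
  intro h
  have := coeff_binomial (a := a) (μ := μ) hb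
  rw [h] at this
  simp at this

theorem norm_binomial (h0 : ν.N (X 0) = θ ^ b) (h1 : ν.N (X 1) = θ ^ a)
    (hb : 0 < b) (hθ : 1 < θ) : ν.N (X 0 ^ a - C μ * X 1 ^ b) = θ ^ (a * b) := by
  refine le_antisymm ((ν.sub _ _).trans (max_le ?_ ?_)) ?_
  · rw [ν.pow, h0, ← pow_mul, mul_comm]
  · rw [ν.mul, ν.pow, h1, ← pow_mul]
    exact mul_le_of_le_one_left (by positivity) (ν.const_le _)
  · have := ν.coeff _ (Finsupp.single 0 a) (by rw [coeff_binomial (a := a) (μ := μ) hb]; simp)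
    simpa [h0, ← pow_mul, mul_comm] using this

/-- Since `a` and `b` are coprime, at most one monomial of weight `n` has `x`-exponent below `a`.
Reducing modulo the binomial therefore leaves a remainder of the single shape `c M` in each weight,
and `M` does not depend on `f`. -/
theorem exists_division (h0 : ν.N (X 0) = θ ^ b) (h1 : ν.N (X 1) = θ ^ a) (ha : 0 < a)
    (hab : a.Coprime b) (hθ : 1 < θ) (n : ℕ) :
    ∃ M : MvPolynomial (Fin 2) k,
      (M = 0 ∨ ∃ i l, b * i + a * l = n ∧ M = X 0 ^ i * X 1 ^ l) ∧
      ∀ f, ν.N f ≤ θ ^ n → ∃ q c, ν.N (f - (q * (X 0 ^ a - C μ * X 1 ^ b) + C c * M)) < θ ^ n ∧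
        ν.N q * θ ^ (a * b) ≤ θ ^ n := by
  classical
  set h : MvPolynomial (Fin 2) k := X 0 ^ a - C μ * X 1 ^ b with hh
  have hθ0 : 0 < θ := by linarith
  have hmono : ∀ i l, ν.N (X 0 ^ i * X 1 ^ l) = θ ^ (b * i + a * l) := fun i l => by
    rw [ν.mul, ν.pow, ν.pow, h0, h1, ← pow_mul, ← pow_mul, ← pow_add]
  obtain ⟨M, hM, huniq⟩ : ∃ M : MvPolynomial (Fin 2) k,
      (M = 0 ∨ ∃ i l, b * i + a * l = n ∧ M = X 0 ^ i * X 1 ^ l) ∧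
      ∀ i l, i < a → b * i + a * l = n → X 0 ^ i * X 1 ^ l = M := by
    by_cases hex : ∃ i l, i < a ∧ b * i + a * l = n
    · obtain ⟨i, l, hi, hil⟩ := hex
      refine ⟨X 0 ^ i * X 1 ^ l, Or.inr ⟨i, l, hil, rfl⟩, fun i' l' hi' hil' => ?_⟩
      have hmod : b * i ≡ b * i' [MOD a] := by
        have e1 : b * i + a * l ≡ b * i [MOD a] := by simp [Nat.ModEq]
        have e2 : b * i' + a * l' ≡ b * i' [MOD a] := by simp [Nat.ModEq]
        exact e1.symm.trans ((by rw [hil, hil'] : b * i + a * l ≡ b * i' + a * l' [MOD a]).trans e2)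
      have hi2 : i = i' := by
        have := Nat.ModEq.cancel_left_of_coprime (by simpa using hab) hmod
        rwa [Nat.ModEq, Nat.mod_eq_of_lt hi, Nat.mod_eq_of_lt hi'] at this
      subst hi2
      have : l = l' := Nat.eq_of_mul_eq_mul_left ha (by omega)
      rw [this]
    · exact ⟨0, Or.inl rfl, fun i l hi hil => absurd ⟨i, l, hi, hil⟩ hex⟩
  refine ⟨M, hM, ?_⟩
  let P : MvPolynomial (Fin 2) k → Prop := fun f =>
    ∃ q c, ν.N (f - (q * h + C c * M)) < θ ^ n ∧ ν.N q * θ ^ (a * b) ≤ θ ^ n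
  have hadd : ∀ f g, P f → P g → P (f + g) := by
    rintro f g ⟨q, c, h2, h3⟩ ⟨q', c', h2', h3'⟩
    refine ⟨q + q', c + c', ?_, ?_⟩
    · rw [show f + g - ((q + q') * h + C (c + c') * M)
        = (f - (q * h + C c * M)) + (g - (q' * h + C c' * M)) by rw [C_add]; ring]
      exact (ν.add _ _).trans_lt (max_lt h2 h2')
    · rcases le_max_iff.1 (ν.add q q') with h4 | h4
      · exact (mul_le_mul_of_nonneg_right h4 (by positivity)).trans h3
      · exact (mul_le_mul_of_nonneg_right h4 (by positivity)).trans h3'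
  have hsmall : ∀ f, ν.N f < θ ^ n → P f := fun f hf =>
    ⟨0, 0, by simpa using hf, by rw [ν.zero, zero_mul]; positivity⟩
  have hmonoP : ∀ i l, b * i + a * l = n → ∀ c, P (C c * (X 0 ^ i * X 1 ^ l)) := by
    intro i
    induction i using Nat.strong_induction_on with
    | _ i ih =>
      intro l hil c
      rcases lt_or_ge i a with hi | hi
      · refine ⟨0, c, ?_, by rw [ν.zero, zero_mul]; positivity⟩
        rw [huniq i l hi hil, zero_mul, zero_add, sub_self, ν.zero]
        positivity
      · obtain ⟨j, rfl⟩ := Nat.exists_eq_add_of_le hi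
        -- Trading `x ^ a` for `h + μ y ^ b` keeps the weight and lowers the exponent of `x`.
        have e : (C c * (X 0 ^ (a + j) * X 1 ^ l) : MvPolynomial (Fin 2) k)
            = C c * (X 0 ^ j * X 1 ^ l) * h + C (c * μ) * (X 0 ^ j * X 1 ^ (l + b)) := by
          rw [hh, C_mul, pow_add, pow_add]; ring
        rw [e]
        refine hadd _ _ ⟨C c * (X 0 ^ j * X 1 ^ l), 0, ?_, ?_⟩
          (ih j (by omega) (l + b) (by rw [← hil]; ring) _)
        · simp only [C_0, zero_mul, add_zero, sub_self, ν.zero]; positivity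
        · rw [ν.mul, hmono, mul_assoc, ← pow_add]
          refine (mul_le_of_le_one_left (by positivity) (ν.const_le _)).trans ?_
          exact pow_le_pow_right₀ hθ.le (by rw [← hil]; ring_nf; rfl)
  intro f hf
  change P f
  rw [f.eq_sum_support_fin_two]
  refine Finset.sum_induction _ P hadd (hsmall 0 (by rw [ν.zero]; positivity)) fun d hd => ?_
  have hle := (ν.coeff f d (mem_support_iff.1 hd)).trans hf
  rw [h0, h1, ← pow_mul, ← pow_mul, ← pow_add, pow_le_pow_iff_right₀ hθ] at hle
  rcases hle.lt_or_eq with h2 | h2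
  · refine hsmall _ ?_
    rw [ν.mul, hmono]
    exact (mul_le_of_le_one_left (by positivity) (ν.const_le _)).trans_lt
      (pow_lt_pow_right₀ hθ h2)
  · exact hmonoP _ _ h2 _

end MonomialNorm

/-! ### The dominant indices when a binomial has index zero. -/

namespace HasseSystem

open MvPolynomial

variable {k : Type*} [Field k] {E : HasseSystem k} {ν : MonomialNorm k} {K : ℝ}

theorem IsDom.add_of_lt {f g : MvPolynomial (Fin 2) k} {m n : ℕ} (hK : 0 < K)
    (hf : E.IsDom ν K f m) (hg : E.IsDom ν K g n) (hmn : m < n) (hle : ν.N f ≤ ν.N g)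
    (heq : ν.N (f + g) = ν.N g) : E.IsDom ν K (f + g) n := by
  have hlt : ∀ i, m < i → ν.N (E.D i f) < K ^ i * ν.N g := fun i hi =>
    (hf.2 i hi).trans_le (mul_le_mul_of_nonneg_left hle (by positivity))
  constructor
  · rw [map_add, add_comm, ν.add_eq_left, hg.1, heq]
    rw [hg.1]; exact hlt n hmn
  · intro i hi
    rw [map_add, heq]
    exact (ν.add _ _).trans_lt (max_lt (hlt i (by omega)) (hg.2 i hi))

variable {θ : ℝ} {a b r : ℕ} {μ : k}

/-- A monomial of weight `w` has index `r * w`, so no monomial of weight at most `n` attains the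
bound beyond `r * n`. -/
theorem lt_of_norm_le (hK : 0 < K) (hb : E.Bounded ν K) (h0 : ν.N (X 0) = θ ^ b)
    (h1 : ν.N (X 1) = θ ^ a) (hθ : 1 < θ) (d0 : E.IsDom ν K (X 0) (r * b))
    (d1 : E.IsDom ν K (X 1) (r * a)) {f : MvPolynomial (Fin 2) k} {n : ℕ} (hf : ν.N f ≤ θ ^ n)
    {i : ℕ} (hi : r * n < i) : ν.N (E.D i f) < K ^ i * θ ^ n := by
  have hθ0 : 0 < θ := by linarith
  rw [f.eq_sum_support_fin_two, map_sum]
  refine ν.sum_lt _ _ (by positivity) fun d hd => ?_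
  have hle := (ν.coeff f d (mem_support_iff.1 hd)).trans hf
  rw [h0, h1, ← pow_mul, ← pow_mul, ← pow_add, pow_le_pow_iff_right₀ hθ] at hle
  have hdom := (d0.pow hK hb (X_ne_zero 0) (d 0)).mul hK hb (pow_ne_zero _ (X_ne_zero 0))
    (pow_ne_zero _ (X_ne_zero 1)) (d1.pow hK hb (X_ne_zero 1) (d 1))
  have hlt := hdom.2 i (lt_of_le_of_lt (by nlinarith) hi)
  rw [ν.mul, ν.pow, ν.pow, h0, h1, ← pow_mul, ← pow_mul, ← pow_add] at hlt
  rw [← smul_eq_C_mul, map_smul, smul_eq_C_mul, ν.mul]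
  refine (mul_le_of_le_one_left (ν.nonneg _) (ν.const_le _)).trans_lt (hlt.trans_le ?_)
  exact mul_le_mul_of_nonneg_left (pow_le_pow_right₀ hθ.le hle) (by positivity)

/-- Induction on the weight by division with remainder. Both conclusions are needed later: the first
restricts the possible indices, the second identifies the top parts of index zero. -/
theorem exists_isDom_eq (hK : 0 < K) (hbd : E.Bounded ν K) (h0 : ν.N (X 0) = θ ^ b)
    (h1 : ν.N (X 1) = θ ^ a) (ha : 0 < a) (hb : 0 < b) (hab : a.Coprime b) (hθ : 1 < θ)
    (hr : 0 < r) (d0 : E.IsDom ν K (X 0) (r * b)) (d1 : E.IsDom ν K (X 1) (r * a))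
    (dh : E.IsDom ν K (X 0 ^ a - C μ * X 1 ^ b) 0) (n : ℕ) :
    ∀ f, ν.N f = θ ^ n → (∃ i l, E.IsDom ν K f (r * (b * i + a * l))) ∧
      (E.IsDom ν K f 0 → ∃ c e, ν.N (f - C c * (X 0 ^ a - C μ * X 1 ^ b) ^ e) < ν.N f) := by
  have hθ0 : 0 < θ := by linarith
  have hne := MonomialNorm.binomial_ne_zero (a := a) (μ := μ) hb
  have hN := MonomialNorm.norm_binomial (μ := μ) h0 h1 hb hθ
  have habpos : 0 < a * b := Nat.mul_pos ha hb
  induction n using Nat.strong_induction_on with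
  | _ n ih =>
  intro f hf
  obtain ⟨M, hM, hdiv⟩ := MonomialNorm.exists_division (μ := μ) h0 h1 ha hab hθ n
  obtain ⟨q, c, hlt, hq⟩ := hdiv f hf.le
  set h : MvPolynomial (Fin 2) k := X 0 ^ a - C μ * X 1 ^ b with hh
  have hf0 : f ≠ 0 := by
    rintro rfl
    rw [ν.zero] at hf
    have : 0 < θ ^ n := by positivity
    linarith
  by_cases hcM : C c * M = 0
  -- The top part is divisible by `h`, which has index zero; both claims pass from the quotient, of
  -- smaller weight, to `f`.
  · rw [hcM, add_zero, ← hf] at hlt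
    have hq0 : q ≠ 0 := by
      rintro rfl
      simp at hlt
    obtain ⟨d, -, hqd⟩ := MonomialNorm.eq_pow h0 h1 hq0
    set w := b * d 0 + a * d 1
    have hw : w + a * b = n := by
      have := ν.eq_of_sub_lt hlt
      rw [ν.mul, hqd, hN, hf, ← pow_add] at this
      exact pow_right_injective₀ hθ0 hθ.ne' this
    obtain ⟨⟨i, l, hil⟩, hz⟩ := ih w (by omega) q hqd
    have hfd : E.IsDom ν K f (r * (b * i + a * l)) := (hil.mul hK hbd hq0 hne dh).of_sub_lt hK hbd hlt
    refine ⟨⟨i, l, hfd⟩, fun hfz => ?_⟩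
    rw [hfd.unique hfz] at hil
    obtain ⟨c', e, he⟩ := hz hil
    refine ⟨c', e + 1, ?_⟩
    rw [show f - C c' * h ^ (e + 1) = (f - q * h) + (q - C c' * h ^ e) * h by ring]
    refine (ν.add _ _).trans_lt (max_lt hlt ?_)
    rw [ν.mul, hN, hf, ← hw, pow_add, ← hqd]
    exact mul_lt_mul_of_pos_right he (by positivity)
  -- The remainder has index `r * n`, the largest possible in this weight, while `q * h` has index
  -- at most `r * (n - a * b)`. So the remainder dominates, and index zero leaves only a constant.
  · have hc : c ≠ 0 := by rintro rfl; simp at hcM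
    rcases hM with rfl | ⟨i, l, hil, rfl⟩
    · simp at hcM
    have hMN : ν.N (C c * (X 0 ^ i * X 1 ^ l)) = θ ^ n := by
      rw [ν.mul, ν.const c hc, ν.mul, ν.pow, ν.pow, h0, h1, ← pow_mul, ← pow_mul, ← pow_add, hil,
        one_mul]
    have hMd : E.IsDom ν K (C c * (X 0 ^ i * X 1 ^ l)) (r * n) := by
      have hdom := (d0.pow hK hbd (X_ne_zero 0) i).mul hK hbd (pow_ne_zero _ (X_ne_zero 0))
        (pow_ne_zero _ (X_ne_zero 1)) (d1.pow hK hbd (X_ne_zero 1) l)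
      have hdom2 := (IsDom.of_invariant (E := E) (ν := ν) hK (C_ne_zero.2 hc)
        (fun i hi => E.const i c hi)).mul hK hbd (C_ne_zero.2 hc) (by simp) hdom
      rwa [show 0 + (i * (r * b) + l * (r * a)) = r * n by rw [← hil]; ring] at hdom2
    have hfd : E.IsDom ν K f (r * n) := by
      constructor
      · have e : E.D (r * n) f = E.D (r * n) (C c * (X 0 ^ i * X 1 ^ l)) +
            (E.D (r * n) (q * h) + E.D (r * n) (f - (q * h + C c * (X 0 ^ i * X 1 ^ l)))) := by
          rw [← map_add, ← map_add]; congr 1; ring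
        rw [e, ν.add_eq_left, hMd.1, hMN, hf]
        rw [hMd.1, hMN]
        refine (ν.add _ _).trans_lt (max_lt ?_ ?_)
        · by_cases hq0 : q = 0
          · rw [hq0, zero_mul, map_zero, ν.zero]; positivity
          obtain ⟨d, -, hqd⟩ := MonomialNorm.eq_pow h0 h1 hq0
          set w := b * d 0 + a * d 1
          have hw : w + a * b ≤ n := by
            rw [hqd, ← pow_add] at hq
            exact (pow_le_pow_iff_right₀ hθ).1 hq
          obtain ⟨m, hm⟩ := exists_isDom hK hbd hq0
          have hmw : m ≤ r * w := by
            by_contra hcon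
            have := lt_of_norm_le hK hbd h0 h1 hθ d0 d1 hqd.le (not_le.1 hcon)
            rw [hm.1, hqd] at this
            exact lt_irrefl _ this
          have := (hm.mul hK hbd hq0 hne dh).2 (r * n) (by nlinarith)
          refine this.trans_le ?_
          rw [ν.mul, hN]
          exact mul_le_mul_of_nonneg_left hq (by positivity)
        · exact (hbd _ _).trans_lt (mul_lt_mul_of_pos_left hlt (by positivity))
      · intro j hj
        rw [hf]
        exact lt_of_norm_le hK hbd h0 h1 hθ d0 d1 hf.le hj
    refine ⟨⟨i, l, by rwa [hil]⟩, fun hfz => ⟨c, 0, ?_⟩⟩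
    have hn : n = 0 := by
      have := hfd.unique hfz
      simpa [hr.ne'] using this
    subst hn
    have hi : i = 0 := by
      have : b * i = 0 := by omega
      simpa [hb.ne'] using this
    have hl : l = 0 := by
      have : a * l = 0 := by omega
      simpa [ha.ne'] using this
    have hq0 : q = 0 := by
      by_contra hq0
      obtain ⟨d, -, hqd⟩ := MonomialNorm.eq_pow h0 h1 hq0
      rw [hqd, ← pow_add, pow_le_pow_iff_right₀ hθ] at hq
      omega
    rw [hf]
    simpa [hq0, hi, hl] using hlt

/-- The hypothesis `hatt` says that `K` is the exact expansion rate; without it all indices could be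
zero and carry no information. -/
theorem eq_one_or_eq_one_and_exists (hK : 0 < K) (hbd : E.Bounded ν K)
    (hatt : ∃ i, 0 < i ∧ ∃ z, ν.N (E.D i (X z)) = K ^ i * ν.N (X z)) (h0 : ν.N (X 0) = θ ^ b)
    (h1 : ν.N (X 1) = θ ^ a) (ha : 0 < a) (hb : 0 < b) (hab : a.Coprime b) (hθ : 1 < θ)
    (hμ : μ ≠ 0) {f q : MvPolynomial (Fin 2) k} (hf0 : f ≠ 0) (hinv : ∀ i, 0 < i → E.D i f = 0)
    (hq : ν.N (f - q * (X 0 ^ a - C μ * X 1 ^ b)) < ν.N f) :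
    (a = 1 ∨ b = 1) ∧ ∃ c e, ν.N (f - C c * (X 0 ^ a - C μ * X 1 ^ b) ^ e) < ν.N f := by
  have hθ0 : 0 < θ := by linarith
  have hne := MonomialNorm.binomial_ne_zero (a := a) (μ := μ) hb
  have hN := MonomialNorm.norm_binomial (μ := μ) h0 h1 hb hθ
  have df : E.IsDom ν K f 0 := IsDom.of_invariant hK hf0 hinv
  have hq0 : q ≠ 0 := by
    rintro rfl
    simp at hq
  -- The invariant `f` has index zero and the same top part as a product, so both factors have index
  -- zero.
  have dh : E.IsDom ν K (X 0 ^ a - C μ * X 1 ^ b) 0 := by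
    obtain ⟨m, hm⟩ := exists_isDom hK hbd hne
    obtain ⟨m', hm'⟩ := exists_isDom hK hbd hq0
    have := df.unique ((hm'.mul hK hbd hq0 hne hm).of_sub_lt hK hbd hq)
    obtain rfl : m = 0 := by omega
    exact hm
  obtain ⟨s, ds⟩ := exists_isDom hK hbd (X_ne_zero (R := k) (0 : Fin 2))
  obtain ⟨t, dt⟩ := exists_isDom hK hbd (X_ne_zero (R := k) (1 : Fin 2))
  -- If the two terms of the binomial had different indices, the larger one would be the index of
  -- the binomial, which is zero.
  have hst : a * s = b * t := by
    have dsa := ds.pow hK hbd (X_ne_zero 0) a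
    have hC0 : (C (-μ) : MvPolynomial (Fin 2) k) ≠ 0 := C_ne_zero.2 (neg_ne_zero.2 hμ)
    have dtb := (IsDom.of_invariant (E := E) (ν := ν) hK hC0
      (fun i hi => E.const i _ hi)).mul hK hbd hC0
      (pow_ne_zero _ (X_ne_zero 1)) (dt.pow hK hbd (X_ne_zero 1) b)
    rw [zero_add] at dtb
    have hs : (X 0 ^ a - C μ * X 1 ^ b : MvPolynomial (Fin 2) k)
        = X 0 ^ a + C (-μ) * X 1 ^ b := by rw [C_neg]; ring
    rw [hs] at dh hN
    have e0 : ν.N (X 0 ^ a) = θ ^ (a * b) := by rw [ν.pow, h0, ← pow_mul, mul_comm]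
    have e1 : ν.N (C (-μ) * X 1 ^ b) = θ ^ (a * b) := by
      rw [ν.mul, ν.const _ (neg_ne_zero.2 hμ), ν.pow, h1, ← pow_mul, one_mul]
    rcases lt_trichotomy (a * s) (b * t) with hlt | heq | hlt
    · have := dh.unique (dsa.add_of_lt hK dtb hlt (by rw [e0, e1]) (by rw [hN, e1]))
      omega
    · exact heq
    · rw [add_comm] at dh hN
      have := dh.unique (dtb.add_of_lt hK dsa hlt (by rw [e0, e1]) (by rw [hN, e0]))
      omega
  obtain ⟨r, rfl⟩ : b ∣ s := hab.symm.dvd_of_dvd_mul_left (Dvd.intro _ hst.symm)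
  have ht : t = r * a := by
    refine Nat.eq_of_mul_eq_mul_left hb ?_
    rw [← hst]; ring
  subst ht
  rw [mul_comm b r] at ds
  -- If `r` were zero, no derivative of positive order of `x` or `y` could attain the bound.
  have hr : 0 < r := by
    rcases Nat.eq_zero_or_pos r with rfl | h
    · exfalso
      obtain ⟨i, hi, z, hz⟩ := hatt
      rw [zero_mul] at ds dt
      fin_cases z
      · exact (ds.2 i hi).ne hz
      · exact (dt.2 i hi).ne hz
    · exact h
  have main := exists_isDom_eq hK hbd h0 h1 ha hb hab hθ hr ds dt dh
  constructor
  -- Some derivative of the variable has an index `u` dividing `r`, and every index has the form `r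
  -- * (b * i + a * l)`; hence `b * i + a * l = 1`.
  · have final : ∀ z : Fin 2, ∀ w : ℕ, E.IsDom ν K (X z) (r * w) → (w : k) ≠ 0 → a = 1 ∨ b = 1 := by
      intro z w hd hw
      obtain ⟨u, hu, ⟨r', rfl⟩, hch⟩ := exists_dvd_choose_ne_zero k hr hw
      have hw0 : 0 < w := by
        rcases Nat.eq_zero_or_pos w with rfl | h
        · simp at hw
        · exact h
      have hr' : 0 < r' := Nat.pos_of_mul_pos_left hr
      obtain ⟨hne', hd'⟩ := hd.derivative hK hbd (q := u)
        (by rw [mul_assoc]; exact Nat.le_mul_of_pos_right _ (Nat.mul_pos hr' hw0)) (X_ne_zero z) hch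
      obtain ⟨d, -, hn⟩ := MonomialNorm.eq_pow h0 h1 hne'
      obtain ⟨⟨i, l, hil⟩, -⟩ := main _ _ hn
      have h3 := hd'.unique hil
      have h4 : r' * (b * i + a * l) = 1 := by
        refine Nat.eq_of_mul_eq_mul_left hu ?_
        rw [← mul_assoc, ← h3, mul_one]
      have h5 := Nat.dvd_one.1 (Dvd.intro_left _ h4)
      rcases Nat.eq_zero_or_pos i with rfl | hi
      · left
        rw [mul_zero, zero_add] at h5
        exact Nat.dvd_one.1 (Dvd.intro _ h5)
      · right
        nlinarith
    -- The coprime numbers `a` and `b` cannot both vanish in `k`, so one of the two variables is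
    -- usable.
    by_cases hbk : (b : k) = 0
    · refine final 1 a dt fun hak => ?_
      obtain ⟨p, hp⟩ := CharP.exists k
      have h2 := Nat.dvd_gcd ((CharP.cast_eq_zero_iff k p a).1 hak)
        ((CharP.cast_eq_zero_iff k p b).1 hbk)
      rw [hab.gcd_eq_one, Nat.dvd_one] at h2
      exact CharP.char_ne_one k p h2
    · exact final 0 b ds hbk
  · obtain ⟨d, -, hn⟩ := MonomialNorm.eq_pow h0 h1 hf0
    exact (main _ f hn).2 df

end HasseSystem

/-! ### Hasse derivatives along a coordinate, and their expansion rate. -/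

namespace HasseSystem

open MvPolynomial

variable {k : Type*} [Field k]

/-- The higher derivations in the second of two coordinates. -/
noncomputable def ofAlgEquiv (Φ : Polynomial (Polynomial k) ≃ₐ[k] MvPolynomial (Fin 2) k) :
    HasseSystem k where
  D i := Φ.toLinearMap ∘ₗ (Polynomial.hasseDeriv i).restrictScalars k ∘ₗ Φ.symm.toLinearMap
  zero f := by simp
  const i c hi := by
    have : Φ.symm (C c) = Polynomial.C (Polynomial.C c) := Φ.symm.commutes c
    simp [this, Polynomial.hasseDeriv_C _ _ hi]
  mul n f g := by
    simp [Polynomial.hasseDeriv_mul]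
  comp i j f := by
    have h := LinearMap.congr_fun (Polynomial.hasseDeriv_comp (R := Polynomial k) i j) (Φ.symm f)
    simp only [LinearMap.comp_apply, LinearMap.smul_apply] at h
    simp only [LinearMap.comp_apply, AlgEquiv.toLinearMap_apply, AlgEquiv.symm_apply_apply,
      LinearMap.restrictScalars_apply, h, map_nsmul, Nat.cast_smul_eq_nsmul]
  finite f := by
    refine ⟨(Φ.symm f).natDegree, fun i hi => ?_⟩
    simp [Polynomial.hasseDeriv_eq_zero_of_lt_natDegree _ _ hi]

theorem ofAlgEquiv_C (Φ : Polynomial (Polynomial k) ≃ₐ[k] MvPolynomial (Fin 2) k)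
    (p : Polynomial k) {i : ℕ} (hi : 0 < i) :
    (ofAlgEquiv Φ).D i (Φ (Polynomial.C p)) = 0 := by
  simp [ofAlgEquiv, Polynomial.hasseDeriv_C _ _ hi]

theorem ofAlgEquiv_X (Φ : Polynomial (Polynomial k) ≃ₐ[k] MvPolynomial (Fin 2) k) :
    (ofAlgEquiv Φ).D 1 (Φ Polynomial.X) = 1 := by
  simp [ofAlgEquiv]

variable {E : HasseSystem k} (ν : MonomialNorm k)

theorem exists_D_X_ne_zero {f : MvPolynomial (Fin 2) k} (h : ∃ i, 0 < i ∧ E.D i f ≠ 0) :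
    ∃ i, 0 < i ∧ ∃ z, E.D i (X z) ≠ 0 := by
  by_contra! hcon
  obtain ⟨i, hi, hif⟩ := h
  refine hif ?_
  clear hif
  revert i
  induction f using MvPolynomial.induction_on with
  | C c => exact fun i hi => E.const i c hi
  | add p q hp hq => intro i hi; rw [map_add, hp i hi, hq i hi, add_zero]
  | mul_X p z hp =>
    intro i hi
    rw [E.mul]
    refine Finset.sum_eq_zero fun ij hij => ?_
    have := Finset.HasAntidiagonal.mem_antidiagonal.1 hij
    rcases Nat.eq_zero_or_pos ij.1 with h0 | h0
    · rw [hcon ij.2 (by omega) z, mul_zero]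
    · rw [hp ij.1 h0, zero_mul]

/-- `K` is the maximum over the variables and the positive orders `i` of the `i`-th root of the
relative growth. Local finiteness makes this a maximum over a finite set; it is positive because
some derivative of a variable is nonzero. -/
theorem exists_bounded {f : MvPolynomial (Fin 2) k} (h : ∃ i, 0 < i ∧ E.D i f ≠ 0) :
    ∃ K, 0 < K ∧ E.Bounded ν K ∧ ∃ i, 0 < i ∧ ∃ z, ν.N (E.D i (X z)) = K ^ i * ν.N (X z) := by
  obtain ⟨i₀, hi₀, z₀, hz₀⟩ := exists_D_X_ne_zero h
  choose n hn using fun z : Fin 2 => E.finite (X z)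
  let s : Finset (ℕ × Fin 2) := Finset.Icc 1 (n 0 + n 1 + i₀) ×ˢ Finset.univ
  let φ : ℕ × Fin 2 → ℝ := fun p => (ν.N (E.D p.1 (X p.2)) / ν.N (X p.2)) ^ ((p.1 : ℝ)⁻¹)
  obtain ⟨⟨i, z⟩, hiz, hmax⟩ := Finset.exists_max_image s φ
    ⟨(i₀, z₀), by simp [s]; omega⟩
  have hi : 0 < i := by simp [s] at hiz; omega
  have hX : ∀ z : Fin 2, 0 < ν.N (X z) := fun z => ν.pos _ (X_ne_zero z)
  have hq : ∀ j z, 0 ≤ ν.N (E.D j (X z)) / ν.N (X z) := fun j z =>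
    div_nonneg (ν.nonneg _) (ν.nonneg _)
  have hφ : ∀ j z, 0 < j → φ (j, z) ^ j = ν.N (E.D j (X z)) / ν.N (X z) := fun j z hj =>
    Real.rpow_inv_natCast_pow (hq j z) hj.ne'
  have hK : 0 < φ (i, z) := by
    refine lt_of_lt_of_le ?_ (hmax (i₀, z₀) (by simp [s]; omega))
    exact Real.rpow_pos_of_pos (div_pos (ν.pos _ hz₀) (hX z₀)) _
  have hle : ∀ z' j, ν.N (E.D j (X z')) ≤ φ (i, z) ^ j * ν.N (X z') := by
    intro z' j
    rcases Nat.eq_zero_or_pos j with rfl | hj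
    · simp [E.zero]
    by_cases hjn : j ≤ n 0 + n 1 + i₀
    · rw [← div_le_iff₀ (hX z'), ← hφ j z' hj]
      refine pow_le_pow_left₀ (Real.rpow_nonneg (hq j z') _) (hmax (j, z') ?_) j
      simp [s]; omega
    · rw [hn z' j, ν.zero]
      · exact mul_nonneg (by positivity) (ν.nonneg _)
      · have : n z' ≤ n 0 + n 1 := by fin_cases z' <;> simp
        omega
  refine ⟨φ (i, z), hK, bounded_of_X hK (hle 0) (hle 1), i, hi, z, ?_⟩
  rw [hφ i z hi, div_mul_cancel₀ _ (hX z).ne']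

end HasseSystem

/-! ### Weighted degrees as monomial norms. -/

namespace MvPolynomial

variable {k : Type*} [Field k]

/-- The substitution `x ↦ τ λ ^ α`, `y ↦ λ ^ β`; the degree in `λ` is the weighted degree. -/
noncomputable def homogenization (α β : ℕ) :
    MvPolynomial (Fin 2) k →ₐ[k] Polynomial (Polynomial k) :=
  aeval ![Polynomial.C Polynomial.X * Polynomial.X ^ α, Polynomial.X ^ β]

theorem homogenization_monomial (α β : ℕ) (c : k) (d : Fin 2 →₀ ℕ) :
    homogenization α β (C c * (X 0 ^ d 0 * X 1 ^ d 1))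
      = Polynomial.monomial (α * d 0 + β * d 1) (Polynomial.monomial (d 0) c) := by
  simp only [homogenization, map_mul, map_pow, aeval_X, Matrix.cons_val_zero, Matrix.cons_val_one,
    mul_pow, ← pow_mul, ← Polynomial.C_mul_X_pow_eq_monomial, pow_add, aeval_C]
  rw [IsScalarTower.algebraMap_apply k (Polynomial k) (Polynomial (Polynomial k))]
  simp only [Polynomial.algebraMap_eq]
  ring

/-- The power of `τ` records the exponent of `x`; with it the weight determines the exponent of `y`,
so no two monomials collide. -/
theorem coeff_homogenization {α β : ℕ} (hβ : 0 < β) (f : MvPolynomial (Fin 2) k)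
    (d : Fin 2 →₀ ℕ) :
    ((homogenization α β f).coeff (α * d 0 + β * d 1)).coeff (d 0) = f.coeff d := by
  classical
  conv_lhs => rw [f.eq_sum_support_fin_two]
  simp only [map_sum, homogenization_monomial, Polynomial.finsetSum_coeff,
    Polynomial.coeff_monomial]
  rw [Finset.sum_eq_single d]
  · simp
  · intro e _ hne
    split_ifs with h1
    · rw [Polynomial.coeff_monomial, if_neg]
      intro h2
      refine hne (Finsupp.ext fun z => ?_)
      fin_cases z
      · exact h2
      · rw [h2] at h1
        exact Nat.eq_of_mul_eq_mul_left hβ (Nat.add_left_cancel h1)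
    · simp
  · intro hd
    simp [notMem_support_iff.1 hd]

theorem homogenization_injective {α β : ℕ} (hβ : 0 < β) :
    Function.Injective (homogenization (k := k) α β) := by
  refine (injective_iff_map_eq_zero _).2 fun f hf => ?_
  ext d
  rw [← coeff_homogenization hβ f d (α := α), hf]
  simp

/-- The degree of `f` for the weights `α` of `x` and `β` of `y`. -/
noncomputable def wdeg (α β : ℕ) (f : MvPolynomial (Fin 2) k) : ℕ :=
  (homogenization α β f).natDegree

theorem le_wdeg {α β : ℕ} (hβ : 0 < β) {f : MvPolynomial (Fin 2) k} {d : Fin 2 →₀ ℕ}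
    (hd : d ∈ f.support) : α * d 0 + β * d 1 ≤ wdeg α β f := by
  refine Polynomial.le_natDegree_of_ne_zero fun h => mem_support_iff.1 hd ?_
  rw [← coeff_homogenization hβ f d (α := α), h]
  simp

/-- Twice-exponentiated degree, a nonarchimedean norm. -/
noncomputable def degNorm {A : Type*} [Semiring A] (p : Polynomial A) : ℝ :=
  open Classical in if p = 0 then 0 else 2 ^ p.natDegree

section

variable {A : Type*} [CommRing A] {p q : Polynomial A}

theorem degNorm_zero : degNorm (0 : Polynomial A) = 0 := if_pos rfl

theorem degNorm_of_ne_zero (h : p ≠ 0) : degNorm p = 2 ^ p.natDegree := if_neg h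

theorem degNorm_nonneg (p : Polynomial A) : 0 ≤ degNorm p := by
  unfold degNorm; split_ifs <;> positivity

theorem degNorm_le (p : Polynomial A) : degNorm p ≤ 2 ^ p.natDegree := by
  unfold degNorm; split_ifs
  · positivity
  · exact le_rfl

theorem degNorm_mul [IsDomain A] (p q : Polynomial A) : degNorm (p * q) = degNorm p * degNorm q := by
  by_cases hp : p = 0
  · simp [hp, degNorm_zero]
  by_cases hq : q = 0
  · simp [hq, degNorm_zero]
  rw [degNorm_of_ne_zero hp, degNorm_of_ne_zero hq, degNorm_of_ne_zero (mul_ne_zero hp hq),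
    Polynomial.natDegree_mul hp hq, pow_add]

theorem degNorm_add (p q : Polynomial A) : degNorm (p + q) ≤ max (degNorm p) (degNorm q) := by
  by_cases hp : p = 0
  · simp [hp]
  by_cases hq : q = 0
  · simp [hq]
  rw [degNorm_of_ne_zero hp, degNorm_of_ne_zero hq]
  refine (degNorm_le _).trans ?_
  rcases le_max_iff.1 (Polynomial.natDegree_add_le p q) with h | h
  · exact le_max_of_le_left (pow_le_pow_right₀ one_le_two h)
  · exact le_max_of_le_right (pow_le_pow_right₀ one_le_two h)

end

/-- The norm given by a weighted degree. -/
noncomputable def weightNorm (k : Type*) [Field k] {α β : ℕ} (hβ : 0 < β) : MonomialNorm k where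
  N f := degNorm (homogenization α β f)
  zero := by simp [degNorm_zero]
  pos f hf := by
    rw [degNorm_of_ne_zero ((map_ne_zero_iff _ (homogenization_injective hβ)).2 hf)]
    positivity
  mul f g := by rw [map_mul, degNorm_mul]
  add f g := by rw [map_add]; exact degNorm_add _ _
  const c hc := by
    have := homogenization_monomial α β c 0
    simp only [Finsupp.coe_zero, Pi.zero_apply, pow_zero, mul_one, mul_zero, add_zero] at this
    rw [this, degNorm_of_ne_zero (by simpa using hc)]
    simp
  coeff f d hd := by
    have h0 : homogenization α β (X 0 : MvPolynomial (Fin 2) k)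
      = Polynomial.C Polynomial.X * Polynomial.X ^ α := by simp [homogenization]
    have h1 : homogenization α β (X 1 : MvPolynomial (Fin 2) k) = Polynomial.X ^ β := by
      simp [homogenization]
    have hf : f ≠ 0 := by rintro rfl; simp at hd
    rw [h0, h1, degNorm_of_ne_zero (by simp), degNorm_of_ne_zero (by simp),
      degNorm_of_ne_zero ((map_ne_zero_iff _ (homogenization_injective hβ)).2 hf),
      Polynomial.natDegree_C_mul (by simp), Polynomial.natDegree_X_pow, Polynomial.natDegree_X_pow,
      ← pow_mul, ← pow_mul, ← pow_add]
    exact pow_le_pow_right₀ one_le_two (le_wdeg hβ (mem_support_iff.2 hd))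

theorem weightNorm_X_zero {α β : ℕ} (hβ : 0 < β) : (weightNorm k (α := α) hβ).N (X 0) = 2 ^ α := by
  change degNorm _ = _
  have h0 : homogenization α β (X 0 : MvPolynomial (Fin 2) k)
      = Polynomial.C Polynomial.X * Polynomial.X ^ α := by simp [homogenization]
  rw [h0, degNorm_of_ne_zero (by simp), Polynomial.natDegree_C_mul (by simp),
    Polynomial.natDegree_X_pow]

theorem weightNorm_X_one {α β : ℕ} (hβ : 0 < β) : (weightNorm k (α := α) hβ).N (X 1) = 2 ^ β := by
  change degNorm _ = _
  have h1 : homogenization α β (X 1 : MvPolynomial (Fin 2) k) = Polynomial.X ^ β := by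
    simp [homogenization]
  rw [h1, degNorm_of_ne_zero (by simp), Polynomial.natDegree_X_pow]

theorem weightNorm_of_ne_zero {α β : ℕ} (hβ : 0 < β) {f : MvPolynomial (Fin 2) k} (hf : f ≠ 0) :
    (weightNorm k (α := α) hβ).N f = 2 ^ wdeg α β f :=
  degNorm_of_ne_zero ((map_ne_zero_iff _ (homogenization_injective hβ)).2 hf)

end MvPolynomial

/-! ### Homogeneous relations between two polynomials in one variable. -/

namespace Polynomial

variable {k : Type*} [Field k]

/-- The field `k` is algebraically closed in `k(t)`: an algebraic fraction is integral, hence a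
polynomial, and nonconstant polynomials are transcendental. -/
theorem exists_eq_C_mul_of_aeval_div_eq_zero {A B : Polynomial k} (hA : A ≠ 0) (hB : B ≠ 0)
    {φ : Polynomial k} (hφ : φ ≠ 0)
    (h : aeval (algebraMap (Polynomial k) (FractionRing (Polynomial k)) A /
      algebraMap (Polynomial k) (FractionRing (Polynomial k)) B) φ = 0) :
    ∃ μ : k, μ ≠ 0 ∧ A = C μ * B := by
  set z := algebraMap (Polynomial k) (FractionRing (Polynomial k)) A /
      algebraMap (Polynomial k) (FractionRing (Polynomial k)) B with hz
  have hB' : algebraMap (Polynomial k) (FractionRing (Polynomial k)) B ≠ 0 := by simpa using hB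
  have hint : IsIntegral k z := isAlgebraic_iff_isIntegral.1 ⟨φ, hφ, h⟩
  obtain ⟨y, hy⟩ := IsIntegrallyClosed.isIntegral_iff.1 (hint.tower_top (A := Polynomial k))
  have hyd : y.natDegree = 0 := by
    by_contra hyd
    refine Polynomial.transcendental y hyd (by
      rw [mem_nonZeroDivisors_iff_ne_zero, leadingCoeff_ne_zero]; rintro rfl; simp at hyd)
      ⟨φ, hφ, ?_⟩
    rw [← hy, aeval_algebraMap_apply] at h
    exact (IsFractionRing.injective (Polynomial k) (FractionRing (Polynomial k)))
      (by rw [h, map_zero])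
  rw [eq_C_of_natDegree_eq_zero hyd] at hy
  have hAB : A = C (y.coeff 0) * B := by
    apply IsFractionRing.injective (Polynomial k) (FractionRing (Polynomial k))
    rw [map_mul, hy, hz, div_mul_cancel₀ _ hB']
  exact ⟨y.coeff 0, fun h0 => hA (by rw [hAB, h0]; simp), hAB⟩

theorem exists_pow_eq_of_sum_eq_zero {A B : Polynomial k} (hA : A ≠ 0) (hB : B ≠ 0) {a b n : ℕ}
    (ha : 0 < a) (hab : a.Coprime b) {s : Finset (Fin 2 →₀ ℕ)} (hs : s.Nonempty)
    {c : (Fin 2 →₀ ℕ) → k} (hc : ∀ d ∈ s, c d ≠ 0) (hn : ∀ d ∈ s, b * d 0 + a * d 1 = n)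
    (hsum : ∑ d ∈ s, C (c d) * (A ^ d 0 * B ^ d 1) = 0) :
    ∃ μ : k, μ ≠ 0 ∧ A ^ a = C μ * B ^ b := by
  obtain ⟨e, he, hmin⟩ := Finset.exists_min_image s (fun d => d 0) hs
  -- The exponents lie on a line with primitive direction `(a, -b)`. Dividing by the monomial at `e`
  -- turns the relation into a polynomial equation for `A ^ a / B ^ b`; its constant term `c e` is
  -- nonzero.
  have hex : ∀ d ∈ s, ∃ t, d 0 = e 0 + a * t ∧ d 1 + b * t = e 1 := by
    intro d hd
    have h1 := hn d hd
    rw [← hn e he] at h1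
    obtain ⟨u, hu⟩ := Nat.exists_eq_add_of_le (hmin d hd)
    obtain ⟨t, rfl⟩ : a ∣ u := by
      refine hab.dvd_of_dvd_mul_left ⟨e 1 - d 1, ?_⟩
      rw [hu] at h1
      have h2 : b * u + a * d 1 = a * e 1 := by linarith
      rw [Nat.mul_sub]; omega
    refine ⟨t, hu, Nat.eq_of_mul_eq_mul_left ha ?_⟩
    rw [hu] at h1
    linarith
  choose! t ht0 ht1 using hex
  set ι := algebraMap (Polynomial k) (FractionRing (Polynomial k))
  have hA' : ι A ≠ 0 := by simpa [ι] using hA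
  have hB' : ι B ≠ 0 := by simpa [ι] using hB
  let φ : Polynomial k := ∑ d ∈ s, monomial (t d) (c d)
  have ht0' : ∀ d ∈ s, t d = 0 → d = e := by
    intro d hd h
    have h0 := ht0 d hd
    have h1 := ht1 d hd
    rw [h] at h0 h1
    refine Finsupp.ext fun z => ?_
    fin_cases z
    · simpa using h0
    · simpa using h1
  have hte : t e = 0 := by
    have := ht0 e he
    have : a * t e = 0 := by omega
    simpa [ha.ne'] using this
  have hφ : φ ≠ 0 := by
    intro h
    have h1 : φ.coeff 0 = c e := by
      simp only [φ, finsetSum_coeff, coeff_monomial]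
      rw [Finset.sum_eq_single e (fun d hd hne => if_neg fun h => hne (ht0' d hd h))
        (fun h => absurd he h), if_pos hte]
    rw [h, coeff_zero] at h1
    exact hc e he h1.symm
  refine exists_eq_C_mul_of_aeval_div_eq_zero (pow_ne_zero _ hA) (pow_ne_zero _ hB) hφ ?_
  have hne : ι A ^ e 0 * ι B ^ e 1 ≠ 0 := mul_ne_zero (pow_ne_zero _ hA') (pow_ne_zero _ hB')
  refine (mul_eq_zero.1 ?_).resolve_right hne
  have h2 := congrArg ι hsum
  rw [map_zero, map_sum] at h2
  rw [← h2, map_sum, Finset.sum_mul]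
  refine Finset.sum_congr rfl fun d hd => ?_
  rw [aeval_monomial, map_mul, map_mul, map_pow, map_pow, ht0 d hd, ← ht1 d hd, map_pow, map_pow,
    IsScalarTower.algebraMap_apply k (Polynomial k) (FractionRing (Polynomial k))]
  simp only [algebraMap_eq]
  change ι (C (c d)) * (ι A ^ a / ι B ^ b) ^ t d * _ = _
  rw [div_pow, ← pow_mul, ← pow_mul]
  field_simp
  ring

end Polynomial

/-! ### Cancellation under a substitution, and the top part it forces. -/

namespace MvPolynomial

variable {k : Type*} [Field k]

theorem map_eq_sum_support {A : Type*} [CommRing A] [Algebra k A]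
    (T : MvPolynomial (Fin 2) k →ₐ[k] A) (f : MvPolynomial (Fin 2) k) :
    T f = ∑ d ∈ f.support, algebraMap k A (f.coeff d) * (T (X 0) ^ d 0 * T (X 1) ^ d 1) := by
  conv_lhs => rw [f.eq_sum_support_fin_two]
  simp only [map_sum, map_mul, map_pow]
  refine Finset.sum_congr rfl fun d _ => ?_
  rw [← algebraMap_eq, AlgHom.commutes]

theorem degNorm_sum_le {A ι : Type*} [CommRing A] (s : Finset ι) (f : ι → Polynomial A) {B : ℝ}
    (hB : 0 ≤ B) (h : ∀ i ∈ s, degNorm (f i) ≤ B) : degNorm (∑ i ∈ s, f i) ≤ B := by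
  refine Finset.sum_induction f (fun g => degNorm g ≤ B) (fun a b ha hb => ?_) ?_ h
  · exact (degNorm_add a b).trans (max_le ha hb)
  · simpa [degNorm_zero] using hB

theorem algebraMap_polynomial_polynomial (c : k) :
    algebraMap k (Polynomial (Polynomial k)) c = Polynomial.C (Polynomial.C c) := by
  rw [IsScalarTower.algebraMap_apply k (Polynomial k) (Polynomial (Polynomial k))]
  rfl

theorem degNorm_algebraMap {c : k} (hc : c ≠ 0) :
    degNorm (algebraMap k (Polynomial (Polynomial k)) c) = 1 := by
  rw [algebraMap_polynomial_polynomial, degNorm_of_ne_zero (by simpa using hc)]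
  simp

theorem degNorm_pow {A : Type*} [CommRing A] [IsDomain A] (p : Polynomial A) (n : ℕ) :
    degNorm (p ^ n) = degNorm p ^ n := by
  induction n with
  | zero => simp [degNorm_of_ne_zero]
  | succ n ih => rw [pow_succ, degNorm_mul, ih, pow_succ]

/-- The top part of `f`, for the weights `b` of `x` and `a` of `y`, is a multiple of
`(x ^ a - μ y ^ b) ^ e`. -/
def IsEdged (a b : ℕ) (μ : k) (e : ℕ) (f : MvPolynomial (Fin 2) k) : Prop :=
  ∃ c : k, c ≠ 0 ∧ ∀ d ∈ (f - C c * (X 0 ^ a - C μ * X 1 ^ b) ^ e).support,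
    b * d 0 + a * d 1 < a * b * e

theorem exists_mem_support_eq_wdeg {α β : ℕ} (hβ : 0 < β) {f : MvPolynomial (Fin 2) k}
    (hf : f ≠ 0) : ∃ d ∈ f.support, α * d 0 + β * d 1 = wdeg α β f := by
  obtain ⟨d, hd, h⟩ := (weightNorm k (α := α) hβ).exists_mem_support hf
  rw [weightNorm_of_ne_zero hβ hf, weightNorm_X_zero, weightNorm_X_one, ← pow_mul, ← pow_mul,
    ← pow_add] at h
  exact ⟨d, hd, (pow_right_injective₀ two_pos (by norm_num) h).symm⟩

variable {T : MvPolynomial (Fin 2) k →ₐ[k] Polynomial (Polynomial k)}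

/-- The coefficient of `T f` in the predicted degree is the top form of `f` evaluated at the leading
coefficients. It vanishes by hypothesis, which is a homogeneous relation between them. -/
theorem exists_leadingCoeff_pow_eq (h0 : 0 < (T (X 0)).natDegree) (h1 : 0 < (T (X 1)).natDegree)
    {a b g : ℕ} (hg0 : (T (X 0)).natDegree = b * g) (hg1 : (T (X 1)).natDegree = a * g)
    (hab : a.Coprime b) {f : MvPolynomial (Fin 2) k}
    (hf : (T f).natDegree < wdeg (T (X 0)).natDegree (T (X 1)).natDegree f) :
    ∃ μ : k, μ ≠ 0 ∧
      (T (X 0)).leadingCoeff ^ a = Polynomial.C μ * (T (X 1)).leadingCoeff ^ b := by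
  classical
  set α := (T (X 0)).natDegree
  set β := (T (X 1)).natDegree
  have ha : 0 < a := Nat.pos_of_ne_zero (by rintro rfl; omega)
  have hg : 0 < g := Nat.pos_of_ne_zero (by rintro rfl; omega)
  have hf0 : f ≠ 0 := by rintro rfl; simp [wdeg] at hf
  obtain ⟨e, he, hew⟩ := exists_mem_support_eq_wdeg (α := α) h1 hf0
  have hT0 : T (X 0) ≠ 0 := fun h => by simp [α, h] at h0
  have hT1 : T (X 1) ≠ 0 := fun h => by simp [β, h] at h1
  refine Polynomial.exists_pow_eq_of_sum_eq_zero (Polynomial.leadingCoeff_ne_zero.2 hT0)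
    (Polynomial.leadingCoeff_ne_zero.2 hT1) ha hab (n := b * e 0 + a * e 1)
    (s := f.support.filter fun d => α * d 0 + β * d 1 = wdeg α β f)
    ⟨e, Finset.mem_filter.2 ⟨he, hew⟩⟩ (c := fun d => f.coeff d)
    (fun d hd => mem_support_iff.1 (Finset.mem_filter.1 hd).1) (fun d hd => ?_) ?_
  · have h2 := (Finset.mem_filter.1 hd).2.trans hew.symm
    rw [hg0, hg1] at h2
    refine Nat.eq_of_mul_eq_mul_left hg ?_
    linarith
  · have h2 := Polynomial.coeff_eq_zero_of_natDegree_lt hf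
    rw [map_eq_sum_support T f, Polynomial.finsetSum_coeff] at h2
    rw [← h2, Finset.sum_filter]
    refine Finset.sum_congr rfl fun d hd => ?_
    have hdeg : (T (X 0) ^ d 0 * T (X 1) ^ d 1).natDegree = α * d 0 + β * d 1 := by
      rw [Polynomial.natDegree_mul (pow_ne_zero _ hT0) (pow_ne_zero _ hT1),
        Polynomial.natDegree_pow, Polynomial.natDegree_pow, mul_comm α, mul_comm β]
    rw [algebraMap_polynomial_polynomial, Polynomial.coeff_C_mul]
    split_ifs with h3
    · rw [← h3, ← hdeg, Polynomial.coeff_natDegree, Polynomial.leadingCoeff_mul,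
        Polynomial.leadingCoeff_pow, Polynomial.leadingCoeff_pow]
    · rw [Polynomial.coeff_eq_zero_of_natDegree_lt, mul_zero]
      rw [hdeg]
      exact lt_of_le_of_ne (le_wdeg h1 hd) h3

theorem natDegree_map_binomial_lt (h0 : 0 < (T (X 0)).natDegree) {a b : ℕ} (ha : 0 < a)
    (hdeg : a * (T (X 0)).natDegree = b * (T (X 1)).natDegree) {μ : k}
    (hμ : (T (X 0)).leadingCoeff ^ a = Polynomial.C μ * (T (X 1)).leadingCoeff ^ b) :
    (T (X 0 ^ a - C μ * X 1 ^ b)).natDegree < a * (T (X 0)).natDegree := by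
  have e : T (X 0 ^ a - C μ * X 1 ^ b)
      = T (X 0) ^ a - Polynomial.C (Polynomial.C μ) * T (X 1) ^ b := by
    rw [map_sub, map_mul, map_pow, map_pow, ← algebraMap_eq, AlgHom.commutes,
      algebraMap_polynomial_polynomial]
  have hpos : 0 < a * (T (X 0)).natDegree := Nat.mul_pos ha h0
  refine lt_of_le_of_ne ?_ fun h => ?_
  · rw [e]
    refine (Polynomial.natDegree_sub_le _ _).trans (max_le Polynomial.natDegree_pow_le ?_)
    refine (Polynomial.natDegree_C_mul_le _ _).trans ?_
    rw [hdeg]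
    exact Polynomial.natDegree_pow_le
  · have h2 : (T (X 0 ^ a - C μ * X 1 ^ b)).leadingCoeff = 0 := by
      rw [Polynomial.leadingCoeff, h, e, Polynomial.coeff_sub, Polynomial.coeff_C_mul,
        Polynomial.coeff_pow_mul_natDegree, hdeg, Polynomial.coeff_pow_mul_natDegree, hμ, sub_self]
    rw [Polynomial.leadingCoeff_eq_zero] at h2
    rw [h2, Polynomial.natDegree_zero] at h
    omega

theorem degNorm_map_le (h0 : 0 < (T (X 0)).natDegree) (h1 : 0 < (T (X 1)).natDegree)
    (f : MvPolynomial (Fin 2) k) :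
    degNorm (T f) ≤ (weightNorm k (α := (T (X 0)).natDegree) h1).N f := by
  have hT0 : T (X 0) ≠ 0 := fun h => by simp [h] at h0
  have hT1 : T (X 1) ≠ 0 := fun h => by simp [h] at h1
  rw [map_eq_sum_support T f]
  refine degNorm_sum_le _ _ (MonomialNorm.nonneg _ _) fun d hd => ?_
  refine le_trans (le_of_eq ?_) ((weightNorm k h1).coeff f d (mem_support_iff.1 hd))
  rw [degNorm_mul, degNorm_mul, degNorm_pow, degNorm_pow,
    degNorm_algebraMap (mem_support_iff.1 hd), one_mul, weightNorm_X_zero, weightNorm_X_one,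
    degNorm_of_ne_zero hT0, degNorm_of_ne_zero hT1]

/-- If substituting into a coordinate lowers the degree that its weighted degree predicts, then the
coordinate has the top part of an elementary transformation. -/
theorem exists_isEdged (Φ : Polynomial (Polynomial k) ≃ₐ[k] MvPolynomial (Fin 2) k)
    (h0 : 0 < (T (X 0)).natDegree) (h1 : 0 < (T (X 1)).natDegree)
    {f : MvPolynomial (Fin 2) k} (hΦ : f = Φ (Polynomial.C Polynomial.X))
    (hf : (T f).natDegree < wdeg (T (X 0)).natDegree (T (X 1)).natDegree f) :
    ∃ (a b : ℕ) (μ : k) (e : ℕ), 0 < a ∧ 0 < b ∧ μ ≠ 0 ∧ 0 < e ∧ (a = 1 ∨ b = 1) ∧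
      a * (T (X 0)).natDegree = b * (T (X 1)).natDegree ∧
      (T (X 0 ^ a - C μ * X 1 ^ b)).natDegree < a * (T (X 0)).natDegree ∧ IsEdged a b μ e f := by
  obtain ⟨g, b, a, hg, hba, hg0, hg1⟩ := Nat.exists_coprime' (Nat.gcd_pos_of_pos_left
    (T (X 1)).natDegree h0)
  have hab := hba.symm
  obtain ⟨μ, hμ, hlc⟩ := exists_leadingCoeff_pow_eq h0 h1 hg0 hg1 hab hf
  have hb : 0 < b := Nat.pos_of_ne_zero (by rintro rfl; omega)
  have ha : 0 < a := Nat.pos_of_ne_zero (by rintro rfl; omega)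
  have hdeg : a * (T (X 0)).natDegree = b * (T (X 1)).natDegree := by rw [hg0, hg1]; ring
  have hbin := natDegree_map_binomial_lt h0 ha hdeg hlc
  have hf0 : f ≠ 0 := by rintro rfl; simp [wdeg] at hf
  set ν := weightNorm k (α := (T (X 0)).natDegree) h1 with hν
  set θ : ℝ := 2 ^ g with hθdef
  have hθ : 1 < θ := one_lt_pow₀ one_lt_two hg.ne'
  have hθ0 : 0 < θ := by linarith
  have n0 : ν.N (X 0) = θ ^ b := by rw [hν, weightNorm_X_zero, hg0, hθdef, ← pow_mul, mul_comm]
  have n1 : ν.N (X 1) = θ ^ a := by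
    rw [hν, weightNorm_X_one, hθdef, ← pow_mul, mul_comm, ← hg1]
  obtain ⟨d, -, hfn⟩ := MonomialNorm.eq_pow n0 n1 hf0
  set n := b * d 0 + a * d 1
  have hTf : degNorm (T f) < θ ^ n := by
    rw [← hfn, hν, weightNorm_of_ne_zero h1 hf0]
    exact (degNorm_le _).trans_lt (pow_lt_pow_right₀ one_lt_two hf)
  have hTh : degNorm (T (X 0 ^ a - C μ * X 1 ^ b)) < θ ^ (a * b) := by
    refine (degNorm_le _).trans_lt ?_
    rw [hθdef, ← pow_mul]
    refine pow_lt_pow_right₀ one_lt_two (hbin.trans_le (le_of_eq ?_))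
    rw [hg0]; ring
  obtain ⟨M, hM, hdiv⟩ := MonomialNorm.exists_division (μ := μ) n0 n1 ha hab hθ n
  obtain ⟨q, c, hlt, hq⟩ := hdiv f hfn.le
  -- The substitution never exceeds the predicted degree on `q` and falls strictly below it on the
  -- binomial.
  have hTq : degNorm (T (q * (X 0 ^ a - C μ * X 1 ^ b))) < θ ^ n := by
    rw [map_mul, degNorm_mul]
    by_cases hq0 : q = 0
    · rw [hq0, map_zero, degNorm_zero, zero_mul]; positivity
    · refine lt_of_lt_of_le ?_ hq
      exact (mul_le_mul_of_nonneg_right (degNorm_map_le h0 h1 q) (degNorm_nonneg _)).trans_lt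
        (mul_lt_mul_of_pos_left hTh (ν.pos q hq0))
  -- A monomial attains its predicted degree under `T`, whereas every other term of the division has
  -- a smaller image. So the remainder vanishes and the binomial divides the top part of `f`.
  have hcM : C c * M = 0 := by
    by_contra hcM
    have hc : c ≠ 0 := by rintro rfl; simp at hcM
    rcases hM with rfl | ⟨i, l, hil, rfl⟩
    · simp at hcM
    have hT0 : T (X 0) ≠ 0 := fun h => by simp [h] at h0
    have hT1 : T (X 1) ≠ 0 := fun h => by simp [h] at h1
    have e1 : degNorm (T (C c * (X 0 ^ i * X 1 ^ l))) = θ ^ n := by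
      rw [map_mul, map_mul, map_pow, map_pow, degNorm_mul, degNorm_mul, degNorm_pow, degNorm_pow,
        ← algebraMap_eq, AlgHom.commutes, degNorm_algebraMap hc, one_mul, degNorm_of_ne_zero hT0,
        degNorm_of_ne_zero hT1, hg0, hg1, hθdef, ← pow_mul, ← pow_mul, ← pow_mul, ← pow_add, ← hil]
      congr 1; ring
    have e2 : T (C c * (X 0 ^ i * X 1 ^ l)) = T f +
        (T (-1 * (q * (X 0 ^ a - C μ * X 1 ^ b))) + T (-1 *
        (f - (q * (X 0 ^ a - C μ * X 1 ^ b) + C c * (X 0 ^ i * X 1 ^ l))))) := by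
      rw [← map_add, ← map_add]; congr 1; ring
    have eneg : ∀ p, degNorm (T (-1 * p)) = degNorm (T p) := fun p => by
      rw [map_mul, degNorm_mul, map_neg, map_one, degNorm_of_ne_zero (by simp)]; simp
    have e3 : degNorm (T (C c * (X 0 ^ i * X 1 ^ l))) < θ ^ n := by
      rw [e2]
      refine (degNorm_add _ _).trans_lt (max_lt hTf ((degNorm_add _ _).trans_lt (max_lt ?_ ?_)))
      · rw [eneg]; exact hTq
      · rw [eneg]; exact (degNorm_map_le h0 h1 _).trans_lt hlt
    rw [e1] at e3
    exact lt_irrefl _ e3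
  rw [hcM, add_zero, ← hfn] at hlt
  -- The derivations are taken along the coordinate complementary to `f`, so they annihilate `f` and
  -- are not all zero.
  obtain ⟨K, hK, hbd, hatt⟩ := HasseSystem.exists_bounded (E := HasseSystem.ofAlgEquiv Φ) ν
    ⟨1, one_pos, by rw [HasseSystem.ofAlgEquiv_X]; exact one_ne_zero⟩
  obtain ⟨hone, c', e, hce⟩ := HasseSystem.eq_one_or_eq_one_and_exists hK hbd hatt n0 n1 ha hb hab
    hθ hμ hf0 (fun i hi => by rw [hΦ]; exact HasseSystem.ofAlgEquiv_C Φ _ hi) hlt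
  have hc' : c' ≠ 0 := by rintro rfl; simp at hce
  have hN : ν.N f = θ ^ (a * b * e) := by
    rw [← ν.eq_of_sub_lt hce, ν.mul, ν.const _ hc', ν.pow,
      MonomialNorm.norm_binomial n0 n1 hb hθ, one_mul, ← pow_mul]
  refine ⟨a, b, μ, e, ha, hb, hμ, Nat.pos_of_ne_zero ?_, hone, hdeg, hbin, c', hc',
    fun d hd => ?_⟩
  · rintro rfl
    rw [hν, weightNorm_of_ne_zero h1 hf0, mul_zero, pow_zero, pow_eq_one_iff_of_nonneg (by norm_num)
      (by omega)] at hN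
    norm_num at hN
  · have h2 := ((ν.coeff _ d (mem_support_iff.1 hd)).trans_lt hce)
    rw [hN, n0, n1, show (θ ^ b) ^ d 0 * (θ ^ a) ^ d 1 = θ ^ (b * d 0 + a * d 1) by
      rw [pow_add, pow_mul, pow_mul], pow_lt_pow_iff_right₀ hθ] at h2
    exact h2

end MvPolynomial

/-! ### Degrees of edged polynomials. -/

namespace MvPolynomial

variable {k : Type*} [Field k]

theorem natDegree_map_le {T : MvPolynomial (Fin 2) k →ₐ[k] Polynomial (Polynomial k)} {α β n : ℕ}
    (h0 : (T (X 0)).natDegree ≤ α) (h1 : (T (X 1)).natDegree ≤ β) {f : MvPolynomial (Fin 2) k}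
    (hf : ∀ d ∈ f.support, α * d 0 + β * d 1 ≤ n) : (T f).natDegree ≤ n := by
  rw [map_eq_sum_support T f]
  refine Polynomial.natDegree_sum_le_of_forall_le _ _ fun d hd => ?_
  rw [algebraMap_polynomial_polynomial]
  refine (Polynomial.natDegree_C_mul_le _ _).trans (le_trans ?_ (hf d hd))
  refine Polynomial.natDegree_mul_le.trans (add_le_add ?_ ?_)
  · exact Polynomial.natDegree_pow_le.trans (by rw [mul_comm α]; exact Nat.mul_le_mul_left _ h0)
  · exact Polynomial.natDegree_pow_le.trans (by rw [mul_comm β]; exact Nat.mul_le_mul_left _ h1)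

theorem homogenization_X_zero (α β : ℕ) : homogenization α β (X 0 : MvPolynomial (Fin 2) k)
    = Polynomial.C Polynomial.X * Polynomial.X ^ α := by simp [homogenization]

theorem homogenization_X_one (α β : ℕ) :
    homogenization α β (X 1 : MvPolynomial (Fin 2) k) = Polynomial.X ^ β := by
  simp [homogenization]

theorem wdeg_X_zero (α β : ℕ) : wdeg α β (X 0 : MvPolynomial (Fin 2) k) = α := by
  rw [wdeg, homogenization_X_zero, Polynomial.natDegree_C_mul (by simp), Polynomial.natDegree_X_pow]

theorem wdeg_X_one (α β : ℕ) : wdeg α β (X 1 : MvPolynomial (Fin 2) k) = β := by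
  rw [wdeg, homogenization_X_one, Polynomial.natDegree_X_pow]

theorem wdeg_le {α β n : ℕ} {f : MvPolynomial (Fin 2) k}
    (hf : ∀ d ∈ f.support, α * d 0 + β * d 1 ≤ n) : wdeg α β f ≤ n :=
  natDegree_map_le (wdeg_X_zero α β).le (wdeg_X_one α β).le hf

theorem wdeg_map_le (S : MvPolynomial (Fin 2) k →ₐ[k] MvPolynomial (Fin 2) k)
    {α β α' β' : ℕ} (hβ : 0 < β) (h0 : wdeg α' β' (S (X 0)) ≤ α)
    (h1 : wdeg α' β' (S (X 1)) ≤ β) (f : MvPolynomial (Fin 2) k) :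
    wdeg α' β' (S f) ≤ wdeg α β f :=
  natDegree_map_le (T := (homogenization α' β').comp S) h0 h1 fun _ hd => le_wdeg hβ hd

theorem wdeg_C (α β : ℕ) (c : k) : wdeg α β (C c : MvPolynomial (Fin 2) k) = 0 := by
  rw [wdeg, ← algebraMap_eq, AlgHom.commutes, algebraMap_polynomial_polynomial,
    Polynomial.natDegree_C]

theorem wdeg_mul_le (α β : ℕ) (f g : MvPolynomial (Fin 2) k) :
    wdeg α β (f * g) ≤ wdeg α β f + wdeg α β g := by
  rw [wdeg, map_mul]; exact Polynomial.natDegree_mul_le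

theorem wdeg_pow (α β : ℕ) (f : MvPolynomial (Fin 2) k) (n : ℕ) :
    wdeg α β (f ^ n) = n * wdeg α β f := by
  rw [wdeg, map_pow]; exact Polynomial.natDegree_pow _ _

theorem wdeg_add_le (α β : ℕ) (f g : MvPolynomial (Fin 2) k) :
    wdeg α β (f + g) ≤ max (wdeg α β f) (wdeg α β g) := by
  rw [wdeg, map_add]; exact Polynomial.natDegree_add_le _ _

theorem wdeg_sub_le (α β : ℕ) (f g : MvPolynomial (Fin 2) k) :
    wdeg α β (f - g) ≤ max (wdeg α β f) (wdeg α β g) := by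
  rw [wdeg, map_sub]; exact Polynomial.natDegree_sub_le _ _

theorem wdeg_C_mul {c : k} (hc : c ≠ 0) (α β : ℕ) (f : MvPolynomial (Fin 2) k) :
    wdeg α β (C c * f) = wdeg α β f := by
  rw [wdeg, map_mul, ← algebraMap_eq, AlgHom.commutes, algebraMap_polynomial_polynomial,
    Polynomial.natDegree_C_mul (by simpa using hc)]
  rfl

theorem wdeg_C_mul_le (c : k) (α β : ℕ) (f : MvPolynomial (Fin 2) k) :
    wdeg α β (C c * f) ≤ wdeg α β f := by
  simpa [wdeg_C] using wdeg_mul_le α β (C c) f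

theorem exists_eq_C_of_wdeg_eq_zero {α β : ℕ} (hα : 0 < α) (hβ : 0 < β)
    {f : MvPolynomial (Fin 2) k} (hf : wdeg α β f = 0) : f = C (f.coeff 0) := by
  classical
  ext d
  rw [coeff_C]
  split_ifs with h
  · rw [h]
  · by_contra hd
    have h1 := le_wdeg (α := α) hβ (mem_support_iff.2 hd)
    refine h (Finsupp.ext fun z => ?_)
    have h2 : α * d 0 = 0 := by omega
    have h3 : β * d 1 = 0 := by omega
    fin_cases z
    · exact ((Nat.mul_eq_zero.1 h2).resolve_left hα.ne').symm
    · exact ((Nat.mul_eq_zero.1 h3).resolve_left hβ.ne').symm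

section

variable {T : MvPolynomial (Fin 2) k →ₐ[k] Polynomial (Polynomial k)}

theorem map_C_mul (T : MvPolynomial (Fin 2) k →ₐ[k] Polynomial (Polynomial k)) (c : k)
    (f : MvPolynomial (Fin 2) k) : T (C c * f) = Polynomial.C (Polynomial.C c) * T f := by
  rw [map_mul, ← algebraMap_eq, AlgHom.commutes, algebraMap_polynomial_polynomial]

theorem natDegree_map_C_mul (T : MvPolynomial (Fin 2) k →ₐ[k] Polynomial (Polynomial k)) {c : k}
    (hc : c ≠ 0) (f : MvPolynomial (Fin 2) k) : (T (C c * f)).natDegree = (T f).natDegree := by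
  rw [map_C_mul, Polynomial.natDegree_C_mul (by simpa using hc)]

theorem natDegree_map_binomial_le (T : MvPolynomial (Fin 2) k →ₐ[k] Polynomial (Polynomial k))
    (a b : ℕ) (μ : k) : (T (X 0 ^ a - C μ * X 1 ^ b)).natDegree
      ≤ max (a * (T (X 0)).natDegree) (b * (T (X 1)).natDegree) := by
  rw [map_sub, map_C_mul, map_pow, map_pow]
  refine (Polynomial.natDegree_sub_le _ _).trans (max_le_max Polynomial.natDegree_pow_le ?_)
  exact (Polynomial.natDegree_C_mul_le _ _).trans Polynomial.natDegree_pow_le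

/-- Two terms of different degrees cannot cancel, so a drop requires equal degrees. -/
theorem natDegree_map_binomial (T : MvPolynomial (Fin 2) k →ₐ[k] Polynomial (Polynomial k))
    (a b : ℕ) {μ : k} (hμ : μ ≠ 0) :
    (T (X 0 ^ a - C μ * X 1 ^ b)).natDegree
        = max (a * (T (X 0)).natDegree) (b * (T (X 1)).natDegree) ∨
      (a * (T (X 0)).natDegree = b * (T (X 1)).natDegree ∧
        (T (X 0 ^ a - C μ * X 1 ^ b)).natDegree < a * (T (X 0)).natDegree) := by
  have hle := natDegree_map_binomial_le T a b μ
  have e1 : (T (C μ * X 1 ^ b)).natDegree = b * (T (X 1)).natDegree := by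
    rw [natDegree_map_C_mul T hμ, map_pow, Polynomial.natDegree_pow]
  have e0 : (T (X 0 ^ a)).natDegree = a * (T (X 0)).natDegree := by
    rw [map_pow, Polynomial.natDegree_pow]
  rcases lt_trichotomy (a * (T (X 0)).natDegree) (b * (T (X 1)).natDegree) with h | h | h
  · left
    rw [max_eq_right h.le, map_sub, Polynomial.natDegree_sub_eq_right_of_natDegree_lt (by omega), e1]
  · rw [← h, max_self] at hle ⊢
    exact hle.eq_or_lt.imp_right fun h2 => ⟨rfl, h2⟩
  · left
    rw [max_eq_left h.le, map_sub, Polynomial.natDegree_sub_eq_left_of_natDegree_lt (by omega), e0]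

/-- If the binomial does not cancel under `T`, the image of its power dominates: a remaining
monomial lies strictly below the edge, and weighting it by the degrees of `T x` and `T y` gives less
than `e * M`. -/
theorem IsEdged.natDegree_map {a b e : ℕ} {μ : k} {f : MvPolynomial (Fin 2) k}
    (h : IsEdged a b μ e f) (h0 : 0 < (T (X 0)).natDegree) (ha : 0 < a) (hb : 0 < b) (he : 0 < e)
    (hT : (T (X 0 ^ a - C μ * X 1 ^ b)).natDegree
      = max (a * (T (X 0)).natDegree) (b * (T (X 1)).natDegree)) :
    (T f).natDegree = e * max (a * (T (X 0)).natDegree) (b * (T (X 1)).natDegree) := by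
  obtain ⟨c, hc, hd⟩ := h
  set M := max (a * (T (X 0)).natDegree) (b * (T (X 1)).natDegree) with hM
  have hM0 : a * (T (X 0)).natDegree ≤ M := le_max_left _ _
  have hM1 : b * (T (X 1)).natDegree ≤ M := le_max_right _ _
  have hMpos : 0 < M := lt_of_lt_of_le (Nat.mul_pos ha h0) hM0
  set r := f - C c * (X 0 ^ a - C μ * X 1 ^ b) ^ e with hr
  have hf : f = C c * (X 0 ^ a - C μ * X 1 ^ b) ^ e + r := by rw [hr]; ring
  have e1 : (T (C c * (X 0 ^ a - C μ * X 1 ^ b) ^ e)).natDegree = e * M := by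
    rw [natDegree_map_C_mul T hc, map_pow, Polynomial.natDegree_pow, hT]
  -- The truncated subtraction is harmless, since `e * M` is positive.
  have e2 : (T r).natDegree ≤ e * M - 1 := by
    refine natDegree_map_le le_rfl le_rfl fun d hdr => ?_
    have h1 := hd d hdr
    have hab : 0 < a * b := Nat.mul_pos ha hb
    have h2 : a * b * ((T (X 0)).natDegree * d 0 + (T (X 1)).natDegree * d 1)
        ≤ (b * d 0 + a * d 1) * M := by
      calc _ = b * d 0 * (a * (T (X 0)).natDegree) + a * d 1 * (b * (T (X 1)).natDegree) := by ring
        _ ≤ b * d 0 * M + a * d 1 * M :=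
          add_le_add (Nat.mul_le_mul_left _ hM0) (Nat.mul_le_mul_left _ hM1)
        _ = _ := by ring
    have h3 : (b * d 0 + a * d 1) * M < a * b * e * M := Nat.mul_lt_mul_of_pos_right h1 hMpos
    have h4 := lt_of_le_of_lt h2 h3
    rw [mul_assoc (a * b)] at h4
    have := Nat.lt_of_mul_lt_mul_left h4
    omega
  have hpos : 0 < e * M := Nat.mul_pos he hMpos
  rw [hf, map_add, Polynomial.natDegree_add_eq_left_of_natDegree_lt (by omega), e1]

theorem IsEdged.wdeg_le {m e : ℕ} {μ : k} {f : MvPolynomial (Fin 2) k}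
    (h : IsEdged 1 m μ e f) : wdeg m 1 f ≤ m * e := by
  obtain ⟨c, hc, hd⟩ := h
  have hf : f = C c * (X 0 ^ 1 - C μ * X 1 ^ m) ^ e + (f - C c * (X 0 ^ 1 - C μ * X 1 ^ m) ^ e) := by
    ring
  rw [hf]
  refine (wdeg_add_le _ _ _ _).trans (max_le ?_ ?_)
  · rw [wdeg_C_mul hc, wdeg_pow, mul_comm m]
    refine Nat.mul_le_mul_left _ ((natDegree_map_binomial_le _ _ _ _).trans ?_)
    change max (1 * wdeg m 1 (X 0)) (m * wdeg m 1 (X 1)) ≤ m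
    rw [wdeg_X_zero, wdeg_X_one]; simp
  · refine MvPolynomial.wdeg_le fun d h => ?_
    have := hd d h
    simp only [one_mul] at this ⊢
    exact this.le

/-- `x` and `y ^ m` are distinct monomials, so nothing cancels in the ordinary degree, even for `m =
1`. -/
theorem wdeg_one_one_binomial {m : ℕ} (hm : 0 < m) {μ : k} (hμ : μ ≠ 0) :
    wdeg 1 1 (X 0 ^ 1 - C μ * X 1 ^ m : MvPolynomial (Fin 2) k)
      = max (1 * wdeg 1 1 (X 0 : MvPolynomial (Fin 2) k))
        (m * wdeg 1 1 (X 1 : MvPolynomial (Fin 2) k)) := by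
  classical
  refine le_antisymm (natDegree_map_binomial_le _ _ _ _) ?_
  rw [wdeg_X_zero, wdeg_X_one, one_mul, mul_one, max_eq_right hm]
  have hne : Finsupp.single (0 : Fin 2) 1 ≠ Finsupp.single 1 m := by
    intro h
    have := DFunLike.congr_fun h 0
    simp at this
  have h := le_wdeg (α := 1) (β := 1) one_pos (d := Finsupp.single 1 m)
    (f := (X 0 ^ 1 - C μ * X 1 ^ m : MvPolynomial (Fin 2) k)) (by
      rw [mem_support_iff]
      simp [coeff_X_pow, coeff_C_mul, coeff_X, hne, hμ])
  simpa using h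

theorem IsEdged.wdeg_one_one {m e : ℕ} {μ : k} {f : MvPolynomial (Fin 2) k}
    (h : IsEdged 1 m μ e f) (hm : 0 < m) (he : 0 < e) (hμ : μ ≠ 0) : wdeg 1 1 f = m * e := by
  have := h.natDegree_map (T := homogenization 1 1) (by
    rw [homogenization_X_zero]; simp) one_pos hm he (wdeg_one_one_binomial hm hμ)
  change wdeg 1 1 f = e * max (1 * wdeg 1 1 (X 0)) (m * wdeg 1 1 (X 1)) at this
  rw [this, wdeg_X_zero, wdeg_X_one, one_mul, mul_one, max_eq_right hm, mul_comm]

end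

end MvPolynomial

/-! ### Recognizing the two factors from supports and degrees. -/

namespace PlaneAut

open MvPolynomial

variable {k : Type*} [Field k]

theorem component_def (φ : PlaneAut k) (i : Fin 2) : φ.component i = φ.unop (X i) := rfl

theorem unop_mul_apply (φ ψ : PlaneAut k) (f : MvPolynomial (Fin 2) k) :
    (φ * ψ).unop f = ψ.unop (φ.unop f) := rfl

theorem unop_inv_apply (φ : PlaneAut k) (f : MvPolynomial (Fin 2) k) :
    φ.unop (φ⁻¹.unop f) = f := by
  rw [← unop_mul_apply, inv_mul_cancel]; rfl

theorem unop_apply_inv (φ : PlaneAut k) (f : MvPolynomial (Fin 2) k) :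
    φ⁻¹.unop (φ.unop f) = f := by
  rw [← unop_mul_apply, mul_inv_cancel]; rfl

theorem unop_C (φ : PlaneAut k) (c : k) : φ.unop (C c) = C c := φ.unop.commutes c

theorem ext_component {φ ψ : PlaneAut k} (h0 : φ.component 0 = ψ.component 0)
    (h1 : φ.component 1 = ψ.component 1) : φ = ψ := by
  apply MulOpposite.unop_injective
  have : (φ.unop : MvPolynomial (Fin 2) k →ₐ[k] MvPolynomial (Fin 2) k) = ψ.unop := by
    ext1 i
    fin_cases i
    · exact h0
    · exact h1
  exact AlgEquiv.coe_toAlgHom_injective this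

theorem wdeg_component_pos (φ : PlaneAut k) {α β : ℕ} (hα : 0 < α) (hβ : 0 < β) (i : Fin 2) :
    0 < wdeg α β (φ.component i) := by
  refine Nat.pos_of_ne_zero fun h => ?_
  have h1 := exists_eq_C_of_wdeg_eq_zero hα hβ h
  rw [component_def, ← φ.unop_C] at h1
  have h2 := φ.unop.injective h1
  have h3 := congrArg (wdeg 1 1) h2
  rw [wdeg_C] at h3
  fin_cases i
  · rw [show (X ((fun i => i) ⟨0, by simp⟩) : MvPolynomial (Fin 2) k) = X 0 from rfl,
      wdeg_X_zero] at h3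
    omega
  · rw [show (X ((fun i => i) ⟨1, by simp⟩) : MvPolynomial (Fin 2) k) = X 1 from rfl,
      wdeg_X_one] at h3
    omega

theorem exists_algEquiv_component (φ : PlaneAut k) (i : Fin 2) :
    ∃ Φ : Polynomial (Polynomial k) ≃ₐ[k] MvPolynomial (Fin 2) k,
      φ.component i = Φ (Polynomial.C Polynomial.X) := by
  fin_cases i
  · refine ⟨(Polynomial.Bivariate.equivMvPolynomial k).trans φ.unop, ?_⟩
    simp [component]
  · refine ⟨((Polynomial.Bivariate.equivMvPolynomial k).trans
      (renameEquiv k (Equiv.swap 0 1))).trans φ.unop, ?_⟩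
    simp [component]

theorem isAffine_of_support {φ : PlaneAut k}
    (h : ∀ i, ∀ d ∈ (φ.component i).support, d 0 + d 1 ≤ 1) : φ.IsAffine := by
  classical
  have hform : ∀ f : MvPolynomial (Fin 2) k, (∀ d ∈ f.support, d 0 + d 1 ≤ 1) →
      f = C (f.coeff (Finsupp.single 0 1)) * X 0 + C (f.coeff (Finsupp.single 1 1)) * X 1
        + C (f.coeff 0) := by
    intro f hf
    have hne : Finsupp.single (0 : Fin 2) 1 ≠ Finsupp.single 1 1 := by
      intro h
      have := DFunLike.congr_fun h 0
      simp at this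
    have hz0 : (0 : Fin 2 →₀ ℕ) ≠ Finsupp.single 0 1 := by simp [eq_comm]
    have hz1 : (0 : Fin 2 →₀ ℕ) ≠ Finsupp.single 1 1 := by simp [eq_comm]
    ext d
    by_cases hd : d ∈ f.support
    · have h1 := hf d hd
      have : d = Finsupp.single 0 1 ∨ d = Finsupp.single 1 1 ∨ d = 0 := by
        have h2 : (d 0 = 1 ∧ d 1 = 0) ∨ (d 0 = 0 ∧ d 1 = 1) ∨ (d 0 = 0 ∧ d 1 = 0) := by omega
        refine h2.imp (fun h2 => ?_) (Or.imp (fun h2 => ?_) (fun h2 => ?_)) <;>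
        · ext z
          fin_cases z <;> simp [h2]
      rcases this with rfl | rfl | rfl <;>
        simp [coeff_C, coeff_X, coeff_C_mul, hne, hne.symm, hz0, hz1]
    · have h0 := notMem_support_iff.1 hd
      rw [h0]
      have e0 : ∀ e, f.coeff e * (if e = d then 1 else 0) = 0 := fun e => by
        split_ifs with h
        · rw [h, h0, zero_mul]
        · rw [mul_zero]
      simp only [coeff_add, coeff_C_mul, coeff_X, coeff_C, e0]
      split_ifs with h
      · rw [h, h0]; simp
      · simp
  set f := φ.component 0 with hf
  set g := φ.component 1 with hg
  have hf' := hform f (h 0)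
  have hg' := hform g (h 1)
  refine ⟨_, _, _, _, _, _, fun hdet => ?_, hf', hg'⟩
  set a := f.coeff (Finsupp.single 0 1)
  set b := f.coeff (Finsupp.single 1 1)
  set c := g.coeff (Finsupp.single 0 1)
  set d := g.coeff (Finsupp.single 1 1)
  -- By injectivity of the comorphism, no nontrivial linear combination of the components is
  -- constant; a vanishing determinant would produce one.
  have key : ∀ s t r : k, C s * f + C t * g = C r → s = 0 ∧ t = 0 := by
    intro s t r hst
    rw [hf, hg, component_def, component_def, ← φ.unop_C s, ← φ.unop_C t, ← φ.unop_C r,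
      ← map_mul, ← map_mul, ← map_add] at hst
    have h2 := φ.unop.injective hst
    have hne : Finsupp.single (0 : Fin 2) 1 ≠ Finsupp.single 1 1 := by
      intro h
      have := DFunLike.congr_fun h 0
      simp at this
    have hz0 : (0 : Fin 2 →₀ ℕ) ≠ Finsupp.single 0 1 := by simp [eq_comm]
    have hz1 : (0 : Fin 2 →₀ ℕ) ≠ Finsupp.single 1 1 := by simp [eq_comm]
    constructor
    · have := congrArg (MvPolynomial.coeff (Finsupp.single 0 1)) h2
      simpa [coeff_C, coeff_X, coeff_C_mul, hne, hne.symm, hz0, hz1] using this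
    · have := congrArg (MvPolynomial.coeff (Finsupp.single 1 1)) h2
      simpa [coeff_C, coeff_X, coeff_C_mul, hne, hne.symm, hz0, hz1] using this
  have hC : (C a * C d - C b * C c : MvPolynomial (Fin 2) k) = 0 := by
    rw [← C_mul, ← C_mul, ← C_sub, hdet, C_0]
  generalize hr : f.coeff 0 = r at hf'
  generalize hs : g.coeff 0 = s at hg'
  have k1 := key d (-b) (d * r - b * s) (by
    simp only [C_neg, C_sub, C_mul]
    linear_combination X 0 * hC + C d * hf' - C b * hg')
  have k2 := key c (-a) (c * r - a * s) (by
    simp only [C_neg, C_sub, C_mul]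
    linear_combination (-X 1) * hC + C c * hf' - C a * hg')
  have k3 := key 1 0 r (by
    have ha : a = 0 := by simpa using k2.2
    have hb : b = 0 := by simpa using k1.2
    rw [ha, hb] at hf'
    rw [hf']
    simp)
  exact one_ne_zero k3.1

end PlaneAut

namespace PlaneAut

open MvPolynomial

variable {k : Type*} [Field k]

theorem eq_of_support_subset_line {f : MvPolynomial (Fin 2) k}
    (hf : ∀ d ∈ f.support, d 0 = 0 ∧ d 1 ≤ 1) :
    f = C (f.coeff (Finsupp.single 1 1)) * X 1 + C (f.coeff 0) := by
  classical
  have hz1 : (0 : Fin 2 →₀ ℕ) ≠ Finsupp.single 1 1 := by simp [eq_comm]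
  ext d
  by_cases hd : d ∈ f.support
  · have h1 := hf d hd
    have : d = Finsupp.single 1 1 ∨ d = 0 := by
      have h2 : (d 0 = 0 ∧ d 1 = 1) ∨ (d 0 = 0 ∧ d 1 = 0) := by omega
      refine h2.imp (fun h2 => ?_) (fun h2 => ?_) <;>
      · ext z
        fin_cases z <;> simp [h2]
    rcases this with rfl | rfl <;> simp [coeff_C, coeff_X, coeff_C_mul, hz1]
  · have h0 := notMem_support_iff.1 hd
    rw [h0]
    have e0 : ∀ e, f.coeff e * (if e = d then 1 else 0) = 0 := fun e => by
      split_ifs with h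
      · rw [h, h0, zero_mul]
      · rw [mul_zero]
    simp only [coeff_add, coeff_C_mul, coeff_X, coeff_C, e0]
    split_ifs with h
    · rw [h, h0]; simp
    · simp

/-- View polynomials as polynomials in `x` over `k[y]`. The comorphism acts as a substitution on
coefficients followed by composition with the first component `F`. As `x` lies in the image, `F` has
degree one and its leading coefficient is a unit of `k[y]`. -/
theorem isDeJonquieres_of_support {φ : PlaneAut k}
    (h : ∀ d ∈ (φ.component 1).support, d 0 = 0 ∧ d 1 ≤ 1) : φ.IsDeJonquieres := by
  have h1 := eq_of_support_subset_line h
  set b := (φ.component 1).coeff (Finsupp.single 1 1)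
  set c := (φ.component 1).coeff 0
  have hb : b ≠ 0 := by
    intro hb
    have := φ.wdeg_component_pos one_pos one_pos 1
    rw [h1, hb, C_0, zero_mul, zero_add, wdeg_C] at this
    exact lt_irrefl _ this
  let H : MvPolynomial (Fin 2) k →ₐ[k] Polynomial (Polynomial k) :=
    aeval ![Polynomial.X, Polynomial.C Polynomial.X]
  let G : Polynomial (Polynomial k) →ₐ[k] MvPolynomial (Fin 2) k :=
    ((Polynomial.Bivariate.equivMvPolynomial k).trans (renameEquiv k (Equiv.swap 0 1))).toAlgHom
  have hG : ∀ f, G (H f) = f := by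
    have : G.comp H = AlgHom.id k _ := by
      ext i
      fin_cases i <;> simp [G, H]
    exact fun f => DFunLike.congr_fun this f
  have hGC : ∀ r : Polynomial k, G (Polynomial.C r) = Polynomial.aeval (X 1) r := by
    have : G.comp (IsScalarTower.toAlgHom k (Polynomial k) (Polynomial (Polynomial k)))
        = Polynomial.aeval (X 1) := by
      ext
      simp [G]
    exact fun r => DFunLike.congr_fun this r
  let E : Polynomial k →+* Polynomial k :=
    Polynomial.eval₂RingHom Polynomial.C (Polynomial.C b * Polynomial.X + Polynomial.C c)
  set F := H (φ.component 0) with hF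
  have key : ∀ q, H (φ.unop q) = ((H q).map E).comp F := by
    intro q
    induction q using MvPolynomial.induction_on with
    | C a =>
      rw [φ.unop_C, ← algebraMap_eq, AlgHom.commutes, algebraMap_polynomial_polynomial]
      simp [E]
    | add p q hp hq => simp only [map_add, hp, hq, Polynomial.map_add, Polynomial.add_comp]
    | mul_X p i hp =>
      simp only [map_mul, hp, Polynomial.map_mul, Polynomial.mul_comp]
      congr 1
      fin_cases i
      · simp [H, F, component]
      · change H (φ.component 1) = _
        rw [h1]
        have : ∀ a : k, H (C a) = Polynomial.C (Polynomial.C a) := fun a => by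
          rw [← algebraMap_eq, AlgHom.commutes, algebraMap_polynomial_polynomial]
        simp only [map_add, map_mul, this]
        simp [H, E]
  have hX : ((H (φ⁻¹.component 0)).map E).comp F = Polynomial.X := by
    rw [← key, component_def, unop_inv_apply]
    simp [H]
  have hdeg := congrArg Polynomial.natDegree hX
  rw [Polynomial.natDegree_comp, Polynomial.natDegree_X] at hdeg
  have hF1 := Nat.eq_one_of_mul_eq_one_left hdeg
  have hlead := congrArg Polynomial.leadingCoeff hX
  rw [Polynomial.leadingCoeff_comp (by omega), Nat.eq_one_of_mul_eq_one_right hdeg, pow_one,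
    Polynomial.leadingCoeff_X] at hlead
  obtain ⟨a, ha, ha'⟩ := Polynomial.isUnit_iff.1 (IsUnit.of_mul_eq_one_right _ hlead)
  have hFe : F = Polynomial.C (Polynomial.C a) * Polynomial.X + Polynomial.C (F.coeff 0) := by
    rw [ha', Polynomial.leadingCoeff, hF1]
    exact Polynomial.eq_X_add_C_of_natDegree_le_one hF1.le
  refine ⟨a, b, c, F.coeff 0, ha.ne_zero, hb, ?_, h1⟩
  rw [← hG (φ.component 0), ← hF, hFe]
  simp only [map_add, map_mul, hGC, Polynomial.coeff_add]
  simp [G]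

theorem isAffine_inv_iff {φ : PlaneAut k} : φ⁻¹.IsAffine ↔ φ.IsAffine :=
  (affineGroup k).inv_mem_iff (x := φ)

theorem isDeJonquieres_inv_iff {φ : PlaneAut k} : φ⁻¹.IsDeJonquieres ↔ φ.IsDeJonquieres :=
  (deJonquieresGroup k).inv_mem_iff (x := φ)

theorem isAffine_of_wdeg {φ : PlaneAut k} (h : ∀ i, wdeg 1 1 (φ.component i) ≤ 1) :
    φ.IsAffine :=
  isAffine_of_support fun i d hd => by
    have := (le_wdeg (α := 1) one_pos hd).trans (h i)
    omega

/-- The edge of a binomial relation between degrees is unique. -/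
theorem binomial_unique {T : MvPolynomial (Fin 2) k →ₐ[k] Polynomial (Polynomial k)} {m m' : ℕ}
    {c c' : k} (h1 : 0 < (T (X 1)).natDegree)
    (h : (T (X 0)).natDegree = m * (T (X 1)).natDegree)
    (h' : (T (X 0)).natDegree = m' * (T (X 1)).natDegree)
    (hc : (T (X 0 - C c * X 1 ^ m)).natDegree < (T (X 0)).natDegree)
    (hc' : (T (X 0 - C c' * X 1 ^ m')).natDegree < (T (X 0)).natDegree) : m = m' ∧ c = c' := by
  obtain rfl : m = m' := Nat.eq_of_mul_eq_mul_right h1 (h.symm.trans h')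
  refine ⟨rfl, ?_⟩
  by_contra hne
  -- The difference is a nonzero multiple of `y ^ m`, which has full degree; it cannot be a
  -- difference of two elements of smaller degree.
  have h2 : (X 0 - C c' * X 1 ^ m) - (X 0 - C c * X 1 ^ m)
      = (C (c - c') * X 1 ^ m : MvPolynomial (Fin 2) k) := by
    rw [C_sub]; ring
  have h3 : (T (C (c - c') * X 1 ^ m)).natDegree = m * (T (X 1)).natDegree := by
    rw [natDegree_map_C_mul T (sub_ne_zero.2 hne), map_pow, Polynomial.natDegree_pow]
  rw [← h2, map_sub] at h3
  have h4 := Polynomial.natDegree_sub_le (T (X 0 - C c' * X 1 ^ m)) (T (X 0 - C c * X 1 ^ m))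
  rw [h3] at h4
  rcases le_max_iff.1 h4 with h4 | h4 <;> omega

end PlaneAut

/-! ### The edge of an automorphism that preserves a degree. -/

namespace PlaneAut

open MvPolynomial

variable {k : Type*} [Field k]

section

variable {T : MvPolynomial (Fin 2) k →ₐ[k] Polynomial (Polynomial k)} {g : PlaneAut k}

theorem natDegree_map_inv_component
    (hinv : ∀ f, (T (g.unop f)).natDegree = (T f).natDegree) (i : Fin 2) :
    (T (g⁻¹.component i)).natDegree = (T (X i)).natDegree := by
  rw [← hinv, component_def, unop_inv_apply]

/-- Either the inverse component has an edge, or it is small with respect to the degrees of `g`. -/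
theorem exists_isEdged_or (g : PlaneAut k) (i : Fin 2) :
    (∃ a b μ e, 0 < a ∧ 0 < b ∧ μ ≠ 0 ∧ 0 < e ∧ (a = 1 ∨ b = 1) ∧
      a * wdeg 1 1 (g.component 0) = b * wdeg 1 1 (g.component 1) ∧
      wdeg 1 1 (g.component 0 ^ a - C μ * g.component 1 ^ b) < a * wdeg 1 1 (g.component 0) ∧
      IsEdged a b μ e (g⁻¹.component i)) ∨
    ∀ d ∈ (g⁻¹.component i).support,
      wdeg 1 1 (g.component 0) * d 0 + wdeg 1 1 (g.component 1) * d 1 ≤ 1 := by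
  let S : MvPolynomial (Fin 2) k →ₐ[k] Polynomial (Polynomial k) :=
    (homogenization 1 1).comp (g.unop : MvPolynomial (Fin 2) k →ₐ[k] MvPolynomial (Fin 2) k)
  have hS : ∀ f, (S f).natDegree = wdeg 1 1 (g.unop f) := fun f => rfl
  have hX : ∀ i, (S (X i)).natDegree = wdeg 1 1 (g.component i) := fun i => rfl
  have hpos := g.wdeg_component_pos one_pos one_pos
  by_cases h : wdeg (wdeg 1 1 (g.component 0)) (wdeg 1 1 (g.component 1)) (g⁻¹.component i) ≤ 1
  · exact Or.inr fun d hd => (le_wdeg (hpos 1) hd).trans h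
  · left
    obtain ⟨Φ, hΦ⟩ := g⁻¹.exists_algEquiv_component i
    -- Substituting `g` into a component of its inverse gives a variable, so any predicted degree
    -- above one must cancel.
    have hone : (S (g⁻¹.component i)).natDegree = 1 := by
      rw [hS, component_def, unop_inv_apply]
      fin_cases i
      · exact wdeg_X_zero 1 1
      · exact wdeg_X_one 1 1
    obtain ⟨a, b, μ, e, ha, hb, hμ, he, hab, h1, h2, h3⟩ := exists_isEdged (T := S) Φ
      (by rw [hX]; exact hpos 0) (by rw [hX]; exact hpos 1) hΦ (by rw [hone, hX, hX]; omega)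
    refine ⟨a, b, μ, e, ha, hb, hμ, he, hab, h1, ?_, h3⟩
    rw [hS, map_sub, map_mul, map_pow, map_pow, unop_C] at h2
    exact h2

/-- Two degrees are compared. Substituting `g` into `g⁻¹` finds an edge; the degree of `T` is
preserved by `g⁻¹`, and this forces a cancellation of `T` along the same edge. -/
theorem exists_edge_of_not_good
    (h0 : 0 < (T (X 0)).natDegree) (h1 : 0 < (T (X 1)).natDegree)
    (hinv : ∀ f, (T (g.unop f)).natDegree = (T f).natDegree)
    (hA : ¬ g.IsAffine) (hJ : ¬ g.IsDeJonquieres) :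
    (wdeg 1 1 (g.component 0) < wdeg 1 1 (g.component 1) ∧
      (T (X 0)).natDegree < (T (X 1)).natDegree) ∨
    ∃ m c, 0 < m ∧ c ≠ 0 ∧
      wdeg 1 1 (g.component 0) = m * wdeg 1 1 (g.component 1) ∧
      wdeg 1 1 (g.component 0 - C c * g.component 1 ^ m) < wdeg 1 1 (g.component 0) ∧
      (T (X 0)).natDegree = m * (T (X 1)).natDegree ∧
      (T (X 0 - C c * X 1 ^ m)).natDegree < (T (X 0)).natDegree ∧
      ∀ i, ∃ e, 0 < e ∧ IsEdged 1 m c e (g⁻¹.component i) := by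
  have hAi : ¬ g⁻¹.IsAffine := fun h => hA (isAffine_inv_iff.1 h)
  have hJi : ¬ g⁻¹.IsDeJonquieres := fun h => hJ (isDeJonquieres_inv_iff.1 h)
  have hpos := g.wdeg_component_pos one_pos one_pos
  have p0 := hpos 0
  have p1 := hpos 1
  have hν := natDegree_map_inv_component hinv
  set γ0 := wdeg 1 1 (g.component 0) with hγ0
  set γ1 := wdeg 1 1 (g.component 1) with hγ1
  -- If both components of the inverse were small, the inverse would be affine.
  have hex : ∃ i, ¬ ∀ d ∈ (g⁻¹.component i).support, γ0 * d 0 + γ1 * d 1 ≤ 1 := by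
    by_contra hcon
    push Not at hcon
    refine hAi (isAffine_of_support fun i d hd => ?_)
    have := hcon i d hd
    have q0 := Nat.le_mul_of_pos_left (d 0) p0
    have q1 := Nat.le_mul_of_pos_left (d 1) p1
    omega
  obtain ⟨i, hi⟩ := hex
  obtain ⟨a, b, μ, e, ha, hb, hμ, he, hab, hg, hlt, hed⟩ :=
    (exists_isEdged_or g i).resolve_right hi
  rw [← hγ0, ← hγ1] at hg
  rw [← hγ0] at hlt
  have hdeg : ∀ {j a b μ e}, 0 < a → 0 < b → 0 < e → IsEdged a b μ e (g⁻¹.component j) →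
      (T (X 0 ^ a - C μ * X 1 ^ b)).natDegree
        = max (a * (T (X 0)).natDegree) (b * (T (X 1)).natDegree) →
      (T (X j)).natDegree = e * max (a * (T (X 0)).natDegree) (b * (T (X 1)).natDegree) := by
    intro j a b μ e ha hb he hed h
    rw [← hν, hed.natDegree_map h0 ha hb he h]
  generalize hα : (T (X 0)).natDegree = α at *
  generalize hβ : (T (X 1)).natDegree = β at *
  by_cases ha1 : a = 1
  · right
    subst ha1
    rw [one_mul] at hg
    -- A component with an edge must have the same edge, by uniqueness of the relation satisfied by
    -- `g`. A component without one would make `g` affine, `g⁻¹` de Jonquières or one of its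
    -- components constant, or contradict invariance.
    have hall : ∀ j, ∃ e', 0 < e' ∧ IsEdged 1 b μ e' (g⁻¹.component j) := by
      intro j
      rcases exists_isEdged_or g j with ⟨a', b', μ', e', ha', hb', hμ', he', hab', hg', hlt', hed'⟩ | hs
      · refine ⟨e', he', ?_⟩
        rw [← hγ0, ← hγ1] at hg'
        have hb1 : a' * b = b' := by
          rw [hg, ← mul_assoc] at hg'
          exact Nat.eq_of_mul_eq_mul_right p1 hg'
        have ha1 : a' = 1 := by
          rcases hab' with h | h
          · exact h
          · rw [h] at hb1; exact Nat.eq_one_of_mul_eq_one_right hb1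
        subst ha1
        rw [one_mul] at hb1 hlt'
        subst hb1
        let S : MvPolynomial (Fin 2) k →ₐ[k] Polynomial (Polynomial k) :=
          (homogenization 1 1).comp (g.unop : MvPolynomial (Fin 2) k →ₐ[k] MvPolynomial (Fin 2) k)
        have hS : ∀ c, (S (X 0 - C c * X 1 ^ b)).natDegree
            = wdeg 1 1 (g.component 0 ^ 1 - C c * g.component 1 ^ b) := by
          intro c
          rw [pow_one]
          change wdeg 1 1 (g.unop (X 0 - C c * X 1 ^ b)) = _
          rw [map_sub, map_mul, map_pow, unop_C]
          rfl
        have := (binomial_unique (T := S) (m := b) (m' := b) (c := μ) (c' := μ') p1 hg hg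
          (by rw [hS]; exact hlt.trans_le (one_mul _).le) (by rw [hS]; exact hlt')).2
        rw [this]
        exact hed'
      · exfalso
        rw [← hγ0, ← hγ1] at hs
        by_cases hb1 : b = 1
        · subst hb1
          rw [one_mul] at hg
          rw [hg] at hs
          by_cases hγ : γ1 ≤ 1
          · refine hA (isAffine_of_wdeg fun i => ?_)
            fin_cases i
            · exact (hg.trans_le hγ)
            · exact hγ
          · have hc : wdeg 1 1 (g⁻¹.component j) ≤ 0 := by
              refine wdeg_le fun d hd => ?_
              have := hs d hd
              rw [← mul_add] at this
              rw [one_mul, one_mul]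
              by_contra hne
              have := Nat.le_mul_of_pos_right γ1 (Nat.pos_of_ne_zero (by omega : d 0 + d 1 ≠ 0))
              omega
            have := g⁻¹.wdeg_component_pos one_pos one_pos j
            omega
        · have hγ : 2 ≤ γ0 := by
            rw [hg]
            calc 2 ≤ b := by omega
              _ ≤ b * γ1 := Nat.le_mul_of_pos_right _ p1
          have hs' : ∀ d ∈ (g⁻¹.component j).support, d 0 = 0 ∧ d 1 ≤ 1 := by
            intro d hd
            have := hs d hd
            have q1 := Nat.le_mul_of_pos_left (d 1) p1
            refine ⟨?_, by omega⟩
            by_contra hne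
            have := Nat.le_mul_of_pos_right γ0 (Nat.pos_of_ne_zero hne)
            omega
          have hj : j = 0 := by
            by_contra hj
            have : j = 1 := by omega
            subst this
            exact hJi (isDeJonquieres_of_support hs')
          subst hj
          -- The first component of the inverse involves only `y`, linearly, and invariance compares
          -- its degree with that of `x`. The edge of the second component is then incompatible with
          -- `2 ≤ b`.
          have hαβ : α ≤ β := by
            rw [← hα, ← hν]
            refine natDegree_map_le (T := T) le_rfl le_rfl fun d hd => ?_
            have := hs' d hd
            rw [this.1, hβ]
            calc _ = β * d 1 := by ring
              _ ≤ β * 1 := Nat.mul_le_mul_left _ this.2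
              _ = β := mul_one _
          have hi1 : i = 1 := by
            by_contra h
            have : i = 0 := by omega
            subst this
            exact hi hs
          subst hi1
          have h2b : 2 * β ≤ b * β := Nat.mul_le_mul_right _ (by omega)
          rcases natDegree_map_binomial T 1 b hμ with h | ⟨h, -⟩
          · rw [hα, hβ] at h
            have h3 := hdeg one_pos hb he hed h
            rw [hβ] at h3
            have : max (1 * α) (b * β) ≤ e * max (1 * α) (b * β) := Nat.le_mul_of_pos_left _ he
            have := le_max_right (1 * α) (b * β)
            omega
          · rw [hα, hβ] at h
            omega
    -- Without cancellation in `T`, the degrees of `x` and `y` would be `e0 * M` and `e1 * M` with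
    -- `M` at least both; then `e0 = e1 = b = 1` and the inverse would be affine.
    rcases natDegree_map_binomial T 1 b hμ with h | ⟨h, h'⟩
    · exfalso
      rw [hα, hβ] at h
      obtain ⟨e0, he0, hed0⟩ := hall 0
      obtain ⟨e1, he1, hed1⟩ := hall 1
      have q0 := hdeg one_pos hb he0 hed0 h
      have q1 := hdeg one_pos hb he1 hed1 h
      rw [hα] at q0
      rw [hβ] at q1
      rw [one_mul] at q0 q1
      have hm0 := le_max_left α (b * β)
      have hm1 := le_max_right α (b * β)
      set M := max α (b * β)
      have hMpos : 0 < M := by omega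
      have e01 : e0 = 1 := by
        refine Nat.eq_of_mul_eq_mul_right hMpos ?_
        have := Nat.le_mul_of_pos_left M he0
        omega
      have hbβ : β ≤ b * β := Nat.le_mul_of_pos_left _ hb
      have e11 : e1 = 1 := by
        refine Nat.eq_of_mul_eq_mul_right hMpos ?_
        have := Nat.le_mul_of_pos_left M he1
        omega
      have hb1 : b = 1 := by
        refine Nat.eq_of_mul_eq_mul_right h1 ?_
        rw [e11] at q1
        omega
      refine hAi (isAffine_of_wdeg fun i => ?_)
      fin_cases i
      · exact (hed0.wdeg_one_one hb he0 hμ).le.trans (by rw [e01, hb1])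
      · exact (hed1.wdeg_one_one hb he1 hμ).le.trans (by rw [e11, hb1])
    · rw [one_mul, pow_one, hα] at h'
      rw [one_mul, hα, hβ] at h
      rw [pow_one, one_mul] at hlt
      exact ⟨b, μ, hb, hμ, hg, hlt, h, h', hall⟩
  -- The edge is now `x ^ a - μ y` with `2 ≤ a`. If `β ≤ α`, the term `x ^ a` would dominate under
  -- `T`, and `g⁻¹` would raise the degree of a variable.
  · left
    have hb1 : b = 1 := hab.resolve_left ha1
    subst hb1
    rw [one_mul] at hg
    have ha2 : 2 * γ0 ≤ a * γ0 := Nat.mul_le_mul_right _ (by omega)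
    have ha3 : 2 * α ≤ a * α := Nat.mul_le_mul_right _ (by omega)
    refine ⟨by omega, ?_⟩
    by_contra hcon
    rcases natDegree_map_binomial T a 1 hμ with h | ⟨h, -⟩
    · rw [hα, hβ] at h
      have h3 := hdeg ha one_pos he hed h
      rw [one_mul, max_eq_left (by omega)] at h3
      have h4 : a * α ≤ e * (a * α) := Nat.le_mul_of_pos_left _ he
      have : i = 0 ∨ i = 1 := by omega
      rcases this with rfl | rfl <;> omega
    · rw [hα, hβ] at h
      omega

/-- In the second case the automorphism itself has the same edge as its inverse. -/
theorem exists_edge_component_of_not_good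
    (h0 : 0 < (T (X 0)).natDegree) (h1 : 0 < (T (X 1)).natDegree)
    (hinv : ∀ f, (T (g.unop f)).natDegree = (T f).natDegree)
    (hA : ¬ g.IsAffine) (hJ : ¬ g.IsDeJonquieres) :
    (wdeg 1 1 (g.component 0) < wdeg 1 1 (g.component 1) ∧
      (T (X 0)).natDegree < (T (X 1)).natDegree) ∨
    ∃ m c, 0 < m ∧ c ≠ 0 ∧
      wdeg 1 1 (g.component 0) = m * wdeg 1 1 (g.component 1) ∧
      wdeg 1 1 (g.component 0 - C c * g.component 1 ^ m) < wdeg 1 1 (g.component 0) ∧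
      (T (X 0)).natDegree = m * (T (X 1)).natDegree ∧
      ∀ i, ∃ e, 0 < e ∧ IsEdged 1 m c e (g.component i) := by
  refine (exists_edge_of_not_good h0 h1 hinv hA hJ).imp id ?_
  rintro ⟨m, c, hm, hc, q1, q2, q3, q4, -⟩
  have hinv' : ∀ f, (T (g⁻¹.unop f)).natDegree = (T f).natDegree := fun f => by
    rw [← hinv, unop_inv_apply]
  -- Applying the result to `g⁻¹` gives an edge of `g`. It coincides with the one already found
  -- because both are determined by the cancellation in `T`.
  rcases exists_edge_of_not_good h0 h1 hinv' (fun h => hA (isAffine_inv_iff.1 h))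
    (fun h => hJ (isDeJonquieres_inv_iff.1 h)) with ⟨-, h⟩ | ⟨m', c', hm', hc', -, -, q3', q4', hed⟩
  · have := Nat.le_mul_of_pos_left (T (X 1)).natDegree hm
    omega
  · obtain ⟨rfl, rfl⟩ := binomial_unique h1 q3 q3' q4 q4'
    rw [inv_inv] at hed
    exact ⟨m, c, hm, hc, q1, q2, q3, hed⟩

end

end PlaneAut

/-! ### Elementary conjugations and the decrease of complexity. -/

namespace PlaneAut

open MvPolynomial

variable {k : Type*} [Field k]

/-- The endomorphism `x ↦ x - c yᵐ`, `y ↦ y` of `k[x, y]`. -/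
noncomputable def shearHom (c : k) (m : ℕ) : MvPolynomial (Fin 2) k →ₐ[k] MvPolynomial (Fin 2) k :=
  aeval ![X 0 - C c * X 1 ^ m, X 1]

theorem shearHom_comp_neg (c : k) (m : ℕ) :
    (shearHom c m).comp (shearHom (-c) m) = AlgHom.id k _ := by
  ext1 i
  fin_cases i <;> simp [shearHom]

/-- The automorphism `(x - c yᵐ, y)`. -/
noncomputable def shear (c : k) (m : ℕ) : PlaneAut k :=
  MulOpposite.op (AlgEquiv.ofAlgHom (shearHom c m) (shearHom (-c) m) (shearHom_comp_neg c m)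
    (by simpa using shearHom_comp_neg (-c) m))

/-- The automorphism `(y, x)`. -/
noncomputable def swap : PlaneAut k :=
  MulOpposite.op (renameEquiv k (Equiv.swap 0 1))

theorem shear_component_zero (c : k) (m : ℕ) :
    (shear c m).component 0 = X 0 - C c * X 1 ^ m := by
  simp [component, shear, shearHom]

theorem shear_component_one (c : k) (m : ℕ) : (shear c m).component 1 = X 1 := by
  simp [component, shear, shearHom]

theorem shear_inv (c : k) (m : ℕ) : (shear c m)⁻¹ = shear (-c) m := by
  have h : ∀ f, (shear c m)⁻¹.unop f = (shear (-c) m).unop f := fun f => rfl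
  exact ext_component (h _) (h _)

theorem swap_component_zero : (swap : PlaneAut k).component 0 = X 1 := by
  simp [component, swap]

theorem swap_component_one : (swap : PlaneAut k).component 1 = X 0 := by
  simp [component, swap]

theorem swap_inv : (swap : PlaneAut k)⁻¹ = swap := by
  have h : ∀ f, (swap : PlaneAut k)⁻¹.unop f = swap.unop f := fun f => rfl
  exact ext_component (h _) (h _)

theorem swap_isAffine : (swap : PlaneAut k).IsAffine :=
  ⟨0, 1, 0, 1, 0, 0, by simp, by simp [swap_component_zero], by simp [swap_component_one]⟩

theorem shear_isDeJonquieres (c : k) (m : ℕ) : (shear c m).IsDeJonquieres :=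
  ⟨1, 1, 0, -(Polynomial.C c * Polynomial.X ^ m), one_ne_zero, one_ne_zero, by
    simp [shear_component_zero, sub_eq_add_neg], by simp [shear_component_one]⟩

theorem shear_one_isAffine (c : k) : (shear c 1).IsAffine :=
  ⟨1, -c, 0, 0, 1, 0, by simp, by simp [shear_component_zero, sub_eq_add_neg],
    by simp [shear_component_one]⟩

theorem conj_component_zero_shear (c : k) (m : ℕ) (g : PlaneAut k) :
    (shear c m * g * (shear c m)⁻¹).component 0
      = (shear (-c) m).unop (g.component 0 - C c * g.component 1 ^ m) := by
  rw [shear_inv, component_def, unop_mul_apply, unop_mul_apply, ← component_def,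
    shear_component_zero, map_sub, map_mul, map_pow, unop_C]
  rfl

theorem conj_component_one_shear (c : k) (m : ℕ) (g : PlaneAut k) :
    (shear c m * g * (shear c m)⁻¹).component 1 = (shear (-c) m).unop (g.component 1) := by
  rw [shear_inv, component_def, unop_mul_apply, unop_mul_apply, ← component_def,
    shear_component_one]
  rfl

theorem conj_component_zero_swap (g : PlaneAut k) :
    (swap * g * swap⁻¹).component 0 = swap.unop (g.component 1) := by
  rw [swap_inv, component_def, unop_mul_apply, unop_mul_apply, ← component_def,
    swap_component_zero]
  rfl

theorem conj_component_one_swap (g : PlaneAut k) :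
    (swap * g * swap⁻¹).component 1 = swap.unop (g.component 0) := by
  rw [swap_inv, component_def, unop_mul_apply, unop_mul_apply, ← component_def,
    swap_component_one]
  rfl

/-- The complexity of an automorphism. -/
noncomputable def complexity (g : PlaneAut k) : ℕ :=
  2 * (wdeg 1 1 (g.component 0) + wdeg 1 1 (g.component 1)) +
    if wdeg 1 1 (g.component 0) < wdeg 1 1 (g.component 1) then 1 else 0

theorem wdeg_one_one_swap (f : MvPolynomial (Fin 2) k) : wdeg 1 1 (swap.unop f) = wdeg 1 1 f := by
  have h (f : MvPolynomial (Fin 2) k) : wdeg 1 1 ((swap (k := k)).unop f) ≤ wdeg 1 1 f :=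
    wdeg_map_le ((swap (k := k)).unop : MvPolynomial (Fin 2) k →ₐ[k] MvPolynomial (Fin 2) k) one_pos
      (by change wdeg 1 1 ((swap (k := k)).component 0) ≤ 1
          rw [swap_component_zero, wdeg_X_one])
      (by change wdeg 1 1 ((swap (k := k)).component 1) ≤ 1
          rw [swap_component_one, wdeg_X_zero]) f
  refine le_antisymm (h f) ?_
  conv_lhs => rw [← unop_inv_apply swap f, swap_inv]
  exact (h _)

/-- The swap leaves the degree sum unchanged; the indicator in the complexity is there to make this
step count. -/
theorem complexity_conj_swap {g : PlaneAut k}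
    (h : wdeg 1 1 (g.component 0) < wdeg 1 1 (g.component 1)) :
    complexity (swap * g * swap⁻¹) < complexity g := by
  rw [complexity, complexity, conj_component_zero_swap, conj_component_one_swap,
    wdeg_one_one_swap, wdeg_one_one_swap, if_pos h, if_neg (by omega)]
  omega

/-- The shear is homogeneous for the weights `m` and `1`. -/
theorem wdeg_shear_le (c : k) (m : ℕ) (f : MvPolynomial (Fin 2) k) :
    wdeg m 1 ((shear c m).unop f) ≤ wdeg m 1 f := by
  refine wdeg_map_le ((shear c m).unop : MvPolynomial (Fin 2) k →ₐ[k] MvPolynomial (Fin 2) k)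
    one_pos ?_ ?_ f
  · change wdeg m 1 ((shear c m).component 0) ≤ m
    rw [shear_component_zero]
    refine (wdeg_sub_le _ _ _ _).trans (max_le (wdeg_X_zero _ _).le ?_)
    refine (wdeg_C_mul_le _ _ _ _).trans ?_
    rw [wdeg_pow, wdeg_X_one, mul_one]
  · change wdeg m 1 ((shear c m).component 1) ≤ 1
    rw [shear_component_one, wdeg_X_one]

theorem wdeg_one_one_le {m : ℕ} (hm : 0 < m) (f : MvPolynomial (Fin 2) k) :
    wdeg 1 1 f ≤ wdeg m 1 f :=
  wdeg_le fun _ hd => (add_le_add_left (Nat.mul_le_mul_right _ hm) _).trans (le_wdeg one_pos hd)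

theorem shear_neg_unop_binomial (c : k) (m : ℕ) :
    (shear (-c) m).unop (X 0 ^ 1 - C c * X 1 ^ m) = X 0 := by
  rw [pow_one, map_sub, map_mul, map_pow, unop_C, ← component_def, ← component_def,
    shear_component_zero, shear_component_one, C_neg]
  ring

/-- The shear straightens `x - c y ^ m` to `x`, so the top part becomes a multiple of `x ^ e`, of
degree below `m * e`; what lies below the edge stays below it. -/
theorem wdeg_shear_of_isEdged {c : k} {m e : ℕ} {f : MvPolynomial (Fin 2) k} (hm : 2 ≤ m)
    (he : 0 < e) (h : IsEdged 1 m c e f) : wdeg 1 1 ((shear (-c) m).unop f) < m * e := by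
  obtain ⟨a, -, hd⟩ := h
  have hme : 2 * e ≤ m * e := Nat.mul_le_mul_right _ hm
  have hf : f = C a * (X 0 ^ 1 - C c * X 1 ^ m) ^ e + (f - C a * (X 0 ^ 1 - C c * X 1 ^ m) ^ e) := by
    ring
  rw [hf, map_add, map_mul, map_pow, unop_C, shear_neg_unop_binomial]
  refine (wdeg_add_le _ _ _ _).trans_lt (max_lt ?_ ?_)
  · refine (wdeg_C_mul_le _ _ _ _).trans_lt ?_
    rw [wdeg_pow, wdeg_X_zero]
    omega
  · refine (wdeg_one_one_le (by omega) _).trans_lt ((wdeg_shear_le _ _ _).trans_lt ?_)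
    refine (wdeg_le (n := m * e - 1) fun d h => ?_).trans_lt (by omega)
    have := hd d h
    simp only [one_mul] at this
    omega

theorem complexity_conj_shear {g : PlaneAut k} {c : k} {m : ℕ} (hm : 0 < m) (hc : c ≠ 0)
    (hγ : wdeg 1 1 (g.component 0) = m * wdeg 1 1 (g.component 1))
    (hlt : wdeg 1 1 (g.component 0 - C c * g.component 1 ^ m) < wdeg 1 1 (g.component 0))
    (hed : ∀ i, ∃ e, 0 < e ∧ IsEdged 1 m c e (g.component i)) :
    complexity (shear c m * g * (shear c m)⁻¹) < complexity g := by
  obtain ⟨e0, he0, hed0⟩ := hed 0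
  obtain ⟨e1, he1, hed1⟩ := hed 1
  have q0 := hed0.wdeg_one_one hm he0 hc
  have q1 := hed1.wdeg_one_one hm he1 hc
  have hee : e0 = m * e1 := by
    rw [q0, q1] at hγ
    exact Nat.eq_of_mul_eq_mul_left hm hγ
  have r1 : wdeg 1 1 ((shear (-c) m).unop (g.component 1)) ≤ wdeg 1 1 (g.component 1) :=
    (wdeg_one_one_le hm _).trans ((wdeg_shear_le _ _ _).trans (hed1.wdeg_le.trans q1.ge))
  have r0 : wdeg 1 1 ((shear (-c) m).unop (g.component 0 - C c * g.component 1 ^ m))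
      ≤ wdeg 1 1 (g.component 0) := by
    refine (wdeg_one_one_le hm _).trans ((wdeg_shear_le _ _ _).trans ?_)
    refine (wdeg_sub_le _ _ _ _).trans (max_le (hed0.wdeg_le.trans q0.ge) ?_)
    refine (wdeg_C_mul_le _ _ _ _).trans ?_
    rw [wdeg_pow, q0, hee]
    exact Nat.mul_le_mul_left _ hed1.wdeg_le
  have hge : wdeg 1 1 (g.component 1) ≤ wdeg 1 1 (g.component 0) := by
    rw [hγ]; exact Nat.le_mul_of_pos_left _ hm
  rw [complexity, complexity, conj_component_zero_shear, conj_component_one_shear,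
    if_neg (by omega : ¬ wdeg 1 1 (g.component 0) < wdeg 1 1 (g.component 1))]
  -- For `m = 1` the shear preserves the ordinary degree and the drop comes from `g₀ - c g₁`; for
  -- larger `m` it comes from straightening `g₁`. The factor `2` in the complexity absorbs a
  -- possible gain of the indicator.
  by_cases hm1 : m = 1
  · subst hm1
    have r0' := (wdeg_shear_le (-c) 1 (g.component 0 - C c * g.component 1 ^ 1)).trans_lt hlt
    split_ifs <;> omega
  · have r1' := wdeg_shear_of_isEdged (by omega) he1 hed1
    rw [← q1] at r1'
    split_ifs <;> omega

/-! ### Passing between the two factors -/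

section

variable {T : MvPolynomial (Fin 2) k →ₐ[k] Polynomial (Polynomial k)} {g : PlaneAut k}

/-- An `x`-term in the second component would raise the degree of `y` to that of `x`. -/
theorem IsAffine.isDeJonquieres (hg : g.IsAffine)
    (hinv : ∀ f, (T (g.unop f)).natDegree = (T f).natDegree)
    (hlt : (T (X 1)).natDegree < (T (X 0)).natDegree) :
    g.IsDeJonquieres := by
  obtain ⟨a, b, c, d, e, f, hdet, q0, q1⟩ := hg
  have hd : d = 0 := by
    by_contra hd
    have h := hinv (X 1)
    rw [← component_def, q1, map_add, map_add] at h
    have e0 : (T (C d * X 0)).natDegree = (T (X 0)).natDegree := natDegree_map_C_mul T hd _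
    have e1 : (T (C e * X 1)).natDegree ≤ (T (X 1)).natDegree := by
      rw [map_C_mul]; exact Polynomial.natDegree_C_mul_le _ _
    have e2 : (T (C f)).natDegree = 0 := by
      rw [← algebraMap_eq, AlgHom.commutes, algebraMap_polynomial_polynomial,
        Polynomial.natDegree_C]
    have e3 : (T (C d * X 0) + T (C e * X 1)).natDegree = (T (X 0)).natDegree := by
      rw [Polynomial.natDegree_add_eq_left_of_natDegree_lt (by omega), e0]
    rw [Polynomial.natDegree_add_eq_left_of_natDegree_lt (by omega), e3] at h
    omega
  subst hd
  rw [mul_zero, sub_zero] at hdet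
  refine ⟨a, e, f, Polynomial.C b * Polynomial.X + Polynomial.C c, left_ne_zero_of_mul hdet,
    right_ne_zero_of_mul hdet, ?_, ?_⟩
  · rw [q0]; simp [add_assoc]
  · rw [q1]; simp

theorem natDegree_map_aeval (T : MvPolynomial (Fin 2) k →ₐ[k] Polynomial (Polynomial k))
    (f : MvPolynomial (Fin 2) k) (P : Polynomial k) :
    (T (Polynomial.aeval f P)).natDegree = P.natDegree * (T f).natDegree := by
  have : T (Polynomial.aeval f P) = (P.map Polynomial.C).comp (T f) := by
    rw [← Polynomial.aeval_algHom_apply, Polynomial.comp, Polynomial.eval₂_map,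
      Polynomial.aeval_def]
    rfl
  rw [this, Polynomial.natDegree_comp, Polynomial.natDegree_map_eq_of_injective
    Polynomial.C_injective]

/-- A term of degree at least two in `P` would dominate the image of `x` and raise its degree. -/
theorem IsDeJonquieres.isAffine (hg : g.IsDeJonquieres)
    (hinv : ∀ f, (T (g.unop f)).natDegree = (T f).natDegree)
    (hlt : (T (X 0)).natDegree < 2 * (T (X 1)).natDegree) : g.IsAffine := by
  obtain ⟨a, b, c, P, ha, hb, q0, q1⟩ := hg
  have hP : P.natDegree ≤ 1 := by
    by_contra hP
    have h := hinv (X 0)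
    rw [← component_def, q0, map_add] at h
    have e0 : (T (C a * X 0)).natDegree = (T (X 0)).natDegree := natDegree_map_C_mul T ha _
    have e1 := natDegree_map_aeval T (X 1) P
    have e2 : 2 * (T (X 1)).natDegree ≤ P.natDegree * (T (X 1)).natDegree :=
      Nat.mul_le_mul_right _ (by omega)
    rw [Polynomial.natDegree_add_eq_right_of_natDegree_lt (by omega)] at h
    omega
  refine ⟨a, P.coeff 1, P.coeff 0, 0, b, c, by simp [ha, hb], ?_, ?_⟩
  · rw [q0]
    conv_lhs => rw [Polynomial.eq_X_add_C_of_natDegree_le_one hP]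
    simp [add_assoc]
  · rw [q1]; simp

end

/-- A weighted degree, transported along an automorphism, that every element of `S` preserves. -/
def PreservesDegree (S : Set (PlaneAut k)) : Prop :=
  ∃ w, 0 < w ∧ ∃ ψ : PlaneAut k, ∀ g ∈ S, ∀ f,
    wdeg w 1 (ψ.unop (g.unop f)) = wdeg w 1 (ψ.unop f)

theorem PreservesDegree.exists_algHom {S : Set (PlaneAut k)} (h : PreservesDegree S) :
    ∃ T : MvPolynomial (Fin 2) k →ₐ[k] Polynomial (Polynomial k),
      0 < (T (X 0)).natDegree ∧ 0 < (T (X 1)).natDegree ∧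
      ∀ g ∈ S, ∀ f, (T (g.unop f)).natDegree = (T f).natDegree := by
  obtain ⟨w, hw, ψ, h⟩ := h
  exact ⟨(homogenization w 1).comp (ψ.unop : MvPolynomial (Fin 2) k →ₐ[k] MvPolynomial (Fin 2) k),
    ψ.wdeg_component_pos hw one_pos 0, ψ.wdeg_component_pos hw one_pos 1, h⟩

theorem PreservesDegree.conj {S : Set (PlaneAut k)} (h : PreservesDegree S) (θ : PlaneAut k) :
    PreservesDegree ((fun g => θ * g * θ⁻¹) '' S) := by
  obtain ⟨w, hw, ψ, h⟩ := h
  refine ⟨w, hw, θ * ψ, ?_⟩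
  rintro _ ⟨g, hg, rfl⟩ f
  change wdeg w 1 (ψ.unop (θ.unop (θ⁻¹.unop (g.unop (θ.unop f))))) = _
  rw [unop_inv_apply, h g hg]
  rfl

theorem PreservesDegree.forall_or_forall {S : Set (PlaneAut k)} (h : PreservesDegree S)
    (hS : ∀ g ∈ S, g.IsAffine ∨ g.IsDeJonquieres) :
    (∀ g ∈ S, g.IsAffine) ∨ ∀ g ∈ S, g.IsDeJonquieres := by
  obtain ⟨T, -, h1, hinv⟩ := h.exists_algHom
  by_cases hlt : (T (X 1)).natDegree < (T (X 0)).natDegree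
  · exact Or.inr fun g hg => (hS g hg).elim (fun h => h.isDeJonquieres (hinv g hg) hlt) id
  · exact Or.inl fun g hg => (hS g hg).elim id fun h => h.isAffine (hinv g hg) (by omega)

/-- Good elements stay good because they share a group with the conjugating map: `Aff` when `α < β`
or `m = 1`, and `𝕁` when `2 ≤ m`. -/
theorem PreservesDegree.step {S : Set (PlaneAut k)} (h : PreservesDegree S) {g : PlaneAut k}
    (hg : g ∈ S) (hA : ¬ g.IsAffine) (hJ : ¬ g.IsDeJonquieres) :
    (wdeg 1 1 (g.component 0) < wdeg 1 1 (g.component 1) ∧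
      complexity (swap * g * swap⁻¹) < complexity g ∧
      ∀ f ∈ S, (f.IsAffine ∨ f.IsDeJonquieres) →
        (swap * f * swap⁻¹).IsAffine ∨ (swap * f * swap⁻¹).IsDeJonquieres) ∨
    ∃ m c, 0 < m ∧ c ≠ 0 ∧
      wdeg 1 1 (g.component 0) = m * wdeg 1 1 (g.component 1) ∧
      wdeg 1 1 (g.component 0 - C c * g.component 1 ^ m) < wdeg 1 1 (g.component 0) ∧
      complexity (shear c m * g * (shear c m)⁻¹) < complexity g ∧
      ∀ f ∈ S, (f.IsAffine ∨ f.IsDeJonquieres) →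
        (shear c m * f * (shear c m)⁻¹).IsAffine ∨
          (shear c m * f * (shear c m)⁻¹).IsDeJonquieres := by
  obtain ⟨T, h0, h1, hinv⟩ := h.exists_algHom
  have conjA : ∀ e f : PlaneAut k, e.IsAffine → f.IsAffine → (e * f * e⁻¹).IsAffine :=
    fun e f he hf => (affineGroup k).mul_mem ((affineGroup k).mul_mem he hf)
      ((affineGroup k).inv_mem he)
  have conjJ : ∀ e f : PlaneAut k, e.IsDeJonquieres → f.IsDeJonquieres →
      (e * f * e⁻¹).IsDeJonquieres :=
    fun e f he hf => (deJonquieresGroup k).mul_mem ((deJonquieresGroup k).mul_mem he hf)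
      ((deJonquieresGroup k).inv_mem he)
  rcases exists_edge_component_of_not_good h0 h1 (hinv g hg) hA hJ with
    ⟨q1, q2⟩ | ⟨m, c, hm, hc, q1, q2, q3, q4⟩
  · exact Or.inl ⟨q1, complexity_conj_swap q1, fun f hf hf' => Or.inl <|
      conjA _ _ swap_isAffine (hf'.elim id fun h => h.isAffine (hinv f hf) (by omega))⟩
  · refine Or.inr ⟨m, c, hm, hc, q1, q2, complexity_conj_shear hm hc q1 q2 q4,
      fun f hf hf' => ?_⟩
    by_cases hm1 : m = 1
    · subst hm1
      exact Or.inl <| conjA _ _ (shear_one_isAffine c)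
        (hf'.elim id fun h => h.isAffine (hinv f hf) (by omega))
    · refine Or.inr <| conjJ _ _ (shear_isDeJonquieres c m)
        (hf'.elim (fun h => h.isDeJonquieres (hinv f hf) ?_) id)
      have : 2 * (T (X 1)).natDegree ≤ m * (T (X 1)).natDegree :=
        Nat.mul_le_mul_right _ (by omega)
      omega

/-! ### Conjugators -/

theorem isConjugator_closure_iff {θ : PlaneAut k} {S : Set (PlaneAut k)} :
    θ.IsConjugator (Subgroup.closure S) ↔
      (∀ g ∈ S, (θ * g * θ⁻¹).IsAffine) ∨ ∀ g ∈ S, (θ * g * θ⁻¹).IsDeJonquieres := by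
  rw [IsConjugator, Subgroup.map_le_iff_le_comap, Subgroup.map_le_iff_le_comap,
    Subgroup.closure_le, Subgroup.closure_le]
  rfl

/-- Neither `t` nor its inverse raises the degree, so both preserve it. -/
theorem wdeg_unop_eq {t : PlaneAut k} {w : ℕ} (h0 : wdeg w 1 (t.component 0) ≤ w)
    (h1 : wdeg w 1 (t.component 1) ≤ 1) (h0' : wdeg w 1 (t⁻¹.component 0) ≤ w)
    (h1' : wdeg w 1 (t⁻¹.component 1) ≤ 1) (f : MvPolynomial (Fin 2) k) :
    wdeg w 1 (t.unop f) = wdeg w 1 f := by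
  refine le_antisymm (wdeg_map_le
    (t.unop : MvPolynomial (Fin 2) k →ₐ[k] MvPolynomial (Fin 2) k) one_pos h0 h1 f) ?_
  conv_lhs => rw [← unop_apply_inv t f]
  exact wdeg_map_le (t⁻¹.unop : MvPolynomial (Fin 2) k →ₐ[k] MvPolynomial (Fin 2) k)
    one_pos h0' h1' _

theorem IsAffine.wdeg_le_one {t : PlaneAut k} (h : t.IsAffine) (i : Fin 2) :
    wdeg 1 1 (t.component i) ≤ 1 := by
  have key : ∀ a b c : k, wdeg 1 1 (C a * X 0 + C b * X 1 + C c : MvPolynomial (Fin 2) k) ≤ 1 := by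
    intro a b c
    refine (wdeg_add_le _ _ _ _).trans (max_le ((wdeg_add_le _ _ _ _).trans (max_le ?_ ?_)) ?_)
    · exact (wdeg_C_mul_le _ _ _ _).trans (wdeg_X_zero 1 1).le
    · exact (wdeg_C_mul_le _ _ _ _).trans (wdeg_X_one 1 1).le
    · rw [wdeg_C]; exact zero_le_one
  obtain ⟨a, b, c, d, e, f, -, q0, q1⟩ := h
  fin_cases i
  · exact (congrArg _ q0).trans_le (key a b c)
  · exact (congrArg _ q1).trans_le (key d e f)

theorem IsDeJonquieres.exists_wdeg_le {t : PlaneAut k} (h : t.IsDeJonquieres) :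
    ∃ N, ∀ w, N ≤ w → wdeg w 1 (t.component 0) ≤ w ∧ wdeg w 1 (t.component 1) ≤ 1 := by
  obtain ⟨a, b, c, P, -, -, q0, q1⟩ := h
  refine ⟨P.natDegree, fun w hw => ⟨?_, ?_⟩⟩
  · rw [q0]
    refine (wdeg_add_le _ _ _ _).trans (max_le ?_ ?_)
    · exact (wdeg_C_mul_le _ _ _ _).trans (wdeg_X_zero w 1).le
    · refine (natDegree_map_aeval (homogenization w 1) (X 1) P).trans_le ?_
      change _ * wdeg w 1 (X 1) ≤ w
      rw [wdeg_X_one, mul_one]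
      exact hw
  · rw [q1]
    refine (wdeg_add_le _ _ _ _).trans (max_le ?_ ?_)
    · exact (wdeg_C_mul_le _ _ _ _).trans (wdeg_X_one w 1).le
    · rw [wdeg_C]; exact zero_le_one

theorem preservesDegree_of_conj {S : Set (PlaneAut k)} {θ : PlaneAut k} {w : ℕ} (hw : 0 < w)
    (h : ∀ g ∈ S, ∀ f, wdeg w 1 ((θ * g * θ⁻¹).unop f) = wdeg w 1 f) : PreservesDegree S := by
  refine ⟨w, hw, θ⁻¹, fun g hg f => ?_⟩
  have := h g hg (θ⁻¹.unop f)
  rwa [unop_mul_apply, unop_mul_apply, unop_inv_apply] at this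

theorem IsConjugator.preservesDegree {θ : PlaneAut k} {gs : List (PlaneAut k)}
    (h : θ.IsConjugator (Subgroup.closure {g | g ∈ gs})) : PreservesDegree {g | g ∈ gs} := by
  rcases isConjugator_closure_iff.1 h with h | h
  · refine preservesDegree_of_conj (θ := θ) one_pos fun g hg => ?_
    have h1 := h g hg
    have h2 := isAffine_inv_iff.2 h1
    exact wdeg_unop_eq (h1.wdeg_le_one 0) (h1.wdeg_le_one 1) (h2.wdeg_le_one 0) (h2.wdeg_le_one 1)
  -- Finiteness of the list is used here: one weight must dominate the polynomials of all generators
  -- and of their inverses.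
  · have : ∃ N, ∀ w, N ≤ w → ∀ g ∈ gs, ∀ f, wdeg w 1 ((θ * g * θ⁻¹).unop f) = wdeg w 1 f := by
      clear * - h
      induction gs with
      | nil => exact ⟨0, by simp⟩
      | cons g gs ih =>
        obtain ⟨N, hN⟩ := ih fun g hg => h g (List.mem_cons_of_mem _ hg)
        have h1 := h g List.mem_cons_self
        obtain ⟨N1, hN1⟩ := h1.exists_wdeg_le
        obtain ⟨N2, hN2⟩ := (isDeJonquieres_inv_iff.2 h1).exists_wdeg_le
        refine ⟨max N (max N1 N2), fun w hw f hf => ?_⟩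
        simp only [max_le_iff] at hw
        rcases List.mem_cons.1 hf with rfl | hf
        · exact wdeg_unop_eq (hN1 w hw.2.1).1 (hN1 w hw.2.1).2 (hN2 w hw.2.2).1 (hN2 w hw.2.2).2
        · exact hN w hw.1 f hf
    obtain ⟨N, hN⟩ := this
    exact preservesDegree_of_conj (θ := θ) (w := N + 1) N.succ_pos fun g hg =>
      hN _ N.le_succ g hg

end PlaneAut

/-! ### Programs for total functions -/

universe u

/-- A family of functions on data is uniform if one program computes it over all fields. -/
class IsUniform (F : ∀ (k : Type u) [Field k], FieldData k → FieldData k) : Prop where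
  exists_prog : ∃ P : FieldProg, ∀ (k : Type u) [Field k] (s : FieldData k),
    P.eval s = Part.some (F k s)

namespace FieldData

/-- Case distinction on the truth value of a datum. -/
def ite {k : Type*} (c p q : FieldData k) : FieldData k := bif c.truth then p else q

/-- Left fold along the right spine of a datum. -/
def fold {k : Type*} (f : FieldData k → FieldData k → FieldData k) :
    FieldData k → FieldData k → FieldData k
  | nil, acc => acc
  | atom _, acc => f nil acc
  | pair h t, acc => fold f t (f h acc)

/-- The sum of two field elements. -/
def add {k : Type*} [Field k] (a b : FieldData k) : FieldData k := (pair a b).map₂ (· + ·)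

/-- The product of two field elements. -/
def mul {k : Type*} [Field k] (a b : FieldData k) : FieldData k := (pair a b).map₂ (· * ·)

/-- The additive inverse of a field element. -/
def neg {k : Type*} [Field k] (a : FieldData k) : FieldData k := a.map₁ (- ·)

/-- The multiplicative inverse of a field element. -/
def inv {k : Type*} [Field k] (a : FieldData k) : FieldData k := a.map₁ (·⁻¹)

/-- The zero test. -/
noncomputable def zeroTest {k : Type*} [Field k] (a : FieldData k) : FieldData k := ofBool a.isZero

end FieldData

theorem FieldProg.eval_comp {k : Type*} [Field k] {P Q : FieldProg} {s t : FieldData k}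
    (h : Q.eval s = Part.some t) : (FieldProg.comp P Q).eval s = P.eval t := by
  rw [FieldProg.eval, h]
  exact Part.bind_some _ _

namespace IsUniform

open FieldData

variable {F G H : ∀ (k : Type u) [Field k], FieldData k → FieldData k}

instance id : IsUniform fun (k : Type u) _ (s : FieldData k) => s :=
  ⟨.id, fun _ _ _ => by rw [FieldProg.eval]⟩

instance nil : IsUniform fun (k : Type u) _ (_ : FieldData k) => FieldData.nil :=
  ⟨.nil, fun _ _ _ => by rw [FieldProg.eval]⟩

instance zero : IsUniform fun (k : Type u) _ (_ : FieldData k) => atom 0 :=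
  ⟨.zero, fun _ _ _ => by rw [FieldProg.eval]⟩

instance one : IsUniform fun (k : Type u) _ (_ : FieldData k) => atom 1 :=
  ⟨.one, fun _ _ _ => by rw [FieldProg.eval]⟩

theorem comp (hF : IsUniform F) (hG : IsUniform G) : IsUniform fun k _ s => F k (G k s) := by
  obtain ⟨P, hP⟩ := hF
  obtain ⟨Q, hQ⟩ := hG
  exact ⟨.comp P Q, fun k _ s => by rw [FieldProg.eval_comp (hQ k s), hP]⟩

instance fst [hF : IsUniform F] : IsUniform fun k _ s => (F k s).fst :=
  comp (F := fun _ _ s => s.fst) ⟨.fst, fun _ _ _ => by rw [FieldProg.eval]⟩ hF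

instance snd [hF : IsUniform F] : IsUniform fun k _ s => (F k s).snd :=
  comp (F := fun _ _ s => s.snd) ⟨.snd, fun _ _ _ => by rw [FieldProg.eval]⟩ hF

instance neg [hF : IsUniform F] : IsUniform fun k _ s => (F k s).neg :=
  comp (F := fun _ _ s => s.neg) ⟨.neg, fun _ _ _ => by rw [FieldProg.eval]; rfl⟩ hF

instance inv [hF : IsUniform F] : IsUniform fun k _ s => (F k s).inv :=
  comp (F := fun _ _ s => s.inv) ⟨.inv, fun _ _ _ => by rw [FieldProg.eval]; rfl⟩ hF

instance zeroTest [hF : IsUniform F] : IsUniform fun k _ s => (F k s).zeroTest :=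
  comp (F := fun _ _ s => s.zeroTest) ⟨.isZero, fun _ _ _ => by rw [FieldProg.eval]; rfl⟩ hF

instance pair [hF : IsUniform F] [hG : IsUniform G] :
    IsUniform fun k _ s => FieldData.pair (F k s) (G k s) := by
  obtain ⟨P, hP⟩ := hF
  obtain ⟨Q, hQ⟩ := hG
  exact ⟨.pair P Q, fun k _ s => by rw [FieldProg.eval, hQ, hP, Part.bind_some, Part.map_some]⟩

instance add [IsUniform F] [IsUniform G] : IsUniform fun k _ s => (F k s).add (G k s) :=
  comp (F := fun _ _ s => s.map₂ (· + ·)) (G := fun k _ s => FieldData.pair (F k s) (G k s))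
    ⟨.add, fun _ _ _ => by rw [FieldProg.eval]⟩ pair

instance mul [IsUniform F] [IsUniform G] : IsUniform fun k _ s => (F k s).mul (G k s) :=
  comp (F := fun _ _ s => s.map₂ (· * ·)) (G := fun k _ s => FieldData.pair (F k s) (G k s))
    ⟨.mul, fun _ _ _ => by rw [FieldProg.eval]⟩ pair

instance ite [hF : IsUniform F] [hG : IsUniform G] [hH : IsUniform H] :
    IsUniform fun k _ s => (F k s).ite (G k s) (H k s) := by
  obtain ⟨P, hP⟩ := hF
  obtain ⟨Q, hQ⟩ := hG
  obtain ⟨R, hR⟩ := hH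
  refine ⟨.cond P Q R, fun k _ s => ?_⟩
  rw [FieldProg.eval, hP, Part.bind_some, FieldData.ite]
  cases (F k s).truth
  · exact hR k s
  · exact hQ k s

/-- The loop state consists of the remaining spine, the accumulator and an unchanged environment.
The spine is finite, so the fold is a bounded loop and always halts. -/
theorem loop {c p : FieldProg} {k : Type u} [Field k] {f : FieldData k → FieldData k → FieldData k}
    {env : FieldData k}
    (hc : ∀ s : FieldData k, c.eval s = Part.some s.fst)
    (hp : ∀ sp a, p.eval (FieldData.pair sp (FieldData.pair a env))
      = Part.some (FieldData.pair sp.snd (FieldData.pair (f sp.fst a) env)))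
    (sp a : FieldData k) :
    (FieldProg.loop c p).eval (FieldData.pair sp (FieldData.pair a env))
      = Part.some (FieldData.pair FieldData.nil (FieldData.pair (FieldData.fold f sp a) env)) := by
  rw [FieldProg.eval, Part.eq_some_iff]
  have halt_of_nil : ∀ t : FieldData k, t.fst = FieldData.nil →
      t ∈ PFun.fix (fun t : FieldData k => (c.eval t).bind fun b =>
      bif b.truth then (p.eval t).map Sum.inr else Part.some (Sum.inl t)) t := by
    intro t ht
    apply PFun.fix_stop
    rw [hc, Part.bind_some, ht]
    exact Part.mem_some _
  have iterate_of_true : ∀ sp a : FieldData k, sp.truth = true → ∀ r,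
      r ∈ PFun.fix (fun t : FieldData k => (c.eval t).bind fun b =>
      bif b.truth then (p.eval t).map Sum.inr else Part.some (Sum.inl t))
        (FieldData.pair sp.snd (FieldData.pair (f sp.fst a) env)) →
      r ∈ PFun.fix (fun t : FieldData k => (c.eval t).bind fun b =>
      bif b.truth then (p.eval t).map Sum.inr else Part.some (Sum.inl t))
        (FieldData.pair sp (FieldData.pair a env)) := by
    intro sp a hsp r hr
    refine Eq.mpr (congrArg (r ∈ ·) (PFun.fix_fwd_eq ?_)) hr
    rw [hc, Part.bind_some]
    change _ ∈ bif sp.truth then _ else _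
    rw [hsp, cond_true, hp, Part.map_some]
    exact Part.mem_some _
  induction sp generalizing a with
  | nil => exact halt_of_nil _ rfl
  -- An atom counts as true, so the body runs once more on `nil`; this explains the value of
  -- `FieldData.fold` on atoms.
  | atom x => exact iterate_of_true _ _ rfl _ (halt_of_nil _ rfl)
  | pair h t _ ih => exact iterate_of_true _ _ rfl _ (ih _)

instance fold {f : ∀ (k : Type u) [Field k], FieldData k → FieldData k → FieldData k → FieldData k}
    [hf : IsUniform fun k _ t => f k t.fst t.snd.fst t.snd.snd] [hF : IsUniform F]
    [hG : IsUniform G] :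
    IsUniform fun k _ s => FieldData.fold (fun h a => f k h a s) (F k s) (G k s) := by
  obtain ⟨P, hP⟩ := (inferInstance : IsUniform fun k _ s =>
    FieldData.pair (F k s) (FieldData.pair (G k s) s))
  obtain ⟨Q, hQ⟩ := comp (G := fun _ _ s =>
    FieldData.pair s.fst.fst (FieldData.pair s.snd.fst s.snd.snd)) hf inferInstance
  refine ⟨.comp (.comp .fst .snd) (.comp (.loop .fst
    (.pair (.comp .snd .fst) (.pair Q (.comp .snd .snd)))) P), fun k _ s => ?_⟩
  have h := loop (c := .fst) (p := .pair (.comp .snd .fst) (.pair Q (.comp .snd .snd)))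
    (f := fun h a => f k h a s) (env := s) (fun _ => by rw [FieldProg.eval])
    (fun sp a => by
      simp only [FieldProg.eval, hQ, Part.bind_some, Part.map_some, FieldData.snd, FieldData.fst])
    (F k s) (G k s)
  rw [FieldProg.eval_comp ((FieldProg.eval_comp (hP k s)).trans h), FieldProg.eval_comp
    (by rw [FieldProg.eval]), FieldProg.eval]
  rfl

theorem lift₁ {f : ∀ (k : Type u) [Field k], FieldData k → FieldData k}
    (hf : IsUniform fun k _ s => f k s) [hF : IsUniform F] : IsUniform fun k _ s => f k (F k s) :=
  comp hf hF

/-- A function of several arguments is compiled once on the packed tuple; the lift makes it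
available for arbitrary computable arguments. -/
theorem lift₂ {f : ∀ (k : Type u) [Field k], FieldData k → FieldData k → FieldData k}
    (hf : IsUniform fun k _ s => f k s.fst s.snd) [IsUniform F] [IsUniform G] :
    IsUniform fun k _ s => f k (F k s) (G k s) :=
  comp (G := fun k _ s => FieldData.pair (F k s) (G k s)) hf inferInstance

theorem lift₃ {f : ∀ (k : Type u) [Field k], FieldData k → FieldData k → FieldData k → FieldData k}
    (hf : IsUniform fun k _ s => f k s.fst s.snd.fst s.snd.snd)
    [IsUniform F] [IsUniform G] [IsUniform H] :
    IsUniform fun k _ s => f k (F k s) (G k s) (H k s) :=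
  comp (G := fun k _ s => FieldData.pair (F k s) (FieldData.pair (G k s) (H k s))) hf inferInstance

end IsUniform

namespace FieldData

/-- The sum of two numbers. -/
def addNat {k : Type*} (a b : FieldData k) : FieldData k := fold (fun _ c => pair nil c) a b

/-- The truncated difference of two numbers. -/
def subNat {k : Type*} (a b : FieldData k) : FieldData k := fold (fun _ c => c.snd) b a

end FieldData

namespace IsUniform

open FieldData

variable {F G H : ∀ (k : Type u) [Field k], FieldData k → FieldData k}

instance addNat [IsUniform F] [IsUniform G] : IsUniform fun k _ s => (F k s).addNat (G k s) :=
  lift₂ (f := fun _ _ a b => a.addNat b) (by unfold FieldData.addNat; infer_instance)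

instance subNat [IsUniform F] [IsUniform G] : IsUniform fun k _ s => (F k s).subNat (G k s) :=
  lift₂ (f := fun _ _ a b => a.subNat b) (by unfold FieldData.subNat; infer_instance)

end IsUniform

/-! ### The algorithm -/

namespace FieldData

variable {k : Type*} [Field k]

/-- The truth value true. -/
noncomputable def yes : FieldData k :=
  pair nil nil

/-- Negation. -/
noncomputable def not (a : FieldData k) : FieldData k :=
  ite a nil yes

/-- Conjunction. -/
noncomputable def and (a b : FieldData k) : FieldData k :=
  ite a b nil

/-- Equality of numbers. -/
noncomputable def eqNat (a b : FieldData k) : FieldData k :=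
  not (ite (subNat a b) yes (subNat b a))

/-- The product of two numbers. -/
noncomputable def mulNat (a b : FieldData k) : FieldData k :=
  fold (fun _ c => addNat b c) a nil

/-- The maximum of two numbers. -/
noncomputable def maxNat (a b : FieldData k) : FieldData k :=
  ite (subNat a b) a b

/-- The sum of two polynomials. -/
noncomputable def polyAdd (p q : FieldData k) : FieldData k :=
  fold (fun t acc => pair t acc) p q

/-- A term times the polynomial `p`, plus the polynomial `acc`. -/
noncomputable def mulTerm (t p acc : FieldData k) : FieldData k :=
  fold (fun h acc => pair (pair (addNat t.fst h.fst)
    (pair (addNat t.snd.fst h.snd.fst) (mul t.snd.snd h.snd.snd))) acc) p acc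

/-- The product of two polynomials. -/
noncomputable def polyMul (p q : FieldData k) : FieldData k :=
  fold (fun t acc => mulTerm t q acc) p nil

/-- A constant polynomial. -/
noncomputable def polyConst (c : FieldData k) : FieldData k :=
  pair (pair nil (pair nil c)) nil

/-- A power of a polynomial. -/
noncomputable def polyPow (p n : FieldData k) : FieldData k :=
  fold (fun _ acc => polyMul p acc) n (polyConst (atom 1))

/-- The polynomial `f (p, q)`. -/
noncomputable def polySubst (f p q : FieldData k) : FieldData k :=
  fold (fun t acc => polyAdd (polyMul (polyConst t.snd.snd)
    (polyMul (polyPow p t.fst) (polyPow q t.snd.fst))) acc) f nil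

/-- The composition of two automorphisms. -/
noncomputable def autMul (w v : FieldData k) : FieldData k :=
  pair (polySubst w.fst v.fst v.snd) (polySubst w.snd v.fst v.snd)

/-- The coefficient of `xⁱ yʲ`. -/
noncomputable def polyCoeff (p i j : FieldData k) : FieldData k :=
  fold (fun t acc => ite (and (eqNat t.fst i) (eqNat t.snd.fst j)) (add t.snd.snd acc) acc)
    p (atom 0)

/-- Does the monomial of the term `t` have coefficient zero in `p`? -/
noncomputable def isNull (p t : FieldData k) : FieldData k :=
  zeroTest (polyCoeff p t.fst t.snd.fst)

/-- The total degree. -/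
noncomputable def polyDeg (p : FieldData k) : FieldData k :=
  fold (fun t acc => ite (isNull p t) acc (maxNat (addNat t.fst t.snd.fst) acc)) p nil

/-- Is the total degree at most one? -/
noncomputable def isLinear (p : FieldData k) : FieldData k :=
  not (subNat (polyDeg p) (pair nil nil))

/-- Is the automorphism affine? -/
noncomputable def isAffine (w : FieldData k) : FieldData k :=
  and (isLinear w.fst) (isLinear w.snd)

/-- Is the polynomial of the form `b y + c`? -/
noncomputable def isLine (p : FieldData k) : FieldData k :=
  fold (fun t acc => ite (isNull p t) acc (ite t.fst nil (ite t.snd.fst.snd nil acc))) p yes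

/-- The quotient of `a` by `b`, rounded up. -/
noncomputable def findExp (a b : FieldData k) : FieldData k :=
  fold (fun _ m => ite (subNat a (mulNat m b)) (pair nil m) m) a nil

/-- A term of `p` of degree `d` whose monomial has a nonzero coefficient. -/
noncomputable def findTop (p d : FieldData k) : FieldData k :=
  fold (fun t acc => ite (isNull p t) acc (ite (eqNat (addNat t.fst t.snd.fst) d) t acc))
    p nil

/-- The ratio of the coefficients of `p` and `q` at the monomial of `t`. -/
noncomputable def ratio (p q t : FieldData k) : FieldData k :=
  mul (polyCoeff p t.fst t.snd.fst) (inv (polyCoeff q t.fst t.snd.fst))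

/-- The automorphism `(x - c yᵐ, y)`. -/
noncomputable def shear (m c : FieldData k) : FieldData k :=
  pair (pair (pair (pair nil nil) (pair nil (atom 1))) (pair (pair nil (pair m (neg c))) nil))
    (pair (pair nil (pair (pair nil nil) (atom 1))) nil)

/-- The automorphism `(y, x)`. -/
noncomputable def swap : FieldData k :=
  pair (pair (pair nil (pair (pair nil nil) (atom 1))) nil)
    (pair (pair (pair nil nil) (pair nil (atom 1))) nil)

/-- The conjugate of `g` by an automorphism given together with its inverse. -/
noncomputable def conj (g st : FieldData k) : FieldData k :=
  autMul st.fst (autMul g st.snd)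

/-- Compose an automorphism given together with its inverse with another one. -/
noncomputable def update (e e' st : FieldData k) : FieldData k :=
  pair (autMul e st.fst) (autMul st.snd e')

/-- Compose with a shear. -/
noncomputable def updateShear (m c st : FieldData k) : FieldData k :=
  update (shear m c) (shear m (neg c)) st

/-- Compose with the shear that simplifies `g`. -/
noncomputable def reduceShear (g st : FieldData k) : FieldData k :=
  updateShear (findExp (polyDeg g.fst) (polyDeg g.snd))
    (ratio g.fst (polyPow g.snd (findExp (polyDeg g.fst) (polyDeg g.snd)))
      (findTop g.fst (polyDeg g.fst))) st

/-- Compose with the elementary automorphism that simplifies `g`. -/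
noncomputable def reduceWith (g st : FieldData k) : FieldData k :=
  ite (isAffine g) st (ite (isLine g.snd) st
    (ite (subNat (polyDeg g.snd) (polyDeg g.fst)) (update swap swap st) (reduceShear g st)))

/-- One simplification step for the conjugate of `g`. -/
noncomputable def reduceStep (g st : FieldData k) : FieldData k :=
  reduceWith (conj g st) st

/-- A bound for the number of simplification steps. -/
noncomputable def fuel (g : FieldData k) : FieldData k :=
  pair nil (addNat (addNat (polyDeg g.fst) (polyDeg g.snd))
    (addNat (polyDeg g.fst) (polyDeg g.snd)))

/-- Simplify the conjugate of `g` until it lies in one of the factors. -/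
noncomputable def reduce (g st : FieldData k) : FieldData k :=
  fold (fun _ st => reduceStep g st) (fuel (conj g st)) st

/-- The identity together with its inverse. -/
noncomputable def start : FieldData k :=
  pair (pair (pair (pair (pair nil nil) (pair nil (atom 1))) nil)
      (pair (pair nil (pair (pair nil nil) (atom 1))) nil))
    (pair (pair (pair (pair nil nil) (pair nil (atom 1))) nil)
      (pair (pair nil (pair (pair nil nil) (atom 1))) nil))

/-- Simplify all generators in turn. -/
noncomputable def search (gs : FieldData k) : FieldData k :=
  fold (fun g st => reduce g st) gs start

/-- Are all conjugates affine? -/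
noncomputable def allAffine (gs st : FieldData k) : FieldData k :=
  fold (fun g acc => ite (isAffine (conj g st)) acc nil) gs yes

/-- Are all conjugates de Jonquières? -/
noncomputable def allLine (gs st : FieldData k) : FieldData k :=
  fold (fun g acc => ite (isLine (conj g st).snd) acc nil) gs yes

/-- The answer, given the result of the search. -/
noncomputable def answer (gs st : FieldData k) : FieldData k :=
  ite (allAffine gs st) (pair nil st.fst) (ite (allLine gs st) (pair nil st.fst) nil)

/-- The algorithm. -/
noncomputable def findConjugator (gs : FieldData k) : FieldData k :=
  answer gs (search gs)

end FieldData

/-! ### Compilation of the algorithm into a program. -/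

namespace IsUniform

variable {F G H : ∀ (k : Type u) [Field k], FieldData k → FieldData k}

instance yes : IsUniform fun (k : Type u) _ (_ : FieldData k) => FieldData.yes := by
  unfold FieldData.yes; infer_instance

instance not [IsUniform F] :
    IsUniform fun k _ s => FieldData.not (F k s) :=
  lift₁ (f := fun _ _ a => FieldData.not a)
    (by unfold FieldData.not; infer_instance)

instance and [IsUniform F] [IsUniform G] :
    IsUniform fun k _ s => FieldData.and (F k s) (G k s) :=
  lift₂ (f := fun _ _ a b => FieldData.and a b)
    (by unfold FieldData.and; infer_instance)

instance eqNat [IsUniform F] [IsUniform G] :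
    IsUniform fun k _ s => FieldData.eqNat (F k s) (G k s) :=
  lift₂ (f := fun _ _ a b => FieldData.eqNat a b)
    (by unfold FieldData.eqNat; infer_instance)

instance mulNat [IsUniform F] [IsUniform G] :
    IsUniform fun k _ s => FieldData.mulNat (F k s) (G k s) :=
  lift₂ (f := fun _ _ a b => FieldData.mulNat a b)
    (by unfold FieldData.mulNat; infer_instance)

instance maxNat [IsUniform F] [IsUniform G] :
    IsUniform fun k _ s => FieldData.maxNat (F k s) (G k s) :=
  lift₂ (f := fun _ _ a b => FieldData.maxNat a b)
    (by unfold FieldData.maxNat; infer_instance)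

instance polyAdd [IsUniform F] [IsUniform G] :
    IsUniform fun k _ s => FieldData.polyAdd (F k s) (G k s) :=
  lift₂ (f := fun _ _ a b => FieldData.polyAdd a b)
    (by unfold FieldData.polyAdd; infer_instance)

instance mulTerm [IsUniform F] [IsUniform G] [IsUniform H] :
    IsUniform fun k _ s => FieldData.mulTerm (F k s) (G k s) (H k s) :=
  lift₃ (f := fun _ _ a b c => FieldData.mulTerm a b c)
    (by unfold FieldData.mulTerm; infer_instance)

instance polyMul [IsUniform F] [IsUniform G] :
    IsUniform fun k _ s => FieldData.polyMul (F k s) (G k s) :=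
  lift₂ (f := fun _ _ a b => FieldData.polyMul a b)
    (by unfold FieldData.polyMul; infer_instance)

instance polyConst [IsUniform F] :
    IsUniform fun k _ s => FieldData.polyConst (F k s) :=
  lift₁ (f := fun _ _ a => FieldData.polyConst a)
    (by unfold FieldData.polyConst; infer_instance)

instance polyPow [IsUniform F] [IsUniform G] :
    IsUniform fun k _ s => FieldData.polyPow (F k s) (G k s) :=
  lift₂ (f := fun _ _ a b => FieldData.polyPow a b)
    (by unfold FieldData.polyPow; infer_instance)

instance polySubst [IsUniform F] [IsUniform G] [IsUniform H] :
    IsUniform fun k _ s => FieldData.polySubst (F k s) (G k s) (H k s) :=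
  lift₃ (f := fun _ _ a b c => FieldData.polySubst a b c)
    (by unfold FieldData.polySubst; infer_instance)

instance autMul [IsUniform F] [IsUniform G] :
    IsUniform fun k _ s => FieldData.autMul (F k s) (G k s) :=
  lift₂ (f := fun _ _ a b => FieldData.autMul a b)
    (by unfold FieldData.autMul; infer_instance)

instance polyCoeff [IsUniform F] [IsUniform G] [IsUniform H] :
    IsUniform fun k _ s => FieldData.polyCoeff (F k s) (G k s) (H k s) :=
  lift₃ (f := fun _ _ a b c => FieldData.polyCoeff a b c)
    (by unfold FieldData.polyCoeff; infer_instance)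

instance isNull [IsUniform F] [IsUniform G] :
    IsUniform fun k _ s => FieldData.isNull (F k s) (G k s) :=
  lift₂ (f := fun _ _ a b => FieldData.isNull a b)
    (by unfold FieldData.isNull; infer_instance)

instance polyDeg [IsUniform F] :
    IsUniform fun k _ s => FieldData.polyDeg (F k s) :=
  lift₁ (f := fun _ _ a => FieldData.polyDeg a)
    (by unfold FieldData.polyDeg; infer_instance)

instance polyDeg_id : IsUniform fun (k : Type u) _ (s : FieldData k) => FieldData.polyDeg s :=
  polyDeg (F := fun _ _ s => s)

instance isLinear [IsUniform F] :
    IsUniform fun k _ s => FieldData.isLinear (F k s) :=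
  lift₁ (f := fun _ _ a => FieldData.isLinear a)
    (by unfold FieldData.isLinear; infer_instance)

instance isAffine [IsUniform F] :
    IsUniform fun k _ s => FieldData.isAffine (F k s) :=
  lift₁ (f := fun _ _ a => FieldData.isAffine a)
    (by unfold FieldData.isAffine; infer_instance)

instance isLine [IsUniform F] :
    IsUniform fun k _ s => FieldData.isLine (F k s) :=
  lift₁ (f := fun _ _ a => FieldData.isLine a)
    (by unfold FieldData.isLine; infer_instance)

instance findExp [IsUniform F] [IsUniform G] :
    IsUniform fun k _ s => FieldData.findExp (F k s) (G k s) :=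
  lift₂ (f := fun _ _ a b => FieldData.findExp a b)
    (by unfold FieldData.findExp; infer_instance)

instance findTop [IsUniform F] [IsUniform G] :
    IsUniform fun k _ s => FieldData.findTop (F k s) (G k s) :=
  lift₂ (f := fun _ _ a b => FieldData.findTop a b)
    (by unfold FieldData.findTop; infer_instance)

instance ratio [IsUniform F] [IsUniform G] [IsUniform H] :
    IsUniform fun k _ s => FieldData.ratio (F k s) (G k s) (H k s) :=
  lift₃ (f := fun _ _ a b c => FieldData.ratio a b c)
    (by unfold FieldData.ratio; infer_instance)

instance shear [IsUniform F] [IsUniform G] :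
    IsUniform fun k _ s => FieldData.shear (F k s) (G k s) :=
  lift₂ (f := fun _ _ a b => FieldData.shear a b)
    (by unfold FieldData.shear; infer_instance)

instance swap : IsUniform fun (k : Type u) _ (_ : FieldData k) => FieldData.swap := by
  unfold FieldData.swap; infer_instance

instance conj [IsUniform F] [IsUniform G] :
    IsUniform fun k _ s => FieldData.conj (F k s) (G k s) :=
  lift₂ (f := fun _ _ a b => FieldData.conj a b)
    (by unfold FieldData.conj; infer_instance)

instance update [IsUniform F] [IsUniform G] [IsUniform H] :
    IsUniform fun k _ s => FieldData.update (F k s) (G k s) (H k s) :=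
  lift₃ (f := fun _ _ a b c => FieldData.update a b c)
    (by unfold FieldData.update; infer_instance)

instance updateShear [IsUniform F] [IsUniform G] [IsUniform H] :
    IsUniform fun k _ s => FieldData.updateShear (F k s) (G k s) (H k s) :=
  lift₃ (f := fun _ _ a b c => FieldData.updateShear a b c)
    (by unfold FieldData.updateShear; infer_instance)

instance reduceShear [IsUniform F] [IsUniform G] :
    IsUniform fun k _ s => FieldData.reduceShear (F k s) (G k s) :=
  lift₂ (f := fun _ _ a b => FieldData.reduceShear a b)
    (by unfold FieldData.reduceShear; infer_instance)

instance reduceWith [IsUniform F] [IsUniform G] :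
    IsUniform fun k _ s => FieldData.reduceWith (F k s) (G k s) :=
  lift₂ (f := fun _ _ a b => FieldData.reduceWith a b)
    (by unfold FieldData.reduceWith; infer_instance)

instance reduceStep [IsUniform F] [IsUniform G] :
    IsUniform fun k _ s => FieldData.reduceStep (F k s) (G k s) :=
  lift₂ (f := fun _ _ a b => FieldData.reduceStep a b)
    (by unfold FieldData.reduceStep; infer_instance)

instance fuel [IsUniform F] :
    IsUniform fun k _ s => FieldData.fuel (F k s) :=
  lift₁ (f := fun _ _ a => FieldData.fuel a)
    (by unfold FieldData.fuel; infer_instance)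

instance reduce [IsUniform F] [IsUniform G] :
    IsUniform fun k _ s => FieldData.reduce (F k s) (G k s) :=
  lift₂ (f := fun _ _ a b => FieldData.reduce a b)
    (by unfold FieldData.reduce; infer_instance)

instance start : IsUniform fun (k : Type u) _ (_ : FieldData k) => FieldData.start := by
  unfold FieldData.start; infer_instance

instance search [IsUniform F] :
    IsUniform fun k _ s => FieldData.search (F k s) :=
  lift₁ (f := fun _ _ a => FieldData.search a)
    (by unfold FieldData.search; infer_instance)

instance search_id : IsUniform fun (k : Type u) _ (s : FieldData k) => FieldData.search s :=
  search (F := fun _ _ s => s)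

instance allAffine [IsUniform F] [IsUniform G] :
    IsUniform fun k _ s => FieldData.allAffine (F k s) (G k s) :=
  lift₂ (f := fun _ _ a b => FieldData.allAffine a b)
    (by unfold FieldData.allAffine; infer_instance)

instance allLine [IsUniform F] [IsUniform G] :
    IsUniform fun k _ s => FieldData.allLine (F k s) (G k s) :=
  lift₂ (f := fun _ _ a b => FieldData.allLine a b)
    (by unfold FieldData.allLine; infer_instance)

instance answer [IsUniform F] [IsUniform G] :
    IsUniform fun k _ s => FieldData.answer (F k s) (G k s) :=
  lift₂ (f := fun _ _ a b => FieldData.answer a b)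
    (by unfold FieldData.answer; infer_instance)

instance findConjugator [IsUniform F] :
    IsUniform fun k _ s => FieldData.findConjugator (F k s) :=
  lift₁ (f := fun _ _ a => FieldData.findConjugator a)
    (by unfold FieldData.findConjugator; infer_instance)

end IsUniform

/-! ### Correctness of the operations on data -/

namespace FieldData

open MvPolynomial

variable {k : Type*}

theorem ite_nil (p q : FieldData k) : ite nil p q = q := rfl

theorem ite_yes (p q : FieldData k) : ite yes p q = p := rfl

theorem ite_ofNat (n : ℕ) (p q : FieldData k) : ite (ofNat n) p q = if n = 0 then q else p := by
  cases n <;> rfl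

theorem ite_not (c p q : FieldData k) : ite (not c) p q = ite c q p := by
  unfold not ite; cases c.truth <;> rfl

theorem ite_and (c d p q : FieldData k) : ite (and c d) p q = ite c (ite d p q) q := by
  unfold and ite; cases c.truth <;> rfl

theorem fold_ofNat (f : FieldData k → FieldData k → FieldData k) (n : ℕ) (acc : FieldData k) :
    fold f (ofNat n) acc = (f nil)^[n] acc := by
  induction n generalizing acc with
  | zero => rfl
  | succ n ih => exact ih _

theorem addNat_ofNat (a b : ℕ) : addNat (ofNat a) (ofNat b) = (ofNat (a + b) : FieldData k) := by
  rw [addNat, fold_ofNat]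
  induction a with
  | zero => simp
  | succ a ih => rw [Function.iterate_succ_apply', ih, Nat.add_right_comm]; rfl

theorem snd_ofNat (a : ℕ) : (ofNat a : FieldData k).snd = ofNat (a - 1) := by
  cases a <;> rfl

theorem subNat_ofNat (a b : ℕ) : subNat (ofNat a) (ofNat b) = (ofNat (a - b) : FieldData k) := by
  rw [subNat, fold_ofNat]
  induction b with
  | zero => simp
  | succ b ih => rw [Function.iterate_succ_apply', ih, snd_ofNat]; rfl

theorem mulNat_ofNat (a b : ℕ) : mulNat (ofNat a) (ofNat b) = (ofNat (a * b) : FieldData k) := by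
  rw [mulNat, fold_ofNat]
  induction a with
  | zero => simp [ofNat]
  | succ a ih => rw [Function.iterate_succ_apply', ih, addNat_ofNat, Nat.succ_mul, Nat.add_comm]

theorem maxNat_ofNat (a b : ℕ) : maxNat (ofNat a) (ofNat b) = (ofNat (max a b) : FieldData k) := by
  rw [maxNat, subNat_ofNat, ite_ofNat]
  split_ifs with h
  · rw [max_eq_right (by omega)]
  · rw [max_eq_left (by omega)]

theorem ite_eqNat (a b : ℕ) (p q : FieldData k) :
    ite (eqNat (ofNat a) (ofNat b)) p q = if a = b then p else q := by
  rw [eqNat, ite_not, subNat_ofNat, subNat_ofNat, ite_ofNat]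
  split_ifs with h1 h2 h2
  · rw [ite_ofNat, if_pos (by omega)]
  · rw [ite_ofNat, if_neg (by omega)]
  · omega
  · rfl

/-- A term as a datum. -/
def ofTerm (t : ℕ × ℕ × k) : FieldData k := pair (ofNat t.1) (pair (ofNat t.2.1) (atom t.2.2))

theorem toData_cons (t : ℕ × ℕ × k) (l : TermList k) :
    TermList.toData (t :: l) = pair (ofTerm t) l.toData := rfl

variable [Field k]

theorem ite_zeroTest (c : k) (p q : FieldData k) [Decidable (c = 0)] :
    ite (zeroTest (atom c)) p q = if c = 0 then p else q := by
  rw [zeroTest, isZero]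
  by_cases h : c = 0 <;> simp [h, ofBool, ite, truth]

/-- The datum `s` is a written-out form of the polynomial `f`. -/
def IsPoly (s : FieldData k) (f : MvPolynomial (Fin 2) k) : Prop :=
  ∃ l : TermList k, s = l.toData ∧ l.toPoly = f

/-- The datum `s` is a written-out form of the automorphism `φ`. -/
def IsAut (s : FieldData k) (φ : PlaneAut k) : Prop :=
  ∃ a b, s = pair a b ∧ IsPoly a (φ.component 0) ∧ IsPoly b (φ.component 1)

theorem toPoly_cons (t : ℕ × ℕ × k) (l : TermList k) :
    TermList.toPoly (t :: l) = C t.2.2 * X 0 ^ t.1 * X 1 ^ t.2.1 + l.toPoly := by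
  simp [TermList.toPoly]

theorem toPoly_nil : TermList.toPoly ([] : TermList k) = 0 := rfl

theorem IsPoly.congr {s t : FieldData k} {f g : MvPolynomial (Fin 2) k} (h : IsPoly s f)
    (hst : s = t) (hfg : f = g) : IsPoly t g := by
  subst hst hfg
  exact h

theorem IsPoly.nil : IsPoly (nil : FieldData k) 0 := ⟨[], rfl, rfl⟩

theorem IsPoly.cons {s : FieldData k} {f : MvPolynomial (Fin 2) k} (h : IsPoly s f) (i j : ℕ)
    (c : k) : IsPoly (pair (pair (ofNat i) (pair (ofNat j) (atom c))) s)
      (C c * X 0 ^ i * X 1 ^ j + f) := by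
  obtain ⟨l, rfl, rfl⟩ := h
  exact ⟨(i, j, c) :: l, rfl, toPoly_cons _ _⟩

theorem IsPoly.polyAdd {s t : FieldData k} {f g : MvPolynomial (Fin 2) k} (hs : IsPoly s f)
    (ht : IsPoly t g) : IsPoly (polyAdd s t) (f + g) := by
  obtain ⟨l, rfl, rfl⟩ := hs
  induction l generalizing t g with
  | nil => exact ht.congr rfl (by simp [toPoly_nil])
  | cons a l ih =>
    have := ih (ht.cons a.1 a.2.1 a.2.2)
    exact this.congr rfl (by rw [toPoly_cons]; ring)

theorem IsPoly.mulTerm {s t : FieldData k} {f g : MvPolynomial (Fin 2) k} (hs : IsPoly s f)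
    (ht : IsPoly t g) (a : ℕ × ℕ × k) :
    IsPoly (mulTerm (ofTerm a) s t) (C a.2.2 * X 0 ^ a.1 * X 1 ^ a.2.1 * f + g) := by
  obtain ⟨l, rfl, rfl⟩ := hs
  induction l generalizing t g with
  | nil => exact ht.congr rfl (by simp [toPoly_nil])
  | cons b l ih =>
    have := ih (ht.cons (a.1 + b.1) (a.2.1 + b.2.1) (a.2.2 * b.2.2))
    rw [← addNat_ofNat, ← addNat_ofNat] at this
    exact this.congr rfl (by rw [toPoly_cons, C_mul]; ring)

theorem IsPoly.polyMul {s t : FieldData k} {f g : MvPolynomial (Fin 2) k} (hs : IsPoly s f)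
    (ht : IsPoly t g) : IsPoly (polyMul s t) (f * g) := by
  have key : ∀ (l : TermList k) {a : FieldData k} {h : MvPolynomial (Fin 2) k}, IsPoly a h →
      IsPoly (fold (fun r acc => FieldData.mulTerm r t acc) l.toData a) (l.toPoly * g + h) := by
    intro l
    induction l with
    | nil => intro a h ha; exact ha.congr rfl (by simp [toPoly_nil])
    | cons b l ih =>
      intro a h ha
      have := ih (ht.mulTerm ha b)
      exact this.congr rfl (by rw [toPoly_cons]; ring)
  obtain ⟨l, rfl, rfl⟩ := hs
  exact (key l IsPoly.nil).congr rfl (add_zero _)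

theorem isPoly_polyConst (c : k) : IsPoly (polyConst (atom c)) (C c) := by
  exact (IsPoly.nil.cons 0 0 c).congr rfl (by simp)

theorem IsPoly.polyPow {s : FieldData k} {f : MvPolynomial (Fin 2) k} (hs : IsPoly s f) (n : ℕ) :
    IsPoly (polyPow s (ofNat n)) (f ^ n) := by
  rw [FieldData.polyPow, fold_ofNat]
  induction n with
  | zero => simpa using isPoly_polyConst (1 : k)
  | succ n ih =>
    rw [Function.iterate_succ_apply', pow_succ']
    exact hs.polyMul ih

theorem IsPoly.polySubst {s t r : FieldData k} {f g h : MvPolynomial (Fin 2) k} (hs : IsPoly s f)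
    (ht : IsPoly t g) (hr : IsPoly r h) : IsPoly (polySubst s t r) (aeval ![g, h] f) := by
  have key : ∀ (l : TermList k) {a : FieldData k} {e : MvPolynomial (Fin 2) k}, IsPoly a e →
      IsPoly (fold (fun b acc => FieldData.polyAdd (FieldData.polyMul (polyConst b.snd.snd)
        (FieldData.polyMul (FieldData.polyPow t b.fst) (FieldData.polyPow r b.snd.fst))) acc)
        l.toData a) (aeval ![g, h] l.toPoly + e) := by
    intro l
    induction l with
    | nil => intro a h ha; exact ha.congr rfl (by simp [toPoly_nil])
    | cons b l ih =>
      intro a e ha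
      have := ih (((isPoly_polyConst b.2.2).polyMul
        ((ht.polyPow b.1).polyMul (hr.polyPow b.2.1))).polyAdd ha)
      refine this.congr rfl ?_
      rw [toPoly_cons]
      simp only [map_add, map_mul, map_pow, aeval_X, algHom_C, algebraMap_eq, Matrix.cons_val_zero,
        Matrix.cons_val_one]
      ring
  obtain ⟨l, rfl, rfl⟩ := hs
  exact (key l IsPoly.nil).congr rfl (add_zero _)

theorem IsAut.autMul {s t : FieldData k} {φ ψ : PlaneAut k} (hs : IsAut s φ) (ht : IsAut t ψ) :
    IsAut (autMul s t) (φ * ψ) := by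
  obtain ⟨a, b, rfl, ha, hb⟩ := hs
  obtain ⟨c, d, rfl, hc, hd⟩ := ht
  have h : ψ.component = ![ψ.component 0, ψ.component 1] := by
    funext i; fin_cases i <;> rfl
  refine ⟨_, _, rfl, ?_, ?_⟩
  · rw [PlaneAut.component_mul, h]; exact ha.polySubst hc hd
  · rw [PlaneAut.component_mul, h]; exact hb.polySubst hc hd

/-- The exponent of the monomial `xⁱ yʲ`. -/
noncomputable def expo (i j : ℕ) : Fin 2 →₀ ℕ := Finsupp.single 0 i + Finsupp.single 1 j

theorem expo_zero (i j : ℕ) : expo i j 0 = i := by simp [expo]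

theorem expo_one (i j : ℕ) : expo i j 1 = j := by simp [expo]

theorem expo_inj {i j i' j' : ℕ} : expo i j = expo i' j' ↔ i = i' ∧ j = j' := by
  refine ⟨fun h => ⟨?_, ?_⟩, fun h => by rw [h.1, h.2]⟩
  · rw [← expo_zero i j, h, expo_zero]
  · rw [← expo_one i j, h, expo_one]

theorem term_eq_monomial (c : k) (i j : ℕ) :
    (C c * X 0 ^ i * X 1 ^ j : MvPolynomial (Fin 2) k) = monomial (expo i j) c := by
  rw [X_pow_eq_monomial, X_pow_eq_monomial, C_mul_monomial, monomial_mul, mul_one, mul_one, expo]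

theorem IsPoly.polyCoeff {s : FieldData k} {f : MvPolynomial (Fin 2) k} (hs : IsPoly s f)
    (i j : ℕ) : polyCoeff s (ofNat i) (ofNat j) = atom (f.coeff (expo i j)) := by
  classical
  have key : ∀ (l : TermList k) (a : k), fold (fun t acc => ite (and (eqNat t.fst (ofNat i))
      (eqNat t.snd.fst (ofNat j))) (add t.snd.snd acc) acc) l.toData (atom a)
        = atom (l.toPoly.coeff (expo i j) + a) := by
    intro l
    induction l with
    | nil => intro a; simp [toPoly_nil, TermList.toData, ofList, fold]
    | cons b l ih =>
      intro a
      rw [toPoly_cons, coeff_add, term_eq_monomial, coeff_monomial]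
      have h : ite (and (eqNat (ofNat b.1) (ofNat i)) (eqNat (ofNat b.2.1) (ofNat j)))
          (add (atom b.2.2) (atom a)) (atom a)
          = atom ((if expo b.1 b.2.1 = expo i j then b.2.2 else 0) + a) := by
        rw [ite_and, ite_eqNat, ite_eqNat]
        simp only [expo_inj]
        by_cases h1 : b.1 = i <;> by_cases h2 : b.2.1 = j <;> simp [h1, h2, add, map₂]
      rw [toData_cons, fold]
      change fold _ _ (ite (and (eqNat (ofNat b.1) (ofNat i)) (eqNat (ofNat b.2.1) (ofNat j)))
          (add (atom b.2.2) (atom a)) (atom a)) = _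
      rw [h, ih, add_left_comm, add_assoc]
  obtain ⟨l, rfl, rfl⟩ := hs
  exact (key l 0).trans (by rw [add_zero])

theorem exists_term_of_mem_support (l : TermList k) {d : Fin 2 →₀ ℕ} (hd : d ∈ l.toPoly.support) :
    ∃ t ∈ l, expo t.1 t.2.1 = d := by
  classical
  induction l with
  | nil => simp [toPoly_nil] at hd
  | cons b l ih =>
    rw [toPoly_cons, term_eq_monomial] at hd
    rcases Finset.mem_union.1 (support_add hd) with h | h
    · exact ⟨b, List.mem_cons_self, (Finset.mem_singleton.1 (support_monomial_subset h)).symm⟩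
    · obtain ⟨t, ht, h⟩ := ih h
      exact ⟨t, List.mem_cons_of_mem _ ht, h⟩

open Classical in
theorem IsPoly.ite_isNull {s : FieldData k} {f : MvPolynomial (Fin 2) k} (hs : IsPoly s f)
    (t : ℕ × ℕ × k) (p q : FieldData k) :
    ite (isNull s (ofTerm t)) p q = if expo t.1 t.2.1 ∈ f.support then q else p := by
  rw [isNull]
  change ite (zeroTest (FieldData.polyCoeff s (ofNat t.1) (ofNat t.2.1))) p q = _
  rw [hs.polyCoeff, ite_zeroTest]
  simp only [mem_support_iff, _root_.ite_not]

/-- Term lists may repeat monomials and cancel, so each term is tested against the total coefficient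
of its monomial. Only genuine support elements then contribute to the maximum. -/
theorem IsPoly.polyDeg {s : FieldData k} {f : MvPolynomial (Fin 2) k} (hs : IsPoly s f) :
    polyDeg s = ofNat (wdeg 1 1 f) := by
  classical
  have key : ∀ (l : TermList k) (a : ℕ), ∃ n, fold (fun t acc => ite (isNull s t) acc
      (maxNat (addNat t.fst t.snd.fst) acc)) l.toData (ofNat a) = ofNat n ∧ a ≤ n ∧
      (∀ t ∈ l, expo t.1 t.2.1 ∈ f.support → t.1 + t.2.1 ≤ n) ∧
      (n = a ∨ ∃ d ∈ f.support, n = d 0 + d 1) := by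
    intro l
    induction l with
    | nil => intro a; exact ⟨a, rfl, le_rfl, by simp, Or.inl rfl⟩
    | cons b l ih =>
      intro a
      have h : ite (isNull s (ofTerm b)) (ofNat a)
          (maxNat (addNat (ofTerm b).fst (ofTerm b).snd.fst) (ofNat a))
          = ofNat (if expo b.1 b.2.1 ∈ f.support then max (b.1 + b.2.1) a else a) := by
        rw [hs.ite_isNull]
        change (if _ then maxNat (addNat (ofNat b.1) (ofNat b.2.1)) (ofNat a) else _) = _
        rw [addNat_ofNat, maxNat_ofNat]
        split_ifs <;> rfl
      rw [toData_cons, fold, h]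
      obtain ⟨n, h1, h2, h3, h4⟩ :=
        ih (if expo b.1 b.2.1 ∈ f.support then max (b.1 + b.2.1) a else a)
      refine ⟨n, h1, ?_, ?_, ?_⟩
      · split_ifs at h2 <;> omega
      · intro t ht hmem
        rcases List.mem_cons.1 ht with rfl | ht
        · rw [if_pos hmem] at h2
          omega
        · exact h3 t ht hmem
      · rcases h4 with h4 | h4
        · split_ifs at h4 with hmem
          · rcases max_choice (b.1 + b.2.1) a with hm | hm
            · exact Or.inr ⟨_, hmem, by rw [h4, hm, expo_zero, expo_one]⟩
            · exact Or.inl (h4.trans hm)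
          · exact Or.inl h4
        · exact Or.inr h4
  obtain ⟨l, hl, hlf⟩ := hs
  obtain ⟨n, h1, -, h3, h4⟩ := key l 0
  rw [FieldData.polyDeg]
  -- The list occurs twice, as the polynomial being tested and as the list being traversed; only the
  -- second is unfolded.
  nth_rewrite 2 [hl]
  refine h1.trans (congrArg _ (le_antisymm ?_ ?_))
  · rcases h4 with rfl | ⟨d, hd, rfl⟩
    · exact Nat.zero_le _
    · have := le_wdeg (α := 1) one_pos hd
      omega
  · refine wdeg_le fun d hd => ?_
    obtain ⟨t, ht, rfl⟩ := exists_term_of_mem_support l (hlf ▸ hd)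
    rw [expo_zero, expo_one, one_mul, one_mul]
    exact h3 t ht hd

open Classical in
theorem IsPoly.ite_isLine {s : FieldData k} {f : MvPolynomial (Fin 2) k} (hs : IsPoly s f)
    (p q : FieldData k) :
    ite (isLine s) p q = if ∀ d ∈ f.support, d 0 = 0 ∧ d 1 ≤ 1 then p else q := by
  have key : ∀ (l : TermList k) (a : FieldData k), fold (fun t acc => ite (isNull s t) acc
      (ite t.fst FieldData.nil (ite t.snd.fst.snd FieldData.nil acc))) l.toData a
      = if a = FieldData.nil ∨ ∃ t ∈ l, expo t.1 t.2.1 ∈ f.support ∧ ¬ (t.1 = 0 ∧ t.2.1 ≤ 1)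
        then FieldData.nil else a := by
    intro l
    induction l with
    | nil => intro a; simp [TermList.toData, ofList, fold]
    | cons b l ih =>
      intro a
      have h : ite (isNull s (ofTerm b)) a
          (ite (ofTerm b).fst FieldData.nil (ite (ofTerm b).snd.fst.snd FieldData.nil a))
          = if expo b.1 b.2.1 ∈ f.support ∧ ¬ (b.1 = 0 ∧ b.2.1 ≤ 1) then FieldData.nil else a := by
        rw [hs.ite_isNull]
        change (if _ then ite (ofNat b.1) FieldData.nil (ite (ofNat b.2.1 : FieldData k).snd _ _)
          else _) = _
        rw [snd_ofNat, ite_ofNat, ite_ofNat]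
        split_ifs <;> first | rfl | (exfalso; omega) | (exfalso; simp_all)
      rw [toData_cons, fold, h, ih]
      by_cases hb : expo b.1 b.2.1 ∈ f.support ∧ ¬ (b.1 = 0 ∧ b.2.1 ≤ 1)
      · rw [if_pos hb, if_pos (Or.inl rfl), if_pos (Or.inr ⟨b, List.mem_cons_self, hb⟩)]
      · rw [if_neg hb]
        simp only [List.mem_cons, exists_eq_or_imp, hb, false_or]
  obtain ⟨l, hl, hlf⟩ := hs
  rw [isLine]
  nth_rewrite 2 [hl]
  rw [key]
  have hiff : (yes = (FieldData.nil : FieldData k) ∨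
      ∃ t ∈ l, expo t.1 t.2.1 ∈ f.support ∧ ¬ (t.1 = 0 ∧ t.2.1 ≤ 1)) ↔
      ¬ ∀ d ∈ f.support, d 0 = 0 ∧ d 1 ≤ 1 := by
    constructor
    · rintro (h | ⟨t, -, h1, h2⟩) hcon
      · simp [yes] at h
      · have := hcon _ h1
        rw [expo_zero, expo_one] at this
        exact h2 this
    · intro h
      push Not at h
      obtain ⟨d, hd, hd'⟩ := h
      obtain ⟨t, ht, rfl⟩ := exists_term_of_mem_support l (hlf ▸ hd)
      rw [expo_zero, expo_one] at hd'
      exact Or.inr ⟨t, ht, hd, fun h => absurd h.2 (not_le.2 (hd' h.1))⟩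
  by_cases h : ∀ d ∈ f.support, d 0 = 0 ∧ d 1 ≤ 1
  · rw [if_neg (fun h' => hiff.1 h' h), if_pos h, ite_yes]
  · rw [if_pos (hiff.2 h), if_neg h, ite_nil]

end FieldData

theorem PlaneAut.isDeJonquieres_iff {k : Type*} [Field k] {φ : PlaneAut k} :
    φ.IsDeJonquieres ↔ ∀ d ∈ (φ.component 1).support, d 0 = 0 ∧ d 1 ≤ 1 := by
  refine ⟨fun h d hd => ?_, PlaneAut.isDeJonquieres_of_support⟩
  obtain ⟨N, hN⟩ := h.exists_wdeg_le
  -- With weight at least two on `x`, a second component of weighted degree at most one cannot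
  -- contain `x`.
  have h1 := (MvPolynomial.le_wdeg (α := N + 2) one_pos hd).trans (hN (N + 2) (by omega)).2
  have h2 : 2 * d 0 ≤ (N + 2) * d 0 := Nat.mul_le_mul_right _ (by omega)
  omega

/-! ### Correctness of the search. -/

namespace FieldData

open MvPolynomial

variable {k : Type*}

/-- The counter grows while `m * b < a`. If `a = n * b` with `b` positive, it stops at `n`, and the
`a` iterations suffice because `n ≤ a`. -/
theorem exists_findExp (a b : ℕ) : ∃ m, findExp (ofNat a) (ofNat b) = (ofNat m : FieldData k) ∧
    ∀ n, 0 < b → a = n * b → m = n := by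
  let step : ℕ → ℕ := fun m => if a - m * b = 0 then m else m + 1
  refine ⟨step^[a] 0, ?_, ?_⟩
  · rw [findExp, fold_ofNat]
    have : ∀ i, (fun m : FieldData k => ite (subNat (ofNat a) (mulNat m (ofNat b)))
        (pair nil m) m)^[i] nil = ofNat (step^[i] 0) := by
      intro i
      induction i with
      | zero => rfl
      | succ i ih =>
        rw [Function.iterate_succ_apply', Function.iterate_succ_apply', ih, mulNat_ofNat,
          subNat_ofNat, ite_ofNat]
        change _ = ofNat (if _ then _ else _)
        split_ifs <;> rfl
    exact this a
  · intro n hb hn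
    have : ∀ i, step^[i] 0 = min i n := by
      intro i
      induction i with
      | zero => simp
      | succ i ih =>
        rw [Function.iterate_succ_apply', ih]
        change (if _ then _ else _) = _
        rw [hn, ← Nat.sub_mul]
        rcases le_total n i with h | h
        · rw [min_eq_right h, if_pos (by simp), min_eq_right (by omega)]
        · rcases h.eq_or_lt with rfl | h'
          · rw [min_self, if_pos (by simp), min_eq_right (by omega)]
          · rw [min_eq_left h, if_neg (Nat.mul_pos (by omega) hb).ne', min_eq_left h']
    rw [this, min_eq_right]
    rw [hn]
    exact Nat.le_mul_of_pos_right _ hb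

variable [Field k]

open Classical in
theorem IsPoly.ite_isLinear {s : FieldData k} {f : MvPolynomial (Fin 2) k} (hs : IsPoly s f)
    (p q : FieldData k) : ite (isLinear s) p q = if wdeg 1 1 f ≤ 1 then p else q := by
  rw [isLinear, ite_not, hs.polyDeg,
    show pair FieldData.nil FieldData.nil = (ofNat 1 : FieldData k) from rfl,
    subNat_ofNat, ite_ofNat]
  exact if_congr (by omega) rfl rfl

open Classical in
theorem IsAut.ite_isAffine {s : FieldData k} {φ : PlaneAut k} (hs : IsAut s φ)
    (p q : FieldData k) : ite (isAffine s) p q = if φ.IsAffine then p else q := by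
  obtain ⟨a, b, rfl, ha, hb⟩ := hs
  rw [isAffine, ite_and]
  change ite (isLinear a) (ite (isLinear b) p q) q = _
  rw [ha.ite_isLinear, hb.ite_isLinear]
  have : φ.IsAffine ↔ wdeg 1 1 (φ.component 0) ≤ 1 ∧ wdeg 1 1 (φ.component 1) ≤ 1 :=
    ⟨fun h => ⟨h.wdeg_le_one 0, h.wdeg_le_one 1⟩, fun h => PlaneAut.isAffine_of_wdeg fun i => by
      fin_cases i
      · exact h.1
      · exact h.2⟩
  simp only [this]
  split_ifs <;> first | rfl | omega

open Classical in
theorem IsAut.ite_isLine {s : FieldData k} {φ : PlaneAut k} (hs : IsAut s φ)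
    (p q : FieldData k) : ite (isLine s.snd) p q = if φ.IsDeJonquieres then p else q := by
  obtain ⟨a, b, rfl, ha, hb⟩ := hs
  change ite (isLine b) p q = _
  rw [hb.ite_isLine]
  exact if_congr PlaneAut.isDeJonquieres_iff.symm rfl rfl

theorem IsPoly.exists_findTop {s : FieldData k} {f : MvPolynomial (Fin 2) k} (hs : IsPoly s f)
    (d : ℕ) : (findTop s (ofNat d) = FieldData.nil ∧ ∀ e ∈ f.support, e 0 + e 1 ≠ d) ∨
      ∃ t, findTop s (ofNat d) = ofTerm t ∧ expo t.1 t.2.1 ∈ f.support ∧ t.1 + t.2.1 = d := by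
  classical
  have key : ∀ (l : TermList k) (a : FieldData k), (fold (fun t acc => ite (isNull s t) acc
      (ite (eqNat (addNat t.fst t.snd.fst) (ofNat d)) t acc)) l.toData a = a ∧
        ∀ t ∈ l, expo t.1 t.2.1 ∈ f.support → t.1 + t.2.1 ≠ d) ∨
      ∃ t, fold (fun t acc => ite (isNull s t) acc
      (ite (eqNat (addNat t.fst t.snd.fst) (ofNat d)) t acc)) l.toData a = ofTerm t ∧
        expo t.1 t.2.1 ∈ f.support ∧ t.1 + t.2.1 = d := by
    intro l
    induction l with
    | nil => intro a; exact Or.inl ⟨rfl, by simp⟩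
    | cons b l ih =>
      intro a
      have h : ite (isNull s (ofTerm b)) a
          (ite (eqNat (addNat (ofTerm b).fst (ofTerm b).snd.fst) (ofNat d)) (ofTerm b) a)
          = if expo b.1 b.2.1 ∈ f.support ∧ b.1 + b.2.1 = d then ofTerm b else a := by
        rw [hs.ite_isNull]
        change (if _ then ite (eqNat (addNat (ofNat b.1) (ofNat b.2.1)) (ofNat d)) _ _
          else _) = _
        rw [addNat_ofNat, ite_eqNat]
        split_ifs <;> first | rfl | (exfalso; simp_all)
      rw [toData_cons, fold, h]
      rcases ih (if expo b.1 b.2.1 ∈ f.support ∧ b.1 + b.2.1 = d then ofTerm b else a) with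
        ⟨h1, h2⟩ | h1
      · rw [h1]
        split_ifs with hb
        · exact Or.inr ⟨b, rfl, hb⟩
        · refine Or.inl ⟨rfl, fun t ht hmem => ?_⟩
          rcases List.mem_cons.1 ht with rfl | ht
          · exact fun h => hb ⟨hmem, h⟩
          · exact h2 t ht hmem
      · exact Or.inr h1
  obtain ⟨l, hl, hlf⟩ := hs
  rw [findTop]
  nth_rewrite 2 [hl]
  nth_rewrite 3 [hl]
  refine (key l FieldData.nil).imp (And.imp_right fun h e he => ?_) id
  obtain ⟨t, ht, rfl⟩ := exists_term_of_mem_support l (hlf ▸ he)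
  rw [expo_zero, expo_one]
  exact h t ht he

theorem IsPoly.ratio_ofTerm {s t : FieldData k} {f g : MvPolynomial (Fin 2) k} (hs : IsPoly s f)
    (ht : IsPoly t g) (r : ℕ × ℕ × k) : ratio s t (ofTerm r)
      = atom (f.coeff (expo r.1 r.2.1) * (g.coeff (expo r.1 r.2.1))⁻¹) := by
  rw [ratio]
  change mul (FieldData.polyCoeff s (ofNat r.1) (ofNat r.2.1))
    (inv (FieldData.polyCoeff t (ofNat r.1) (ofNat r.2.1))) = _
  rw [hs.polyCoeff, ht.polyCoeff]
  rfl

/-- The default `nil` is read as the exponents `(0, 0)`, so the program still produces a field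
element when no top term is found. -/
theorem IsPoly.ratio_nil {s t : FieldData k} {f g : MvPolynomial (Fin 2) k} (hs : IsPoly s f)
    (ht : IsPoly t g) : ratio s t FieldData.nil
      = atom (f.coeff (expo 0 0) * (g.coeff (expo 0 0))⁻¹) := by
  rw [ratio]
  change mul (FieldData.polyCoeff s (ofNat 0) (ofNat 0))
    (inv (FieldData.polyCoeff t (ofNat 0) (ofNat 0))) = _
  rw [hs.polyCoeff, ht.polyCoeff]
  rfl

theorem isAut_shear (c : k) (m : ℕ) : IsAut (shear (ofNat m) (atom c)) (PlaneAut.shear c m) := by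
  refine ⟨_, _, rfl, ?_, ?_⟩
  · rw [PlaneAut.shear_component_zero]
    exact ((IsPoly.nil.cons 0 m (-c)).cons 1 0 1).congr rfl (by simp [sub_eq_add_neg])
  · rw [PlaneAut.shear_component_one]
    exact (IsPoly.nil.cons 0 1 1).congr rfl (by simp)

theorem isAut_swap : IsAut (swap : FieldData k) PlaneAut.swap := by
  refine ⟨_, _, rfl, ?_, ?_⟩
  · rw [PlaneAut.swap_component_zero]
    exact (IsPoly.nil.cons 0 1 1).congr rfl (by simp)
  · rw [PlaneAut.swap_component_one]
    exact (IsPoly.nil.cons 1 0 1).congr rfl (by simp)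

/-- The datum `st` is a written-out form of `θ` together with its inverse. -/
def IsState (st : FieldData k) (θ : PlaneAut k) : Prop :=
  ∃ a b, st = pair a b ∧ IsAut a θ ∧ IsAut b θ⁻¹

theorem isState_start : IsState (start : FieldData k) 1 := by
  have h : IsAut (start : FieldData k).fst 1 := by
    refine ⟨_, _, rfl, ?_, ?_⟩
    · exact (IsPoly.nil.cons 1 0 1).congr rfl (by simp [PlaneAut.component])
    · exact (IsPoly.nil.cons 0 1 1).congr rfl (by simp [PlaneAut.component])
  exact ⟨_, _, rfl, h, by rw [inv_one]; exact h⟩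

theorem IsState.conj {st s : FieldData k} {θ g : PlaneAut k} (hst : IsState st θ)
    (hs : IsAut s g) : IsAut (conj s st) (θ * g * θ⁻¹) := by
  obtain ⟨a, b, rfl, ha, hb⟩ := hst
  rw [mul_assoc]
  exact ha.autMul (hs.autMul hb)

theorem IsState.update {st s t : FieldData k} {θ e : PlaneAut k} (hst : IsState st θ)
    (hs : IsAut s e) (ht : IsAut t e⁻¹) : IsState (update s t st) (e * θ) := by
  obtain ⟨a, b, rfl, ha, hb⟩ := hst
  exact ⟨_, _, rfl, hs.autMul ha, by rw [mul_inv_rev]; exact hb.autMul ht⟩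

theorem IsState.update_swap {st : FieldData k} {θ : PlaneAut k} (hst : IsState st θ) :
    IsState (FieldData.update swap swap st) (PlaneAut.swap * θ) :=
  hst.update isAut_swap (by rw [PlaneAut.swap_inv]; exact isAut_swap)

theorem IsState.updateShear {st : FieldData k} {θ : PlaneAut k} (hst : IsState st θ) (c : k)
    (m : ℕ) : IsState (updateShear (ofNat m) (atom c) st) (PlaneAut.shear c m * θ) :=
  hst.update (isAut_shear c m) (by rw [PlaneAut.shear_inv]; exact isAut_shear (-c) m)

/-- The shear found by the program is the one predicted by the edge of `g`. -/
theorem IsState.exists_reduceShear {st s : FieldData k} {θ g : PlaneAut k} (hst : IsState st θ)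
    (hs : IsAut s g) : ∃ m c, IsState (reduceShear s st) (PlaneAut.shear c m * θ) ∧
      ∀ m' c', wdeg 1 1 (g.component 0) = m' * wdeg 1 1 (g.component 1) →
        wdeg 1 1 (g.component 0 - C c' * g.component 1 ^ m') < wdeg 1 1 (g.component 0) →
        m = m' ∧ c = c' := by
  obtain ⟨a, b, rfl, ha, hb⟩ := hs
  obtain ⟨m, hm, hm'⟩ := exists_findExp (k := k) (wdeg 1 1 (g.component 0))
    (wdeg 1 1 (g.component 1))
  have e : ∀ c, ratio a (FieldData.polyPow b (ofNat m))
      (findTop a (ofNat (wdeg 1 1 (g.component 0)))) = atom c →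
      reduceShear (pair a b) st = FieldData.updateShear (ofNat m) (atom c) st := by
    intro c hc
    rw [reduceShear]
    change FieldData.updateShear (findExp (polyDeg a) (polyDeg b)) (ratio a
      (FieldData.polyPow b (findExp (polyDeg a) (polyDeg b))) (findTop a (polyDeg a))) st = _
    rw [ha.polyDeg, hb.polyDeg, hm, hc]
  have hpos := g.wdeg_component_pos one_pos one_pos
  rcases ha.exists_findTop (wdeg 1 1 (g.component 0)) with ⟨h, hno⟩ | ⟨t, h, ht, htd⟩
  · refine ⟨m, (g.component 0).coeff (expo 0 0) * ((g.component 1 ^ m).coeff (expo 0 0))⁻¹, ?_,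
      fun m' c' _ _ => ?_⟩
    · rw [e _ (by rw [h]; exact ha.ratio_nil (hb.polyPow m))]
      exact hst.updateShear _ m
    · exfalso
      have hne : g.component 0 ≠ 0 := fun h0 => by
        have := hpos 0
        rw [h0, ← C_0, wdeg_C] at this
        exact lt_irrefl _ this
      obtain ⟨d, hd, hd'⟩ := exists_mem_support_eq_wdeg (α := 1) one_pos hne
      rw [one_mul, one_mul] at hd'
      exact hno d hd hd'
  · refine ⟨m, (g.component 0).coeff (expo t.1 t.2.1) *
      ((g.component 1 ^ m).coeff (expo t.1 t.2.1))⁻¹, ?_, fun m' c' h1 h2 => ?_⟩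
    · rw [e _ (by rw [h]; exact ha.ratio_ofTerm (hb.polyPow m) t)]
      exact hst.updateShear _ m
    · obtain rfl := hm' m' (hpos 1) h1
      refine ⟨rfl, ?_⟩
      -- The drop in degree annihilates the coefficient at the chosen top monomial; this makes the
      -- computed ratio equal to `c'`.
      have h3 : (g.component 0 - C c' * g.component 1 ^ m).coeff (expo t.1 t.2.1) = 0 := by
        by_contra hne
        have := le_wdeg (α := 1) one_pos (mem_support_iff.2 hne)
        rw [expo_zero, expo_one] at this
        omega
      rw [coeff_sub, coeff_C_mul, sub_eq_zero] at h3
      rw [mem_support_iff] at ht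
      rw [h3] at ht ⊢
      rw [mul_assoc, mul_inv_cancel₀ (right_ne_zero_of_mul ht), mul_one]

/-- The elementary automorphism is chosen before the set `S`: the program acts on `g` alone, and a
preserved degree enters only in the analysis. -/
theorem IsState.exists_reduceWith {st s : FieldData k} {θ g : PlaneAut k} (hst : IsState st θ)
    (hs : IsAut s g) : ∃ e, IsState (reduceWith s st) (e * θ) ∧
      ∀ S, PlaneAut.PreservesDegree S → g ∈ S →
        (∀ f ∈ S, (f.IsAffine ∨ f.IsDeJonquieres) →
          (e * f * e⁻¹).IsAffine ∨ (e * f * e⁻¹).IsDeJonquieres) ∧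
        ((g.IsAffine ∨ g.IsDeJonquieres) ∨
          PlaneAut.complexity (e * g * e⁻¹) < PlaneAut.complexity g) := by
  rw [reduceWith, hs.ite_isAffine, hs.ite_isLine]
  by_cases hA : g.IsAffine
  · rw [if_pos hA]
    exact ⟨1, by rwa [one_mul], fun S _ _ => ⟨fun f _ hf => by simpa using hf, Or.inl (Or.inl hA)⟩⟩
  rw [if_neg hA]
  by_cases hJ : g.IsDeJonquieres
  · rw [if_pos hJ]
    exact ⟨1, by rwa [one_mul], fun S _ _ => ⟨fun f _ hf => by simpa using hf, Or.inl (Or.inr hJ)⟩⟩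
  rw [if_neg hJ]
  have hsub : subNat (polyDeg s.snd) (polyDeg s.fst)
      = ofNat (wdeg 1 1 (g.component 1) - wdeg 1 1 (g.component 0)) := by
    obtain ⟨a, b, rfl, ha, hb⟩ := hs
    change subNat (polyDeg b) (polyDeg a) = _
    rw [ha.polyDeg, hb.polyDeg, subNat_ofNat]
  rw [hsub, ite_ofNat]
  by_cases hlt : wdeg 1 1 (g.component 0) < wdeg 1 1 (g.component 1)
  · rw [if_neg (by omega)]
    refine ⟨_, hst.update_swap, fun S hS hg => ?_⟩
    rcases hS.step hg hA hJ with ⟨-, h1, h2⟩ | ⟨m, c, hm, -, h1, -⟩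
    · exact ⟨h2, Or.inr h1⟩
    · have := Nat.le_mul_of_pos_left (wdeg 1 1 (g.component 1)) hm
      omega
  · rw [if_pos (by omega)]
    obtain ⟨m, c, h, huniq⟩ := hst.exists_reduceShear hs
    refine ⟨_, h, fun S hS hg => ?_⟩
    rcases hS.step hg hA hJ with ⟨h1, -⟩ | ⟨m', c', -, -, h1, h2, h3, h4⟩
    · exact absurd h1 hlt
    · obtain ⟨rfl, rfl⟩ := huniq m' c' h1 h2
      exact ⟨h4, Or.inr h3⟩

/-- Iterated simplification steps make the conjugate of `g` good, provided that they are numerous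
enough, and keep all good conjugates good. -/
theorem IsState.exists_iterate_reduceStep {s : FieldData k} {g : PlaneAut k} (hs : IsAut s g)
    (n : ℕ) {st : FieldData k} {θ : PlaneAut k} (hst : IsState st θ) :
    ∃ θ', IsState ((reduceStep s)^[n] st) θ' ∧
      ∀ S, PlaneAut.PreservesDegree S → g ∈ S →
        (∀ f ∈ S, ((θ * f * θ⁻¹).IsAffine ∨ (θ * f * θ⁻¹).IsDeJonquieres) →
          (θ' * f * θ'⁻¹).IsAffine ∨ (θ' * f * θ'⁻¹).IsDeJonquieres) ∧
        (PlaneAut.complexity (θ * g * θ⁻¹) ≤ n →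
          (θ' * g * θ'⁻¹).IsAffine ∨ (θ' * g * θ'⁻¹).IsDeJonquieres) := by
  induction n generalizing st θ with
  | zero =>
    refine ⟨θ, hst, fun S _ _ => ⟨fun f _ hf => hf, fun h => ?_⟩⟩
    -- The complexity is always positive, so the base case of the bound is vacuous.
    have := (θ * g * θ⁻¹).wdeg_component_pos one_pos one_pos 0
    rw [PlaneAut.complexity] at h
    omega
  | succ n ih =>
    obtain ⟨e, h1, h2⟩ := hst.exists_reduceWith (hst.conj hs)
    obtain ⟨θ', h3, h4⟩ := ih h1
    refine ⟨θ', h3, fun S hS hg => ?_⟩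
    -- The step is applied to the conjugated set, which preserves the transported degree.
    obtain ⟨h5, h6⟩ := h2 _ (hS.conj θ) ⟨g, hg, rfl⟩
    obtain ⟨h7, h8⟩ := h4 S hS hg
    have hc : ∀ f, e * (θ * f * θ⁻¹) * e⁻¹ = e * θ * f * (e * θ)⁻¹ := fun f => by group
    have h9 : ∀ f ∈ S, ((θ * f * θ⁻¹).IsAffine ∨ (θ * f * θ⁻¹).IsDeJonquieres) →
          (θ' * f * θ'⁻¹).IsAffine ∨ (θ' * f * θ'⁻¹).IsDeJonquieres := fun f hf hf' => by
      have := h5 _ ⟨f, hf, rfl⟩ hf'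
      rw [hc] at this
      exact h7 f hf this
    refine ⟨h9, fun hn => ?_⟩
    rcases h6 with h6 | h6
    · exact h9 g hg h6
    · rw [hc] at h6
      exact h8 (by omega)

theorem IsState.exists_reduce {st s : FieldData k} {θ g : PlaneAut k} (hst : IsState st θ)
    (hs : IsAut s g) : ∃ θ', IsState (reduce s st) θ' ∧
      ∀ S, PlaneAut.PreservesDegree S → g ∈ S →
        (∀ f ∈ S, ((θ * f * θ⁻¹).IsAffine ∨ (θ * f * θ⁻¹).IsDeJonquieres) →
          (θ' * f * θ'⁻¹).IsAffine ∨ (θ' * f * θ'⁻¹).IsDeJonquieres) ∧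
        ((θ' * g * θ'⁻¹).IsAffine ∨ (θ' * g * θ'⁻¹).IsDeJonquieres) := by
  have hf : ∃ n, fuel (FieldData.conj s st) = ofNat n ∧
      PlaneAut.complexity (θ * g * θ⁻¹) ≤ n := by
    obtain ⟨a, b, hab, ha, hb⟩ := hst.conj hs
    rw [hab]
    set d0 := wdeg 1 1 ((θ * g * θ⁻¹).component 0) with hd0
    set d1 := wdeg 1 1 ((θ * g * θ⁻¹).component 1) with hd1
    refine ⟨(d0 + d1) + (d0 + d1) + 1, ?_, ?_⟩
    · rw [fuel]
      change pair FieldData.nil (addNat (addNat (polyDeg a) (polyDeg b))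
        (addNat (polyDeg a) (polyDeg b))) = _
      rw [ha.polyDeg, hb.polyDeg, addNat_ofNat, addNat_ofNat]
      rfl
    · rw [PlaneAut.complexity, ← hd0, ← hd1]
      split_ifs <;> omega
  obtain ⟨n, hn, hle⟩ := hf
  obtain ⟨θ', h1, h2⟩ := IsState.exists_iterate_reduceStep hs n hst
  refine ⟨θ', ?_, fun S hS hg => ?_⟩
  · rw [reduce, hn, fold_ofNat]
    exact h1
  · obtain ⟨h3, h4⟩ := h2 S hS hg
    exact ⟨h3, h4 hle⟩

/-- Goodness of all of `S` is carried along, not only of the remaining generators, so that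
generators treated earlier are not spoiled later. -/
theorem exists_search {S : Set (PlaneAut k)} {ss : List (FieldData k)} {gs : List (PlaneAut k)}
    (h : List.Forall₂ IsAut ss gs) (hgs : ∀ g ∈ gs, g ∈ S) {st : FieldData k} {θ : PlaneAut k}
    (hst : IsState st θ) : ∃ θ', IsState (fold (fun s st => reduce s st) (ofList ss) st) θ' ∧
      (PlaneAut.PreservesDegree S →
        (∀ f ∈ S, ((θ * f * θ⁻¹).IsAffine ∨ (θ * f * θ⁻¹).IsDeJonquieres) →
          (θ' * f * θ'⁻¹).IsAffine ∨ (θ' * f * θ'⁻¹).IsDeJonquieres) ∧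
        ∀ g ∈ gs, (θ' * g * θ'⁻¹).IsAffine ∨ (θ' * g * θ'⁻¹).IsDeJonquieres) := by
  induction h generalizing st θ with
  | nil => exact ⟨θ, hst, fun _ => ⟨fun f _ hf => hf, by simp⟩⟩
  | @cons s g ss gs hs _ ih =>
    obtain ⟨θ₁, h1, h2⟩ := hst.exists_reduce hs
    obtain ⟨θ', h3, h4⟩ := ih (fun g hg => hgs g (List.mem_cons_of_mem _ hg)) h1
    have hg := hgs g List.mem_cons_self
    refine ⟨θ', h3, fun hS => ?_⟩
    obtain ⟨h5, h6⟩ := h2 S hS hg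
    obtain ⟨h7, h8⟩ := h4 hS
    refine ⟨fun f hf hf' => h7 f hf (h5 f hf hf'), fun f hf => ?_⟩
    rcases List.mem_cons.1 hf with rfl | hf
    · exact h7 _ hg h6
    · exact h8 f hf

open Classical in
theorem fold_test {ss : List (FieldData k)} {gs : List (PlaneAut k)}
    (h : List.Forall₂ IsAut ss gs) {test : FieldData k → FieldData k} {P : PlaneAut k → Prop}
    (htest : ∀ {s g}, IsAut s g → ∀ p q, ite (test s) p q = if P g then p else q)
    (p q : FieldData k) : ite (fold (fun s acc => ite (test s) acc nil) (ofList ss) yes) p q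
      = if ∀ g ∈ gs, P g then p else q := by
  have key : ∀ acc, fold (fun s acc => ite (test s) acc nil) (ofList ss) acc
      = if ∀ g ∈ gs, P g then acc else nil := by
    induction h with
    | nil => intro acc; simp [ofList, fold]
    | @cons s g ss gs hs _ ih =>
      intro acc
      rw [ofList, fold, ih, htest hs]
      by_cases h1 : P g <;> simp [h1]
  rw [key]
  split_ifs <;> rfl

open Classical in
theorem IsState.answer_eq {ss : List (FieldData k)} {gs : List (PlaneAut k)}
    (h : List.Forall₂ IsAut ss gs) {st : FieldData k} {θ : PlaneAut k} (hst : IsState st θ) :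
    answer (ofList ss) st
      = if θ.IsConjugator (Subgroup.closure {g | g ∈ gs}) then pair nil st.fst else nil := by
  rw [answer, allAffine, allLine,
    fold_test h (P := fun g => (θ * g * θ⁻¹).IsAffine) (fun hs => (hst.conj hs).ite_isAffine),
    fold_test h (test := fun s => isLine (FieldData.conj s st).snd)
      (P := fun g => (θ * g * θ⁻¹).IsDeJonquieres) (fun hs => (hst.conj hs).ite_isLine)]
  simp only [PlaneAut.isConjugator_closure_iff, Set.mem_ofPred_eq]
  by_cases h1 : ∀ g ∈ gs, (θ * g * θ⁻¹).IsAffine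
  · rw [if_pos h1, if_pos (Or.inl h1)]
  · by_cases h2 : ∀ g ∈ gs, (θ * g * θ⁻¹).IsDeJonquieres
    · rw [if_neg h1, if_pos h2, if_pos (Or.inr h2)]
    · rw [if_neg h1, if_neg h2, if_neg (not_or.2 ⟨h1, h2⟩)]

theorem findConjugator_spec {ss : List (FieldData k)} {gs : List (PlaneAut k)}
    (h : List.Forall₂ IsAut ss gs) :
    ((¬ ∃ θ : PlaneAut k, θ.IsConjugator (Subgroup.closure {g | g ∈ gs})) ∧
        findConjugator (ofList ss) = nil) ∨
      ∃ θ : PlaneAut k, ∃ s, θ.IsConjugator (Subgroup.closure {g | g ∈ gs}) ∧ IsAut s θ ∧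
        findConjugator (ofList ss) = pair nil s := by
  obtain ⟨θ, hst, hθ⟩ := exists_search (S := {g | g ∈ gs}) h (fun _ hg => hg) isState_start
  rw [findConjugator, search, hst.answer_eq h]
  by_cases hc : θ.IsConjugator (Subgroup.closure {g | g ∈ gs})
  · rw [if_pos hc]
    obtain ⟨a, b, hab, ha, -⟩ := hst
    exact Or.inr ⟨θ, _, hc, by rw [hab]; exact ha, rfl⟩
  · rw [if_neg hc]
    -- Any conjugator `θ₀` yields a preserved degree; then all conjugates found by the search are
    -- good and lie in a common factor, so the final test could not have failed.
    refine Or.inl ⟨fun ⟨θ₀, h₀⟩ => hc ?_, rfl⟩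
    have hS := h₀.preservesDegree
    have hall := (hθ hS).2
    rw [PlaneAut.isConjugator_closure_iff]
    refine ((hS.conj θ).forall_or_forall ?_).imp (fun H g hg => H _ ⟨g, hg, rfl⟩)
      (fun H g hg => H _ ⟨g, hg, rfl⟩)
    rintro _ ⟨g, hg, rfl⟩
    exact hall g hg

theorem isAut_pairToData {φ : PlaneAut k} {w : TermList k × TermList k} (h : φ.PresentedBy w) :
    IsAut (TermList.pairToData w) φ :=
  ⟨_, _, rfl, ⟨_, rfl, h.1.symm⟩, ⟨_, rfl, h.2.symm⟩⟩

theorem IsAut.exists_presentedBy {s : FieldData k} {φ : PlaneAut k} (h : IsAut s φ) :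
    ∃ w, φ.PresentedBy w ∧ s = TermList.pairToData w := by
  obtain ⟨a, b, rfl, ⟨l, rfl, hl⟩, ⟨l', rfl, hl'⟩⟩ := h
  exact ⟨(l, l'), ⟨hl.symm, hl'.symm⟩, rfl⟩

end FieldData

theorem mainTheorem3 :
    ∃ P : FieldProg, ∀ (k : Type*) [Field k] (gs : List (PlaneAut k))
      (ws : List (TermList k × TermList k)), List.Forall₂ PlaneAut.PresentedBy gs ws →
      ∃ out ∈ P.eval (FieldData.ofList (ws.map TermList.pairToData)),
        ((¬ ∃ θ : PlaneAut k, θ.IsConjugator (Subgroup.closure {g | g ∈ gs})) ∧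
            out = FieldData.nil) ∨
          ∃ (θ : PlaneAut k) (w : TermList k × TermList k),
            θ.IsConjugator (Subgroup.closure {g | g ∈ gs}) ∧ θ.PresentedBy w ∧
              out = FieldData.pair FieldData.nil (TermList.pairToData w) := by
  obtain ⟨P, hP⟩ := IsUniform.findConjugator (F := fun _ _ s => s)
  refine ⟨P, fun k _ gs ws h => ?_⟩
  have h' : List.Forall₂ FieldData.IsAut (ws.map TermList.pairToData) gs := by
    rw [List.forall₂_map_left_iff]
    exact h.flip.imp fun _ _ h => FieldData.isAut_pairToData h
  refine ⟨_, by rw [hP]; exact Part.mem_some _, ?_⟩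
  rcases FieldData.findConjugator_spec h' with h1 | ⟨θ, s, h1, h2, h3⟩
  · exact Or.inl h1
  · obtain ⟨w, hw, rfl⟩ := h2.exists_presentedBy
    exact Or.inr ⟨θ, w, h1, hw, h3⟩
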